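/- **Setting.** Let $X$ be a smooth projective toric variety of dimension $n$ with fan $\Sigma$ in $N_{\mathbb R}$, $N=\mathbb Z^n$, and let $\Sigma(1)=J_1\sqcup\dots\sqcup J_r$ be a nef-partition: with $J_i=\{\rho_{i,1},\dots,\rho_{i,m_i}\}$ (primitive generators), every divisor $E_i=\sum_{j\ge1}D_{i,j}$ is nef. Put $p=\sum_i m_i$, $\rho_{i,0}=0$, $\mathcal I=\{(i,j):1\le i\le r,\ 0\le j\le m_i\}$ and $\mathcal J=\{(i,j)\in\mathcal I: j\ge1\}$. Fix a $\mathbb Z$-basis of $\mathrm{Cl}(X)\cong\mathbb Z^s$ consisting of ample classes, let $\theta_{i,j}=(\theta^1_{i,j},\dots,\theta^s_{i,j})$ be the coordinates of $[D_{i,j}]$ for $j\ge 1$, and let $\theta_{i,0}=\sum_{j\ge1}\theta_{i,j}$. Write $\theta(\sigma)=\sum_k\theta^k\sigma_k$ for $\sigma\in\mathbb C^s$. **GKZ system.** $A$ is the integral $(r+n)\times(r+p)$ matrix with columns $(e_i,\rho_{i,j})$, $(i,j)\in\mathcal I$, and $\beta=(-\tfrac12,\dots,-\tfrac12,0,\dots,0)$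 with $r$ entries $-\frac12$. The system $\mathcal M_A^\beta$ in the variables $x=(x_{i,j})_{(i,j)\in\mathcal I}$ consists of the Euler operators $\sum_c a_{lc}x_c\partial_c-\beta_l$ for all rows $l$ and of the box operators $\partial^{\ell^+}-\partial^{\ell^-}$ for all $\ell^\pm\in\mathbb Z_{\ge0}^{\mathcal I}$ with $A\ell^+=A\ell^-$. **Model and branes.** Let $f_k\in H^0(X,E_k)$, viewed as polynomials in the homogeneous coordinates $\phi_{i,j}$. Consider the $U(1)^s$ gauged linear sigma model with fields $\phi_{i,j}$, $(i,j)\in\mathcal J$ (gauge weight $2\theta_{i,j}$, R-charge $0$) and $z_{i,j}$, $(i,j)\in\mathcal I$ (gauge weight $-\theta_{i,j}$, R-charge $1$), and superpotential $W=\sum_{\mathcal J}z_{i,j}^2\phi_{i,j}+\sum_k z_{k,0}^2f_k(\phi)$. For $J\subset\mathcal J$ let $\mathfrak B_J$ be the equivariant matrix factorization $$\mathbf T_J=\sum_{(i,j)\in J}(z_{i,j}^2\eta_{i,j}+\phi_{i,j}\bar\eta_{i,j})+\sum_{(i,j)\in\mathcal J\setminus J}(z_{i,j}\eta_{i,j}+z_{i,j}\phi_{i,j}\bar\eta_{i,j})+\sum_k(z_{k,0}\eta_{k,0}+z_{k,0}f_k\bar\eta_{k,0})$$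 of $W$ on the exterior algebra with basis $\bar\eta_Iv$, $I\subset\mathcal I$, where $\eta_c,\bar\eta_c$ are contraction and exterior multiplication, $v$ has trivial weights, and $\rho_M,R_M$ are the resulting gauge and R-symmetry actions. Its brane factor is $f_{\mathfrak B_J}(\sigma)=\mathrm{tr}\big(R_M(e^{\mathrm i\pi})\rho_M(e^{2\pi\sigma})\big)$. Denote by $Q_j,R_j$ the gauge weights and R-charges of all the fields and put $$F(\sigma)=\prod_j\Gamma\big(\mathrm iQ_j(\sigma)+\tfrac{R_j}2\big)=\prod_{\mathcal J}\Gamma(2\mathrm i\,\theta_{i,j}(\sigma))\prod_{\mathcal I}\Gamma\big(\tfrac12-\mathrm i\,\theta_{i,j}(\sigma)\big).$$ **Contours.** Let $L=\{x+\mathrm i\,y(x):x\in\mathbb R^s\}\subset\mathbb C^s$ where $y:\mathbb R^s\to\mathbb R^s$ satisfies $\|y(x)-y(x')\|\le C(1+\|x\|+\|x'\|)^{K}\|x-x'\|$ for some $C,K$, and suppose that $L$ is a deformation of $\mathbb R^s$ off the poles of $F$ in the following sense: for every field $j$ there are $c>0$ and $K\ge0$ such that the distance from $\mathrm iQ_j(\sigma)+\frac{R_j}2$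 to $\mathbb R_{\le0}$ is at least $c(1+\|x\|)^{-K}$ for all $\sigma=x+\mathrm iy(x)\in L$. Let $T_{L,J}\subset\mathbb C^s$ be the set of those $t$ for which $L$ is admissible for $\mathfrak B_J$: for every weight $q$ of $\rho_M$, with $$W_{\mathrm{eff},q}(\sigma)=-\sum_jQ_j(\sigma)\big(\log(\mathrm iQ_j(\sigma))-1\big)-\sum_kt_k\sigma_k+2\pi\mathrm i\,q(\sigma),$$ one has $\operatorname{Im}W_{\mathrm{eff},q}(x+\mathrm iy(x))/\log\|x\|\to-\infty$ as $\|x\|\to\infty$. With $t=-\log q$, i.e. $q_k=e^{-t_k}$, define the hemisphere partition function $$Z_{\mathfrak B_J}(q)=\int_LF(\sigma)f_{\mathfrak B_J}(\sigma)\,q_1^{-\mathrm i\sigma_1}\cdots q_s^{-\mathrm i\sigma_s}\,d\sigma=\int_LF(\sigma)f_{\mathfrak B_J}(\sigma)\,e^{\mathrm i\sum_kt_k\sigma_k}\,d\sigma .$$ **Theorem.** Let $U\subset(\mathbb C^*)^{\mathcal I}$ be open, with continuous branches on $U$ of $t_k=-\log q_k$, where $$q_k=\prod_{(i,j)\in\mathcal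 J}(-4x_{i,j})^{\theta^k_{i,j}}\prod_{i=1}^rx_{i,0}^{-\theta^k_{i,0}},$$ and of $\big(\prod_ix_{i,0}\big)^{1/2}$, and suppose that $t(x)$ lies in the interior of $T_{L,J}$ for all $x\in U$. Then, for every subset $J\subset\mathcal J$, the integral defining $Z_{\mathfrak B_J}$ converges absolutely at every $x\in U$, and the function $$\hat Z_{\mathfrak B_J}(x)=\Big(\prod_{i=1}^rx_{i,0}\Big)^{-1/2}Z_{\mathfrak B_J}(q_1,\dots,q_s)$$ is holomorphic on $U$ and is a solution of the GKZ system $\mathcal M_A^\beta$. -/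

import Mathlib

namespace DoubleCoverPeriods

open Filter Topology MeasureTheory

noncomputable section

/-! ### GKZ systems -/

/-- The partial derivative `∂Φ/∂x_j` of a function on `ℂ^m`. -/
def partialDeriv {m : Type*} [Fintype m] [DecidableEq m] (j : m) (Φ : (m → ℂ) → ℂ) :
    (m → ℂ) → ℂ :=
  fun x => fderiv ℂ Φ x (Pi.single j 1)

/-- The operator `∂^ℓ = ∏_j (∂/∂x_j)^{ℓ_j}` (on holomorphic functions the order of the factors
is immaterial). -/
def multiPartial {m : Type*} [Fintype m] [DecidableEq m] (ℓ : m → ℕ) (Φ : (m → ℂ) → ℂ) :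
    (m → ℂ) → ℂ :=
  (Finset.univ : Finset m).toList.foldr (fun j Ψ => (partialDeriv j)^[ℓ j] Ψ) Φ

/-- `Φ` is a holomorphic solution on `U` of the GKZ system with matrix `A` and parameter `β`:
it is killed by the Euler operators `∑_j a_{ij} x_j ∂_j - β_i` and by all box operators
`∂^{ℓ⁺} - ∂^{ℓ⁻}` with `A ℓ⁺ = A ℓ⁻`. -/
structure IsGKZSolution {d m : Type*} [Fintype m] [DecidableEq m]
    (A : Matrix d m ℤ) (β : d → ℂ) (U : Set (m → ℂ)) (Φ : (m → ℂ) → ℂ) : Prop where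
  analytic : AnalyticOnNhd ℂ Φ U
  euler : ∀ x ∈ U, ∀ i, ∑ j, (A i j : ℂ) * x j * partialDeriv j Φ x = β i * Φ x
  box : ∀ ℓp ℓm : m → ℕ,
    A.mulVec (fun j => (ℓp j : ℤ)) = A.mulVec (fun j => (ℓm j : ℤ)) →
    ∀ x ∈ U, multiPartial ℓp Φ x = multiPartial ℓm Φ x

/-! ### Smooth complete toric varieties and nef-partitions -/

/-- The real cone spanned by the vectors `ρ a`, `a ∈ σ`. -/
def rayCone {n p : ℕ} (ρ : Fin p → Fin n → ℤ) (σ : Finset (Fin p)) : Set (Fin n → ℝ) :=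
  {v | ∃ c : Fin p → ℝ, (∀ a, 0 ≤ c a) ∧ (∀ a, a ∉ σ → c a = 0) ∧
    ∀ i, v i = ∑ a, c a * (ρ a i : ℝ)}

/-- A smooth complete fan in `N_ℝ`, `N = ℤ^n`, with `p` rays, given by the primitive generators
of its rays and by its maximal cones (as sets of rays). -/
structure SmoothCompleteFan (n p : ℕ) where
  /-- the primitive generators of the rays -/
  ρ : Fin p → Fin n → ℤ
  /-- the maximal cones -/
  maxCones : Set (Finset (Fin p))
  /-- every maximal cone is spanned by a basis of the lattice `N` -/
  smooth : ∀ σ ∈ maxCones, LinearIndependent ℤ (fun a : σ => ρ a) ∧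
    Submodule.span ℤ (Set.range (fun a : σ => ρ a)) = ⊤
  /-- two maximal cones meet along the common face spanned by their common rays -/
  inter : ∀ σ ∈ maxCones, ∀ τ ∈ maxCones,
    rayCone ρ σ ∩ rayCone ρ τ = rayCone ρ (σ ∩ τ)
  /-- the cones cover `N_ℝ` -/
  complete : ⋃ σ ∈ maxCones, rayCone ρ σ = Set.univ
  /-- every ray belongs to a maximal cone -/
  ray_mem : ∀ a, ∃ σ ∈ maxCones, a ∈ σ

namespace SmoothCompleteFan

variable {n p : ℕ} (X : SmoothCompleteFan n p)

/-- The map `M → ℤ^p`, `m ↦ (⟨m, ρ⟩)_ρ`, sending a character to its divisor. -/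
def principal : (Fin n → ℤ) →ₗ[ℤ] (Fin p → ℤ) :=
  (Matrix.of X.ρ).mulVecLin

/-- The divisor class group `Cl(X)`, the cokernel of `M → ℤ^p`. -/
abbrev Cl : Type := (Fin p → ℤ) ⧸ LinearMap.range X.principal

/-- The class of the torus-invariant divisor `∑ D_ρ · D_ρ`. -/
def divClass : (Fin p → ℤ) →ₗ[ℤ] X.Cl := (LinearMap.range X.principal).mkQ

/-- The torus-invariant divisor `D` is nef (its support function is convex). -/
def IsNef (D : Fin p → ℤ) : Prop :=
  ∀ σ ∈ X.maxCones, ∃ m : Fin n → ℤ,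
    (∀ a ∈ σ, X.principal m a = -D a) ∧ ∀ a, -D a ≤ X.principal m a

/-- The torus-invariant divisor `D` is ample (its support function is strictly convex). -/
def IsAmple (D : Fin p → ℤ) : Prop :=
  ∀ σ ∈ X.maxCones, ∃ m : Fin n → ℤ,
    (∀ a ∈ σ, X.principal m a = -D a) ∧ ∀ a, a ∉ σ → -D a < X.principal m a

/-- A divisor class is ample if it contains an ample torus-invariant divisor. -/
def IsAmpleClass (c : X.Cl) : Prop :=
  ∃ D : Fin p → ℤ, X.divClass D = c ∧ X.IsAmple D

/-- A nef-partition: a partition `J_1 ⊔ ⋯ ⊔ J_r` of the set of rays, `J_k = {a | part a = k}`,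
such that every `E_k = ∑_{ρ ∈ J_k} D_ρ` is nef. -/
structure NefPartition (r : ℕ) where
  /-- the part to which a ray belongs -/
  part : Fin p → Fin r
  /-- each `E_k` is nef -/
  nef : ∀ k, X.IsNef (fun a => if part a = k then 1 else 0)

end SmoothCompleteFan

variable {n p r s : ℕ}

/-- The index set `𝓘 = {(i,j) | 1 ≤ i ≤ r, 0 ≤ j ≤ m_i}`: the pair `(i,j)` with `j ≥ 1` is a
ray (`Sum.inl`), the pair `(i,0)` is the index `i` of a part (`Sum.inr`). -/
abbrev Idx (p r : ℕ) : Type := Fin p ⊕ Fin r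

/-- The vectors `θ_c ∈ ℤ^s`, `c ∈ 𝓘`: for a ray these are the coordinates of the class of `D_ρ` in
the basis `b` of `Cl(X)`, and `θ_{i,0} = ∑_{ρ ∈ J_i} θ_ρ`. -/
def theta (X : SmoothCompleteFan n p) (P : X.NefPartition r)
    (b : Module.Basis (Fin s) ℤ X.Cl) : Idx p r → Fin s → ℤ
  | Sum.inl a => fun k => b.repr (X.divClass (Pi.single a 1)) k
  | Sum.inr i => ∑ a with P.part a = i, fun k => b.repr (X.divClass (Pi.single a 1)) k

/-- The matrix `A` of the GKZ system: the column of index `(i,j)` is `(e_i, ρ_{i,j})`, where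
`ρ_{i,0} = 0`. -/
def gkzMatrix (X : SmoothCompleteFan n p) (P : X.NefPartition r) :
    Matrix (Fin r ⊕ Fin n) (Idx p r) ℤ
  | Sum.inl i, Sum.inl a => if P.part a = i then 1 else 0
  | Sum.inl i, Sum.inr k => if k = i then 1 else 0
  | Sum.inr l, Sum.inl a => X.ρ a l
  | Sum.inr _, Sum.inr _ => 0

/-- The parameter `β = (-1/2, …, -1/2, 0, …, 0)` of the GKZ system. -/
def gkzBeta (r n : ℕ) : Fin r ⊕ Fin n → ℂ
  | Sum.inl _ => -1 / 2
  | Sum.inr _ => 0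

/-! ### Abelian gauged linear sigma models, B-branes, hemisphere partition functions -/

/-- The value of the weight `w ∈ ℤ^s` at `σ ∈ 𝔱_ℂ = ℂ^s`. -/
def pairing (w : Fin s → ℤ) (σ : Fin s → ℂ) : ℂ := ∑ k, (w k : ℂ) * σ k

/-- A nonanomalous GLSM with gauge group `U(1)^s`: chiral matter fields with their gauge weights
`Q_j` and R-charges `R_j`, and a gauge invariant superpotential of R-weight two. -/
structure AbelianGLSM (s : ℕ) where
  Matter : Type
  [fintypeMatter : Fintype Matter]
  charge : Matter → Fin s → ℤ
  rCharge : Matter → ℝ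
  superpotential : MvPolynomial Matter ℂ
  faithful : Submodule.span ℤ (Set.range charge) = ⊤
  nonanomalous : ∑ j, charge j = 0
  gaugeInvariant : MvPolynomial.IsWeightedHomogeneous charge superpotential 0
  rWeight_two : MvPolynomial.IsWeightedHomogeneous rCharge superpotential 2

attribute [instance] AbelianGLSM.fintypeMatter

/-- The algebraic data of a B-brane: a `ℤ/2`-graded free module of finite rank over the polynomial
ring in the matter fields, with a homogeneous basis on which the gauge torus and the R-symmetry act
through the given weights, and an odd endomorphism `T` with `T² = W`. The equivariance conditions
`ρ_M(g)⁻¹ T(g·φ) ρ_M(g) = T(φ)` and `R_M(λ) T(R(λ)φ) R_M(λ)⁻¹ = λ T(φ)` are written out for the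
matrix entries. -/
structure Brane (G : AbelianGLSM s) where
  ι : Type
  [fintypeι : Fintype ι]
  [decEqι : DecidableEq ι]
  parity : ι → ZMod 2
  gaugeWeight : ι → Fin s → ℤ
  rWeight : ι → ℚ
  T : Matrix ι ι (MvPolynomial G.Matter ℂ)
  odd : ∀ a b, T a b ≠ 0 → parity a = parity b + 1
  sq : T * T = Matrix.scalar ι G.superpotential
  gaugeEquivariant : ∀ a b, MvPolynomial.IsWeightedHomogeneous G.charge (T a b)
    (gaugeWeight a - gaugeWeight b)
  rEquivariant : ∀ a b, MvPolynomial.IsWeightedHomogeneous G.rCharge (T a b)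
    (1 + (rWeight b : ℝ) - (rWeight a : ℝ))

attribute [instance] Brane.fintypeι Brane.decEqι

/-- The matrix of `ρ_M(e^{2πσ})` in the homogeneous basis. -/
def Brane.gaugeMatrix {G : AbelianGLSM s} (B : Brane G) (σ : Fin s → ℂ) : Matrix B.ι B.ι ℂ :=
  Matrix.diagonal fun a => Complex.exp (2 * Real.pi * pairing (B.gaugeWeight a) σ)

/-- The matrix of `R_M(e^{iα})` in the homogeneous basis. -/
def Brane.rMatrix {G : AbelianGLSM s} (B : Brane G) (α : ℝ) : Matrix B.ι B.ι ℂ :=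
  Matrix.diagonal fun a => Complex.exp (Complex.I * α * (B.rWeight a : ℂ))

/-- The brane factor `f_𝔅(σ) = tr_M (R_M(e^{iπ}) ρ_M(e^{2πσ}))`. -/
def Brane.factor {G : AbelianGLSM s} (B : Brane G) (σ : Fin s → ℂ) : ℂ :=
  (B.rMatrix Real.pi * B.gaugeMatrix σ).trace

/-- The argument `i Q_j(σ) + R_j / 2` of the Gamma function attached to the matter field `j`. -/
def AbelianGLSM.gammaArg (G : AbelianGLSM s) (j : G.Matter) (σ : Fin s → ℂ) : ℂ :=
  Complex.I * pairing (G.charge j) σ + (G.rCharge j : ℂ) / 2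

/-- The product `F(σ) = ∏_j Γ(i Q_j(σ) + R_j / 2)`. -/
def AbelianGLSM.gammaProduct (G : AbelianGLSM s) (σ : Fin s → ℂ) : ℂ :=
  ∏ j, Complex.Gamma (G.gammaArg j σ)

/-- The boundary effective twisted superpotential
`W_{eff,q}(σ) = - ∑_j Q_j(σ) (log (i Q_j(σ)) - 1) - t(σ) + 2πi q(σ)`
(the energy scale drops out for a nonanomalous model). -/
def AbelianGLSM.effPotential (G : AbelianGLSM s) (q : Fin s → ℤ) (t σ : Fin s → ℂ) : ℂ :=
  -(∑ j, pairing (G.charge j) σ *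
      (Complex.log (Complex.I * pairing (G.charge j) σ) - 1))
    - ∑ k, t k * σ k + 2 * Real.pi * Complex.I * pairing q σ

/-- The point `x + i y(x)` of the contour that is the graph of `y`. -/
def graphPoint (y : (Fin s → ℝ) → (Fin s → ℝ)) (x : Fin s → ℝ) : Fin s → ℂ :=
  fun k => (x k : ℂ) + Complex.I * (y x k : ℂ)

/-- The Jacobian determinant `det (1 + i Dy)` of the parametrization `x ↦ x + i y(x)`. -/
def graphJacobian (y : (Fin s → ℝ) → (Fin s → ℝ)) (x : Fin s → ℝ) : ℂ :=
  (Matrix.of fun j k : Fin s =>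
    (if j = k then (1 : ℂ) else 0) + Complex.I * (fderiv ℝ y x (Pi.single k 1) j : ℂ)).det

/-- The contour `L = {x + i y(x)}` is a tempered deformation of the real contour off the polar
hyperplanes of the Gamma functions: `y` is locally Lipschitz with polynomially growing constant,
and along `L` no argument `i Q_j(σ) + R_j / 2` of a Gamma function reaches the ray `ℝ_{≤ 0}`
(so that scaling down to the real contour, with the R-charges `R_j = 0` understood as small positive
numbers, meets no pole), its distance from that ray being bounded below by a negative power. -/
structure AbelianGLSM.IsContour (G : AbelianGLSM s) (y : (Fin s → ℝ) → (Fin s → ℝ)) : Prop where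
  lipschitz : ∃ C : ℝ, ∃ N : ℕ, ∀ x x',
    ‖y x - y x'‖ ≤ C * (1 + ‖x‖ + ‖x'‖) ^ N * ‖x - x'‖
  avoids : ∀ j, ∃ c : ℝ, 0 < c ∧ ∃ N : ℕ, ∀ x, ∀ u : ℝ, u ≤ 0 →
    c ≤ (1 + ‖x‖) ^ N * ‖G.gammaArg j (graphPoint y x) - (u : ℂ)‖

/-- The set of FI-theta parameters `t` for which the contour is admissible for the brane: for all
weights `q` of `ρ_M`, the imaginary part of `W_{eff,q}`, which is the logarithm of the absolute value
of `exp (-i W_{eff,q})`, tends to `-∞` along the contour, faster than every multiple of the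
logarithm. -/
def Brane.admissibleParams {G : AbelianGLSM s} (B : Brane G)
    (y : (Fin s → ℝ) → (Fin s → ℝ)) : Set (Fin s → ℂ) :=
  {t | ∀ a : B.ι, Tendsto
    (fun x => (G.effPotential (B.gaugeWeight a) t (graphPoint y x)).im / Real.log ‖x‖)
    (cocompact (Fin s → ℝ)) atBot}

/-- The integrand `F(σ) f_𝔅(σ) e^{i t(σ)} dσ` of the hemisphere partition function, pulled back to
`ℝ^s` along `x ↦ x + i y(x)`. -/
def Brane.integrand {G : AbelianGLSM s} (B : Brane G) (y : (Fin s → ℝ) → (Fin s → ℝ))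
    (t : Fin s → ℂ) (x : Fin s → ℝ) : ℂ :=
  G.gammaProduct (graphPoint y x) * B.factor (graphPoint y x) *
    Complex.exp (Complex.I * ∑ k, t k * graphPoint y x k) * graphJacobian y x

/-- The hemisphere partition function (central charge) of the brane, as a function of
`t = - log q` on the universal cover of the torus of the `q_k`:
`∫_L F(σ) f_𝔅(σ) ∏_k q_k^{-i σ_k} dσ`. -/
def Brane.hemisphere {G : AbelianGLSM s} (B : Brane G) (y : (Fin s → ℝ) → (Fin s → ℝ))
    (t : Fin s → ℂ) : ℂ :=
  ∫ x, B.integrand y t x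

/-! ### Creation and annihilation matrices -/

section Clifford

variable {p r : ℕ} {S : Type*} [CommRing S]

/-- The sign `(-1)^{#{b ∈ I | b < c}}` for the lexicographic order of the index set. -/
def cliffSign (c : Idx p r) (I : Finset (Idx p r)) : ℤ :=
  (-1) ^ (I.filter fun b => finSumFinEquiv b < finSumFinEquiv c).card

/-- The matrix of the contraction `η_c` in the basis `η̄_I v`, `I ⊆ 𝓘`, of the exterior algebra. -/
def eta (c : Idx p r) : Matrix (Finset (Idx p r)) (Finset (Idx p r)) S :=
  fun K I => if c ∈ I ∧ K = I.erase c then (cliffSign c I : S) else 0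

/-- The matrix of the exterior multiplication `η̄_c` in the basis `η̄_I v`, `I ⊆ 𝓘`. -/
def etaBar (c : Idx p r) : Matrix (Finset (Idx p r)) (Finset (Idx p r)) S :=
  fun K I => if c ∉ I ∧ K = insert c I then (cliffSign c I : S) else 0

/-- The endomorphism `∑_c (α_c η_c + γ_c η̄_c)`. -/
def cliffordMatrix (α γ : Idx p r → S) : Matrix (Finset (Idx p r)) (Finset (Idx p r)) S :=
  ∑ c, (α c • eta c + γ c • etaBar c)

theorem cliffordMatrix_apply (α γ : Idx p r → S) (K I : Finset (Idx p r)) :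
    cliffordMatrix α γ K I = ∑ c, if K = symmDiff I {c} then
      (cliffSign c I : S) * (if c ∈ I then α c else γ c) else 0 := by
  rw [cliffordMatrix, Matrix.sum_apply]
  refine Finset.sum_congr rfl fun c _ => ?_
  by_cases hc : c ∈ I
  · have h : symmDiff I {c} = I.erase c := by
      ext b; simp only [Finset.mem_symmDiff, Finset.mem_singleton, Finset.mem_erase]; grind
    simp [eta, etaBar, hc, h, mul_comm]
  · have h : symmDiff I {c} = insert c I := by
      ext b; simp only [Finset.mem_symmDiff, Finset.mem_singleton, Finset.mem_insert]; grind
    simp [eta, etaBar, hc, h, mul_comm]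

theorem cliffSign_symmDiff (c b : Idx p r) (I : Finset (Idx p r)) :
    cliffSign b (symmDiff I {c}) =
      (if finSumFinEquiv c < finSumFinEquiv b then -1 else 1) * cliffSign b I := by
  unfold cliffSign
  split_ifs with h
  · by_cases hc : c ∈ I
    · have e : I.filter (fun d => finSumFinEquiv d < finSumFinEquiv b) =
          insert c ((symmDiff I {c}).filter fun d => finSumFinEquiv d < finSumFinEquiv b) := by
        ext d; simp only [Finset.mem_filter, Finset.mem_symmDiff, Finset.mem_singleton,
          Finset.mem_insert]; grind
      rw [e, Finset.card_insert_of_notMem (by simp [Finset.mem_symmDiff, hc])]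
      ring
    · have e : (symmDiff I {c}).filter (fun d => finSumFinEquiv d < finSumFinEquiv b) =
          insert c (I.filter fun d => finSumFinEquiv d < finSumFinEquiv b) := by
        ext d; simp only [Finset.mem_filter, Finset.mem_symmDiff, Finset.mem_singleton,
          Finset.mem_insert]; grind
      rw [e, Finset.card_insert_of_notMem (by simp [hc])]
      ring
  · rw [one_mul]
    congr 2
    ext d; simp only [Finset.mem_filter, Finset.mem_symmDiff, Finset.mem_singleton]; grind

theorem cliffSign_sq (c : Idx p r) (I : Finset (Idx p r)) :
    cliffSign c I * cliffSign c I = 1 := by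
  unfold cliffSign
  rw [← pow_add, ← two_mul, pow_mul]; simp

/-- The Clifford relations, in the form `(∑_c (α_c η_c + γ_c η̄_c))² = ∑_c α_c γ_c`. -/
theorem cliffordMatrix_sq (α γ : Idx p r → S) :
    cliffordMatrix α γ * cliffordMatrix α γ =
      Matrix.scalar (Finset (Idx p r)) (∑ c, α c * γ c) := by
  ext K I
  let g : Idx p r → Finset (Idx p r) → S := fun c I =>
    (cliffSign c I : S) * (if c ∈ I then α c else γ c)
  have h1 : (cliffordMatrix α γ * cliffordMatrix α γ) K I = ∑ c, ∑ b,
      if K = symmDiff (symmDiff I {c}) {b} then g b (symmDiff I {c}) * g c I else 0 := by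
    rw [Matrix.mul_apply]
    simp only [cliffordMatrix_apply]
    simp_rw [Finset.mul_sum, Finset.sum_mul]
    rw [Finset.sum_comm]
    refine Finset.sum_congr rfl fun c _ => ?_
    rw [Finset.sum_comm]
    refine Finset.sum_congr rfl fun b _ => ?_
    rw [Finset.sum_eq_single (symmDiff I {c})]
    · rw [if_pos rfl, ite_mul, zero_mul]
    · intro I' _ hI'
      simp [hI']
    · simp
  have hne : ∀ c b : Idx p r, c ≠ b →
      g b (symmDiff I {c}) * g c I = -(g c (symmDiff I {b}) * g b I) := by
    intro c b hcb
    have m1 : b ∈ symmDiff I {c} ↔ b ∈ I := by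
      simp only [Finset.mem_symmDiff, Finset.mem_singleton]; grind
    have m2 : c ∈ symmDiff I {b} ↔ c ∈ I := by
      simp only [Finset.mem_symmDiff, Finset.mem_singleton]; grind
    simp only [g, m1, m2, cliffSign_symmDiff]
    have hk : finSumFinEquiv c ≠ finSumFinEquiv b := fun h => hcb (finSumFinEquiv.injective h)
    rcases lt_or_gt_of_ne hk with h | h
    · rw [if_pos h, if_neg (not_lt.mpr h.le)]; push_cast; ring
    · rw [if_neg (not_lt.mpr h.le), if_pos h]; push_cast; ring
  have heq : ∀ c : Idx p r, g c (symmDiff I {c}) * g c I = α c * γ c := by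
    intro c
    have m1 : c ∈ symmDiff I {c} ↔ c ∉ I := by
      simp only [Finset.mem_symmDiff, Finset.mem_singleton]; grind
    simp only [g, m1, cliffSign_symmDiff, lt_irrefl, if_false, one_mul]
    have := congrArg (Int.cast : ℤ → S) (cliffSign_sq c I)
    push_cast at this
    by_cases hc : c ∈ I
    · simp only [hc, not_true, if_true, if_false]; linear_combination (α c * γ c) * this
    · simp only [hc, not_false_iff, if_true, if_false]; linear_combination (α c * γ c) * this
  let f : Idx p r → Idx p r → S := fun c b =>
    if c = b then 0 else
      if K = symmDiff (symmDiff I {c}) {b} then g b (symmDiff I {c}) * g c I else 0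
  have hf : ∑ c, ∑ b, f c b = 0 := by
    rw [← Finset.sum_product', Finset.univ_product_univ]
    refine Finset.sum_involution (fun x _ => (x.2, x.1)) ?_ ?_ (by simp) (by simp)
    · rintro ⟨c, b⟩ -
      by_cases hcb : c = b
      · simp [f, hcb]
      · simp only [f, hcb, Ne.symm hcb, if_false, symmDiff_right_comm I {b} {c}]
        split_ifs
        · rw [hne c b hcb]; ring
        · simp
    · rintro ⟨c, b⟩ - h h'
      simp only [Prod.mk.injEq] at h'
      exact h (by simp [f, h'.2])
  have h2 : ∀ c b, (if K = symmDiff (symmDiff I {c}) {b} then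
      g b (symmDiff I {c}) * g c I else 0) =
      f c b + if c = b then (if K = I then α c * γ c else 0) else 0 := by
    intro c b
    by_cases hcb : c = b
    · subst hcb
      simp [f, heq]
    · simp [f, hcb]
  rw [h1]
  simp_rw [h2, Finset.sum_add_distrib]
  rw [hf]
  by_cases hKI : K = I
  · subst hKI; simp
  · simp [hKI]

end Clifford

/-! ### The model attached to a nef-partition and its branes `𝔅_J` -/

section Model

/-- The matter fields: `φ_{i,j}` for every ray (`Sum.inl`) and `z_c`, `c ∈ 𝓘` (`Sum.inr`). -/
abbrev Fields (p r : ℕ) : Type := Fin p ⊕ Idx p r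

/-- The gauge weights: `2 θ_{i,j}` for `φ_{i,j}` and `-θ_c` for `z_c`. -/
def modelCharge (θ : Idx p r → Fin s → ℤ) : Fields p r → Fin s → ℤ
  | Sum.inl a => 2 • θ (Sum.inl a)
  | Sum.inr c => -θ c

/-- The R-charges: `0` for `φ_{i,j}` and `1` for `z_c`. -/
def modelRCharge : Fields p r → ℝ
  | Sum.inl _ => 0
  | Sum.inr _ => 1

/-- The homogeneous coordinate `φ_a`. -/
def phi (a : Fin p) : MvPolynomial (Fields p r) ℂ := MvPolynomial.X (Sum.inl a)

/-- The coordinate `z_c`. -/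
def zvar (c : Idx p r) : MvPolynomial (Fields p r) ℂ := MvPolynomial.X (Sum.inr c)

/-- The polynomial `f(φ)` of the homogeneous coordinates, as a function of all matter fields. -/
def ofCox (f : MvPolynomial (Fin p) ℂ) : MvPolynomial (Fields p r) ℂ :=
  MvPolynomial.rename Sum.inl f

/-- `f` is a family of sections `f_k ∈ H⁰(X, E_k)`: polynomials in the homogeneous coordinates,
homogeneous of degree `θ_{k,0}`, the class of `E_k`, when `φ_{i,j}` has degree `θ_{i,j}`. -/
def IsSectionFamily (θ : Idx p r → Fin s → ℤ) (f : Fin r → MvPolynomial (Fin p) ℂ) : Prop :=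
  ∀ k, MvPolynomial.IsWeightedHomogeneous (fun a => θ (Sum.inl a)) (f k) (θ (Sum.inr k))

/-- The coefficient of `η_c` in `T_J`: `z_c²` if `c ∈ J`, else `z_c`. -/
def lowerCoeff (J : Finset (Fin p)) : Idx p r → MvPolynomial (Fields p r) ℂ
  | Sum.inl a => if a ∈ J then zvar (Sum.inl a) ^ 2 else zvar (Sum.inl a)
  | Sum.inr k => zvar (Sum.inr k)

/-- The coefficient of `η̄_c` in `T_J`: `φ_c` if `c ∈ J`, `z_c φ_c` if `c = (i,j) ∉ J` with `j ≥ 1`,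
and `z_{k,0} f_k(φ)` if `c = (k,0)`. -/
def upperCoeff (f : Fin r → MvPolynomial (Fin p) ℂ) (J : Finset (Fin p)) :
    Idx p r → MvPolynomial (Fields p r) ℂ
  | Sum.inl a => if a ∈ J then phi a else zvar (Sum.inl a) * phi a
  | Sum.inr k => zvar (Sum.inr k) * ofCox (f k)

/-- The superpotential `W = ∑ z_{i,j}² φ_{i,j} + ∑ z_{k,0}² f_k(φ)`. -/
def modelSuperpotential (f : Fin r → MvPolynomial (Fin p) ℂ) : MvPolynomial (Fields p r) ℂ :=
  ∑ a, zvar (Sum.inl a) ^ 2 * phi a + ∑ k, zvar (Sum.inr k) ^ 2 * ofCox (f k)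

theorem isWeightedHomogeneous_rename_inl {M : Type*} [AddCommMonoid M]
    (w : Fields p r → M) (f : MvPolynomial (Fin p) ℂ) (d : M) (N : ℕ) (v : Fin p → M) (e : M)
    (hv : ∀ a, w (Sum.inl a) = N • v a) (hd : d = N • e)
    (hf : MvPolynomial.IsWeightedHomogeneous v f e ∨ N = 0) :
    MvPolynomial.IsWeightedHomogeneous w (ofCox (r := r) f) d := by
  intro u hu
  obtain ⟨u', rfl, hu'⟩ := MvPolynomial.coeff_rename_ne_zero _ _ _ hu
  have h1 : Finsupp.weight w (Finsupp.mapDomain Sum.inl u') = N • Finsupp.weight v u' := by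
    rw [Finsupp.weight_apply, Finsupp.weight_apply, Finsupp.sum_mapDomain_index (by simp)
      (by intros; rw [add_smul]), Finsupp.sum, Finsupp.sum, Finset.smul_sum]
    refine Finset.sum_congr rfl fun a _ => ?_
    rw [hv, smul_comm]
  rw [h1, hd]
  rcases hf with hf | rfl
  · rw [hf hu']
  · simp

theorem isWeightedHomogeneous_congr {M : Type*} [AddCommMonoid M] {w : Fields p r → M}
    {g : MvPolynomial (Fields p r) ℂ} {d e : M} (h : MvPolynomial.IsWeightedHomogeneous w g d)
    (hde : d = e) : MvPolynomial.IsWeightedHomogeneous w g e := hde ▸ h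

theorem phi_homogeneous {M : Type*} [AddCommMonoid M] (w : Fields p r → M) (a : Fin p) :
    MvPolynomial.IsWeightedHomogeneous w (phi a) (w (Sum.inl a)) :=
  MvPolynomial.isWeightedHomogeneous_X ℂ w _

theorem zvar_homogeneous {M : Type*} [AddCommMonoid M] (w : Fields p r → M) (c : Idx p r) :
    MvPolynomial.IsWeightedHomogeneous w (zvar c) (w (Sum.inr c)) :=
  MvPolynomial.isWeightedHomogeneous_X ℂ w _

theorem ofCox_gauge {θ : Idx p r → Fin s → ℤ} {f : Fin r → MvPolynomial (Fin p) ℂ}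
    (hf : IsSectionFamily θ f) (k : Fin r) :
    MvPolynomial.IsWeightedHomogeneous (modelCharge θ) (ofCox (f k)) (2 • θ (Sum.inr k)) :=
  isWeightedHomogeneous_rename_inl _ (f k) _ 2 _ _ (fun _ => rfl) rfl (Or.inl (hf k))

theorem ofCox_rCharge (g : MvPolynomial (Fin p) ℂ) :
    MvPolynomial.IsWeightedHomogeneous (modelRCharge (p := p) (r := r)) (ofCox g) 0 :=
  isWeightedHomogeneous_rename_inl _ g 0 0 (fun _ => 0) 0 (fun _ => by simp [modelRCharge])
    (by simp) (Or.inr rfl)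

theorem modelSuperpotential_gauge {θ : Idx p r → Fin s → ℤ} {f : Fin r → MvPolynomial (Fin p) ℂ}
    (hf : IsSectionFamily θ f) :
    MvPolynomial.IsWeightedHomogeneous (modelCharge θ) (modelSuperpotential f) 0 := by
  refine MvPolynomial.IsWeightedHomogeneous.add ?_ ?_ <;>
    refine MvPolynomial.IsWeightedHomogeneous.sum _ _ _ fun a _ => ?_
  · exact isWeightedHomogeneous_congr (((zvar_homogeneous _ _).pow 2).mul (phi_homogeneous _ _))
      (by simp [modelCharge])
  · exact isWeightedHomogeneous_congr (((zvar_homogeneous _ _).pow 2).mul (ofCox_gauge hf _))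
      (by simp [modelCharge])

theorem modelSuperpotential_rCharge (f : Fin r → MvPolynomial (Fin p) ℂ) :
    MvPolynomial.IsWeightedHomogeneous (modelRCharge (p := p) (r := r))
      (modelSuperpotential f) 2 := by
  refine MvPolynomial.IsWeightedHomogeneous.add ?_ ?_ <;>
    refine MvPolynomial.IsWeightedHomogeneous.sum _ _ _ fun a _ => ?_
  · exact isWeightedHomogeneous_congr (((zvar_homogeneous _ _).pow 2).mul (phi_homogeneous _ _))
      (by simp [modelRCharge])
  · exact isWeightedHomogeneous_congr (((zvar_homogeneous _ _).pow 2).mul (ofCox_rCharge _))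
      (by simp [modelRCharge])

variable (X : SmoothCompleteFan n p) (P : X.NefPartition r) (b : Module.Basis (Fin s) ℤ X.Cl)
  (f : Fin r → MvPolynomial (Fin p) ℂ)

theorem theta_faithful :
    Submodule.span ℤ (Set.range (modelCharge (theta X P b))) = ⊤ := by
  let Λ : (Fin p → ℤ) →ₗ[ℤ] (Fin s → ℤ) := b.equivFun.toLinearMap ∘ₗ X.divClass
  have hsurj : Function.Surjective Λ :=
    b.equivFun.surjective.comp (Submodule.mkQ_surjective _)
  rw [eq_top_iff]
  intro v _
  obtain ⟨D, rfl⟩ := hsurj v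
  rw [LinearMap.pi_apply_eq_sum_univ Λ D]
  refine Submodule.sum_mem _ fun a _ => Submodule.smul_mem _ _ ?_
  have : Λ (fun j => if a = j then 1 else 0) =
      -modelCharge (theta X P b) (Sum.inr (Sum.inl a)) := by
    have e : (fun j => if a = j then (1 : ℤ) else 0) = Pi.single a 1 := by
      ext j; simp [Pi.single_apply, eq_comm]
    rw [e]
    ext k
    simp [Λ, modelCharge, theta]
  rw [this]
  exact Submodule.neg_mem _ (Submodule.subset_span ⟨_, rfl⟩)

theorem theta_nonanomalous : ∑ j, modelCharge (theta X P b) j = 0 := by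
  have h : ∑ k, theta X P b (Sum.inr k) = ∑ a, theta X P b (Sum.inl a) := by
    exact Finset.sum_fiberwise Finset.univ P.part (fun a => theta X P b (Sum.inl a))
  simp only [Fintype.sum_sum_type, modelCharge, Finset.sum_neg_distrib, h]
  rw [← Finset.smul_sum]
  abel

/-- The GLSM of the double cover attached to the nef-partition and the sections `f_k`. -/
def doubleCoverModel (hf : IsSectionFamily (theta X P b) f) : AbelianGLSM s where
  Matter := Fields p r
  charge := modelCharge (theta X P b)
  rCharge := modelRCharge
  superpotential := modelSuperpotential f
  faithful := theta_faithful X P b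
  nonanomalous := theta_nonanomalous X P b
  gaugeInvariant := modelSuperpotential_gauge hf
  rWeight_two := modelSuperpotential_rCharge f

/-- The gauge weight by which `η̄_c` changes the weight: `2 θ_c` if `c ∈ J`, else `θ_c`. -/
def stepWeight (θ : Idx p r → Fin s → ℤ) (J : Finset (Fin p)) : Idx p r → Fin s → ℤ
  | Sum.inl a => if a ∈ J then 2 • θ (Sum.inl a) else θ (Sum.inl a)
  | Sum.inr k => θ (Sum.inr k)

/-- The R-weight by which `η̄_c` changes the R-weight: `1` if `c ∈ J`, else `0`. -/
def stepRWeight (J : Finset (Fin p)) : Idx p r → ℚ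
  | Sum.inl a => if a ∈ J then 1 else 0
  | Sum.inr _ => 0

theorem cliffordMatrix_homogeneous {M : Type*} [AddCommGroup M] (w : Fields p r → M)
    (α γ : Idx p r → MvPolynomial (Fields p r) ℂ) (δ : Idx p r → M) (e : M)
    (hα : ∀ c, MvPolynomial.IsWeightedHomogeneous w (α c) (e - δ c))
    (hγ : ∀ c, MvPolynomial.IsWeightedHomogeneous w (γ c) (e + δ c))
    (K I : Finset (Idx p r)) :
    MvPolynomial.IsWeightedHomogeneous w (cliffordMatrix α γ K I)
      (e + ∑ c ∈ K, δ c - ∑ c ∈ I, δ c) := by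
  rw [cliffordMatrix, Matrix.sum_apply]
  have hZ : ∀ m : ℤ, MvPolynomial.IsWeightedHomogeneous w (m : MvPolynomial (Fields p r) ℂ) 0 := by
    intro m
    have : (m : MvPolynomial (Fields p r) ℂ) = MvPolynomial.C (m : ℂ) := by simp
    rw [this]; exact MvPolynomial.isWeightedHomogeneous_C w _
  refine MvPolynomial.IsWeightedHomogeneous.sum _ _ _ fun c _ => ?_
  rw [Matrix.add_apply, Matrix.smul_apply, Matrix.smul_apply]
  refine MvPolynomial.IsWeightedHomogeneous.add ?_ ?_
  · unfold eta
    split_ifs with h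
    · obtain ⟨hc, rfl⟩ := h
      have := Finset.sum_erase_add I δ hc
      exact isWeightedHomogeneous_congr ((hα c).mul (hZ _)) (by rw [← this]; abel)
    · rw [smul_zero]; exact MvPolynomial.isWeightedHomogeneous_zero _ _ _
  · unfold etaBar
    split_ifs with h
    · obtain ⟨hc, rfl⟩ := h
      exact isWeightedHomogeneous_congr ((hγ c).mul (hZ _))
        (by rw [Finset.sum_insert hc]; abel)
    · rw [smul_zero]; exact MvPolynomial.isWeightedHomogeneous_zero _ _ _

theorem braneJ_sq (f : Fin r → MvPolynomial (Fin p) ℂ) (J : Finset (Fin p)) :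
    cliffordMatrix (lowerCoeff J) (upperCoeff f J) * cliffordMatrix (lowerCoeff J) (upperCoeff f J)
      = Matrix.scalar (Finset (Idx p r)) (modelSuperpotential f) := by
  have h : ∑ c, lowerCoeff J c * upperCoeff f J c = modelSuperpotential f := by
    rw [Fintype.sum_sum_type, modelSuperpotential]
    refine congrArg₂ (· + ·) (Finset.sum_congr rfl fun a _ => ?_)
      (Finset.sum_congr rfl fun a _ => ?_)
    · simp only [lowerCoeff, upperCoeff]
      split_ifs <;> ring
    · simp only [lowerCoeff, upperCoeff]
      ring
  rw [cliffordMatrix_sq, h]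

theorem braneJ_gauge {θ : Idx p r → Fin s → ℤ} {f : Fin r → MvPolynomial (Fin p) ℂ}
    (hf : IsSectionFamily θ f) (J : Finset (Fin p)) (K I : Finset (Idx p r)) :
    MvPolynomial.IsWeightedHomogeneous (modelCharge θ)
      (cliffordMatrix (lowerCoeff J) (upperCoeff f J) K I)
      (∑ c ∈ K, stepWeight θ J c - ∑ c ∈ I, stepWeight θ J c) := by
  refine isWeightedHomogeneous_congr (cliffordMatrix_homogeneous (modelCharge θ) _ _
    (stepWeight θ J) 0 ?_ ?_ K I) (by rw [zero_add])
  · rintro (a | k) <;> simp only [lowerCoeff, stepWeight]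
    · split_ifs
      · exact isWeightedHomogeneous_congr ((zvar_homogeneous _ _).pow 2) (by simp [modelCharge])
      · exact isWeightedHomogeneous_congr (zvar_homogeneous _ _) (by simp [modelCharge])
    · exact isWeightedHomogeneous_congr (zvar_homogeneous _ _) (by simp [modelCharge])
  · rintro (a | k) <;> simp only [upperCoeff, stepWeight]
    · split_ifs
      · exact isWeightedHomogeneous_congr (phi_homogeneous _ _) (by simp [modelCharge])
      · exact isWeightedHomogeneous_congr ((zvar_homogeneous _ _).mul (phi_homogeneous _ _))
          (by simp [modelCharge, two_mul])
    · exact isWeightedHomogeneous_congr ((zvar_homogeneous _ _).mul (ofCox_gauge hf _))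
        (by simp [modelCharge, two_mul])

theorem braneJ_rCharge (f : Fin r → MvPolynomial (Fin p) ℂ) (J : Finset (Fin p))
    (K I : Finset (Idx p r)) :
    MvPolynomial.IsWeightedHomogeneous (modelRCharge (p := p) (r := r))
      (cliffordMatrix (lowerCoeff J) (upperCoeff f J) K I)
      (1 + ((∑ c ∈ I, stepRWeight J c : ℚ) : ℝ) - ((∑ c ∈ K, stepRWeight J c : ℚ) : ℝ)) := by
  refine isWeightedHomogeneous_congr (cliffordMatrix_homogeneous modelRCharge _ _
    (fun c => -(stepRWeight J c : ℝ)) 1 ?_ ?_ K I)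
    (by push_cast; rw [Finset.sum_neg_distrib, Finset.sum_neg_distrib]; ring)
  · rintro (a | k) <;> simp only [lowerCoeff, stepRWeight]
    · split_ifs
      · exact isWeightedHomogeneous_congr ((zvar_homogeneous _ _).pow 2)
          (by norm_num [modelRCharge])
      · exact isWeightedHomogeneous_congr (zvar_homogeneous _ _) (by simp [modelRCharge])
    · exact isWeightedHomogeneous_congr (zvar_homogeneous _ _) (by simp [modelRCharge])
  · rintro (a | k) <;> simp only [upperCoeff, stepRWeight]
    · split_ifs
      · exact isWeightedHomogeneous_congr (phi_homogeneous _ _) (by simp [modelRCharge])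
      · exact isWeightedHomogeneous_congr ((zvar_homogeneous _ _).mul (phi_homogeneous _ _))
          (by simp [modelRCharge])
    · exact isWeightedHomogeneous_congr ((zvar_homogeneous _ _).mul (ofCox_rCharge _))
        (by simp [modelRCharge])

theorem cliffordMatrix_odd {S : Type*} [CommRing S] (α γ : Idx p r → S)
    (K I : Finset (Idx p r)) (h : cliffordMatrix α γ K I ≠ 0) :
    (K.card : ZMod 2) = (I.card : ZMod 2) + 1 := by
  rw [cliffordMatrix, Matrix.sum_apply] at h
  obtain ⟨c, -, hc⟩ := Finset.exists_ne_zero_of_sum_ne_zero h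
  by_cases h1 : c ∈ I ∧ K = I.erase c
  · obtain ⟨h1, rfl⟩ := h1
    rw [← Finset.card_erase_add_one h1]
    push_cast
    have : (2 : ZMod 2) = 0 := rfl
    linear_combination -this
  · by_cases h2 : c ∉ I ∧ K = insert c I
    · obtain ⟨h2, rfl⟩ := h2
      rw [Finset.card_insert_of_notMem h2]; push_cast; rfl
    · exact absurd (by simp [eta, etaBar, h1, h2]) hc

/-- The brane `𝔅_J` of a subset `J` of the set of rays: the Chan--Paton space has the basis
`η̄_I v`, `I ⊆ 𝓘`, the vector `v` has trivial weights, and the matrix factorization is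
`T_J = ∑_{J} (z² η + φ η̄) + ∑_{c ∉ J} (z η + z φ η̄) + ∑_k (z_{k,0} η_{k,0} + z_{k,0} f_k η̄_{k,0})`. -/
def braneJ (hf : IsSectionFamily (theta X P b) f) (J : Finset (Fin p)) :
    Brane (doubleCoverModel X P b f hf) where
  ι := Finset (Idx p r)
  parity I := (I.card : ZMod 2)
  gaugeWeight I := ∑ c ∈ I, stepWeight (theta X P b) J c
  rWeight I := ∑ c ∈ I, stepRWeight J c
  T := cliffordMatrix (lowerCoeff J) (upperCoeff f J)
  odd K I h := cliffordMatrix_odd _ _ K I h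
  sq := braneJ_sq f J
  gaugeEquivariant K I := braneJ_gauge hf J K I
  rEquivariant K I := braneJ_rCharge f J K I

/-- The change of variables
`q_k = ∏_{j ≥ 1} (-4 x_{i,j})^{θ^k_{i,j}} ∏_i x_{i,0}^{-θ^k_{i,0}}`. -/
def qVariable (θ : Idx p r → Fin s → ℤ) (x : Idx p r → ℂ) (k : Fin s) : ℂ :=
  (∏ a, (-4 * x (Sum.inl a)) ^ θ (Sum.inl a) k) * ∏ i, x (Sum.inr i) ^ (-θ (Sum.inr i) k)

end Model

end

end DoubleCoverPeriods

/-! Put z_c = iθ_c(σ). The Gamma product and the brane factor both split into products over c ∈ 𝓘,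
the latter because the trace over an exterior algebra is the product of the 1 + (signed character of
η̄_c). By duplication and reflection the factor of index c becomes, up to constants and exponentials
of z_c, 1/Γ(1 - z_c) for a ray in J, Γ(z_c) for a ray outside J and 1/Γ(1/2 + z_c) for a part
(`gammaProduct_mul_factor_eq`). For local branches of the logarithms, (∏ x_{i,0})^{-1/2} e^{it(σ)}
is a constant times e^{iτ(σ)} ∏ x_c^{u_c} with τ constant, u_c = -z_c on rays and u_c = z_c - 1/2 on
parts (`sum_gkzExponent_mul`). So the function is a Mellin-Barnes integral of monomials in x.

Euler operators: x_c ∂_c multiplies the integrand by u_c, and Au = β identically in σ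
(`sum_gkzMatrix_mul_gkzExponent`).

Box operators: ∂^N produces falling factorials of the u_c, which only shift the Gamma arguments by
N_c. If Aℓ⁺ = Aℓ⁻, then ℓ⁺ - ℓ⁻ comes from some m ∈ Hom(Cl(X), ℤ) = ℤ^s
(`exists_dotProduct_theta_eq`), and the integrand of ∂^{ℓ⁺} at σ + im is the integrand of ∂^{ℓ⁻} at
σ (`regIntegrand_shift`): the powers of 4 from the duplication formula cancel those in q, and the
remaining signs multiply to (-1)^{∑(ℓ⁺ - ℓ⁻)} = 1. The box equation is thus the invariance of the
integral under translation of the contour by im (`integral_regIntegrand_shift`). No pole is met: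
only the Γ(z_a + ℓ⁺_a) with a ∉ J have poles, along σ + iκm their argument is z_a + (1-κ)ℓ⁺_a +
κℓ⁻_a, and z_a never lies in ℝ_{≤0} on L.

Two analytic inputs support this. Stirling bounds with polynomial losses show that the integrand,
its derivatives and its translates are at most a polynomial times ∑_q exp(Im W_{eff,q}).
Admissibility makes this decay faster than any power, and the interior condition leaves room for a
further factor e^{ε∑|σ_k|}, which gives analyticity and differentiation under the integral
(`hasExpMoment_gkz`). As L is only a Lipschitz graph, Stokes is replaced by an analytic
continuation: for x ↦ x + iy₀ + κw(x) with w compactly supported, a small real κ is a mere change of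
variables, and the identity theorem carries the equality of integrals to κ = i
(`integral_deformation_eq_flat`). -/

namespace DoubleCoverPeriods
open Filter Topology MeasureTheory
noncomputable section

/-! ### Stirling bounds for the Gamma function -/

/-- The real part of `z log z - z`, the logarithm of the Stirling majorant of `|Γ|`. -/
def stirlingExp (z : ℂ) : ℝ := z.re * Real.log ‖z‖ - z.im * z.arg - z.re

theorem stirlingExp_eq_re (z : ℂ) : stirlingExp z = (z * (Complex.log z - 1)).re := by
  simp only [stirlingExp, Complex.mul_re, Complex.sub_re, Complex.sub_im, Complex.log_re,
    Complex.log_im, Complex.one_re, Complex.one_im]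
  ring

/-- Negation changes the argument by ∓π according to the sign of Im z; on the real axis the argument
is multiplied by zero. This is the reflection formula at the level of sizes. -/
theorem stirlingExp_neg (z : ℂ) : stirlingExp (-z) = -stirlingExp z - Real.pi * |z.im| := by
  rcases lt_trichotomy z.im 0 with h | h | h
  · simp only [stirlingExp, Complex.neg_re, Complex.neg_im, norm_neg,
      Complex.arg_neg_eq_arg_add_pi_of_im_neg h, abs_of_neg h]
    ring
  · simp [stirlingExp, h]
    ring
  · simp only [stirlingExp, Complex.neg_re, Complex.neg_im, norm_neg,
      Complex.arg_neg_eq_arg_sub_pi_of_im_pos h, abs_of_pos h]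
    ring

/-- The duplication formula at the level of sizes. -/
theorem stirlingExp_two_mul (z : ℂ) :
    stirlingExp (2 * z) = 2 * stirlingExp z + 2 * Real.log 2 * z.re := by
  have h2 : (2 : ℂ) * z = ((2 : ℝ) : ℂ) * z := by norm_num
  have ha : (2 * z).arg = z.arg := by
    rw [h2, Complex.arg_real_mul z (by norm_num : (0 : ℝ) < 2)]
  by_cases hz : z = 0
  · simp [hz, stirlingExp]
  · have hn : ‖2 * z‖ = 2 * ‖z‖ := by simp
    have hl : Real.log ‖2 * z‖ = Real.log 2 + Real.log ‖z‖ := by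
      rw [hn, Real.log_mul (by norm_num) (norm_ne_zero_iff.mpr hz)]
    simp only [stirlingExp, ha, hl]
    rw [h2, Complex.re_ofReal_mul, Complex.im_ofReal_mul]
    ring

theorem abs_log_mul_self_le {t : ℝ} (ht : 0 ≤ t) : |Real.log t| * t ≤ 1 + t ^ 2 := by
  rcases ht.eq_or_lt with rfl | h0
  · simp
  rcases le_total t 1 with h | h
  · have := Real.abs_log_mul_self_lt t h0 h
    rw [abs_mul, abs_of_pos h0] at this
    nlinarith
  · rw [abs_of_nonneg (Real.log_nonneg h)]
    have := Real.log_le_sub_one_of_pos h0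
    nlinarith

/-- Deliberately crude: it serves on bounded sets, and to see that the exponents grow at most
polynomially. -/
theorem abs_stirlingExp_le (z : ℂ) : |stirlingExp z| ≤ 1 + ‖z‖ ^ 2 + 5 * ‖z‖ := by
  have h1 : |z.re * Real.log ‖z‖| ≤ 1 + ‖z‖ ^ 2 := by
    rw [abs_mul]
    calc _ ≤ ‖z‖ * |Real.log ‖z‖| := by gcongr; exact Complex.abs_re_le_norm z
      _ ≤ _ := by rw [mul_comm]; exact abs_log_mul_self_le (norm_nonneg z)
  have h2 : |z.im * z.arg| ≤ 4 * ‖z‖ := by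
    rw [abs_mul, mul_comm]
    gcongr
    · exact (Complex.abs_arg_le_pi z).trans Real.pi_le_four
    · exact Complex.abs_im_le_norm z
  have h3 := Complex.abs_re_le_norm z
  unfold stirlingExp
  rw [abs_le] at *
  constructor <;> linarith [h1.1, h2.1, h3.1]

/-- Along horizontal segments that stay away from the origin, the arguments of `w + u` and `w` can
be compared with no regard to the branch cut, since they only enter multiplied by `Im w`. -/
theorem re_mul_log_add_sub {w c : ℂ} {u : ℝ} (hu : |u| < ‖w‖) (hc : c.im = w.im) :
    c.re * (Real.log ‖w + u‖ - Real.log ‖w‖) - c.im * ((w + u).arg - w.arg) =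
      (c * Complex.log (1 + u / w)).re := by
  have hw : w ≠ 0 := by rintro rfl; simp at hu; exact absurd hu (not_lt.mpr (abs_nonneg u))
  have hwu : w + u ≠ 0 := by
    intro h
    have : w = -(u : ℂ) := by linear_combination h
    rw [this] at hu; simp at hu
  have hq : 1 + u / w = (w + u) / w := by field_simp
  have hn : Real.log ‖1 + u / w‖ = Real.log ‖w + u‖ - Real.log ‖w‖ := by
    rw [hq, norm_div, Real.log_div (norm_ne_zero_iff.mpr hwu) (norm_ne_zero_iff.mpr hw)]
  rw [Complex.mul_re, Complex.log_re, Complex.log_im, hn]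
  by_cases h0 : w.im = 0
  · simp [hc, h0]
  · congr 2
    have hmem : (w + u).arg - w.arg ∈ Set.Ioc (-Real.pi) Real.pi := by
      have him : (w + u).im = w.im := by simp
      rcases lt_or_gt_of_ne h0 with h | h
      · have a1 := Complex.arg_neg_iff.mpr h
        have a2 := Complex.arg_neg_iff.mpr (him ▸ h)
        have b1 := Complex.neg_pi_lt_arg w
        have b2 := Complex.neg_pi_lt_arg (w + u)
        constructor <;> linarith
      · have a1 := Complex.arg_nonneg_iff.mpr h.le
        have a2 := Complex.arg_nonneg_iff.mpr (him ▸ h.le)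
        have b1 := Complex.arg_lt_pi_iff.mpr (Or.inr h.ne')
        have b2 := Complex.arg_lt_pi_iff.mpr (Or.inr (him ▸ h.ne'))
        constructor <;> linarith
    have h1 := Complex.arg_div_coe_angle hwu hw
    rw [← hq, ← Real.Angle.coe_sub] at h1
    have h2 := congrArg Real.Angle.toReal h1
    rw [Real.Angle.toReal_coe_eq_self_iff_mem_Ioc.mpr hmem,
      Real.Angle.toReal_coe_eq_self_iff_mem_Ioc.mpr (Complex.arg_mem_Ioc _)] at h2
    exact h2.symm

/-- The increment is Re(z log(1 + u/z)) + u log‖z + u‖ - u. The first term is O(|u|) once ‖z‖ ≥ 2M;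
the second costs a power of ‖z‖ after exponentiation. -/
theorem stirlingExp_add_sub_le {M : ℝ} (hM : 1 ≤ M) {z : ℂ} (hz : 2 * M ≤ ‖z‖) {u : ℝ}
    (hu : |u| ≤ M) :
    stirlingExp (z + u) - stirlingExp z ≤ 3 * M + M * Real.log ((1 + M) * (1 + ‖z‖)) := by
  have hu' : |u| < ‖z‖ := by linarith
  have h := re_mul_log_add_sub hu' (c := z) rfl
  have hz0 : 0 < ‖z‖ := by linarith
  have e : stirlingExp (z + u) - stirlingExp z =
      (z * Complex.log (1 + u / z)).re + u * Real.log ‖z + u‖ - u := by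
    rw [← h]
    simp only [stirlingExp, Complex.add_re, Complex.add_im, Complex.ofReal_re, Complex.ofReal_im]
    ring
  have h1 : (z * Complex.log (1 + u / z)).re ≤ 3 / 2 * M := by
    refine (Complex.re_le_norm _).trans ?_
    have hq : ‖(u : ℂ) / z‖ ≤ 1 / 2 := by
      rw [norm_div, Complex.norm_real, Real.norm_eq_abs, div_le_iff₀ hz0]; linarith
    rw [norm_mul]
    calc _ ≤ ‖z‖ * (3 / 2 * ‖(u : ℂ) / z‖) := by
          gcongr; exact Complex.norm_log_one_add_half_le_self hq
      _ = 3 / 2 * |u| := by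
          rw [norm_div, Complex.norm_real, Real.norm_eq_abs]; field_simp
      _ ≤ _ := by linarith
  have hlow : 1 ≤ ‖z + u‖ := by
    have := norm_sub_le (z + u) u
    simp only [add_sub_cancel_right, Complex.norm_real, Real.norm_eq_abs] at this
    linarith
  have hup : ‖z + u‖ ≤ (1 + M) * (1 + ‖z‖) := by
    have := norm_add_le z u
    simp only [Complex.norm_real, Real.norm_eq_abs] at this
    nlinarith
  have h2 : u * Real.log ‖z + u‖ ≤ M * Real.log ((1 + M) * (1 + ‖z‖)) := by
    have hl0 := Real.log_nonneg hlow
    calc _ ≤ |u| * Real.log ‖z + u‖ := by gcongr; exact le_abs_self u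
      _ ≤ _ := by gcongr
  have h3 := neg_abs_le u
  linarith

/-- A bounded real shift costs only a polynomial factor: a logarithmic increment for large z, a
crude bound on a bounded set otherwise. Hence R-charges, orders of differentiation and translations
of the contour do not affect the exponential rate. -/
theorem exp_stirlingExp_add_le (M : ℕ) : ∃ C : ℝ, 0 < C ∧ ∃ N : ℕ, ∀ (z : ℂ) (u : ℝ), |u| ≤ M →
    Real.exp (stirlingExp (z + u)) ≤ C * (1 + ‖z‖) ^ N * Real.exp (stirlingExp z) := by
  set K : ℝ := (M : ℝ) + 1 with hK
  have hK1 : 1 ≤ K := by rw [hK]; linarith [(Nat.cast_nonneg M : (0 : ℝ) ≤ M)]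
  set C1 := Real.exp (3 * K) * (1 + K) ^ (M + 1)
  set C2 := Real.exp (2 * (1 + (3 * K) ^ 2 + 5 * (3 * K)))
  refine ⟨C1 + C2, by positivity, M + 1, fun z u hu => ?_⟩
  have hu' : |u| ≤ K := by linarith
  have key : Real.exp (stirlingExp (z + u) - stirlingExp z) ≤
      (C1 + C2) * (1 + ‖z‖) ^ (M + 1) := by
    rcases le_total (2 * K) ‖z‖ with h | h
    · have h1 := stirlingExp_add_sub_le hK1 h hu'
      have hpos : 0 < (1 + K) * (1 + ‖z‖) := by positivity
      calc _ ≤ Real.exp (3 * K + K * Real.log ((1 + K) * (1 + ‖z‖))) := Real.exp_le_exp.mpr h1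
        _ = C1 * (1 + ‖z‖) ^ (M + 1) := by
          rw [Real.exp_add, mul_comm K (Real.log _)]
          have : K = ((M + 1 : ℕ) : ℝ) := by push_cast; rfl
          rw [← Real.rpow_def_of_pos hpos, this, Real.rpow_natCast, mul_pow, ← this]
          simp only [C1]; ring
        _ ≤ _ := by gcongr; simp only [C2]; linarith [Real.exp_pos (2 * (1 + (3 * K) ^ 2 + 5 * (3 * K)))]
    · have hzu : ‖z + u‖ ≤ 3 * K := by
        have := norm_add_le z u
        simp only [Complex.norm_real, Real.norm_eq_abs] at this
        linarith
      have hz : ‖z‖ ≤ 3 * K := by linarith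
      have a := (abs_le.mp (abs_stirlingExp_le z)).1
      have a2 := (abs_le.mp (abs_stirlingExp_le (z + u))).2
      have b : 1 + ‖z‖ ^ 2 + 5 * ‖z‖ ≤ 1 + (3 * K) ^ 2 + 5 * (3 * K) := by gcongr
      have b2 : 1 + ‖z + u‖ ^ 2 + 5 * ‖z + u‖ ≤ 1 + (3 * K) ^ 2 + 5 * (3 * K) := by gcongr
      calc _ ≤ C2 := Real.exp_le_exp.mpr (by linarith)
        _ ≤ C1 + C2 := le_add_of_nonneg_left (by positivity)
        _ ≤ _ := le_mul_of_one_le_right (by positivity)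
            (one_le_pow₀ (by linarith [norm_nonneg z]))
  calc _ = Real.exp (stirlingExp (z + u) - stirlingExp z) * Real.exp (stirlingExp z) := by
        rw [← Real.exp_add]; congr 1; ring
    _ ≤ _ := by gcongr

/-- The increment of the correction term in Stirling's formula. -/
def stirlingStep (w : ℂ) : ℝ :=
  (w.re + 1 / 2) * (Real.log ‖w + 1‖ - Real.log ‖w‖) - w.im * ((w + 1).arg - w.arg) - 1

/-- The correction term in Stirling's formula. -/
def stirlingRem (z : ℂ) : ℝ :=
  Real.log ‖Complex.Gamma z‖ - stirlingExp z + 1 / 2 * Real.log ‖z‖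

theorem stirlingRem_add_one {z : ℂ} (hz : ∀ k : ℕ, z ≠ -k) :
    stirlingRem z = stirlingRem (z + 1) + stirlingStep z := by
  have h0 : z ≠ 0 := by simpa using hz 0
  have hG : Complex.Gamma z ≠ 0 := Complex.Gamma_ne_zero hz
  unfold stirlingRem stirlingStep stirlingExp
  rw [Complex.Gamma_add_one z h0, norm_mul, Real.log_mul (norm_ne_zero_iff.mpr h0)
    (norm_ne_zero_iff.mpr hG)]
  simp only [Complex.add_re, Complex.add_im, Complex.one_re, Complex.one_im]
  ring

theorem stirlingRem_add_nat {z : ℂ} (hz : ∀ k : ℕ, z ≠ -k) (n : ℕ) :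
    stirlingRem z = stirlingRem (z + n) + ∑ k ∈ Finset.range n, stirlingStep (z + k) := by
  induction n with
  | zero => simp
  | succ n ih =>
    rw [Finset.sum_range_succ, ih, stirlingRem_add_one (z := z + n)]
    · push_cast; rw [add_assoc z]; ring
    · intro k hk
      refine hz (n + k) ?_
      push_cast; linear_combination hk

/-- With v = 1/w the step is Re((w + 1/2) log(1 + v) - 1). The correction 1/2 kills the term of
order v, so the step is O(|v|²), which is summable along z + ℕ. -/
theorem abs_stirlingStep_le {w : ℂ} (hw : 3 ≤ ‖w‖) : |stirlingStep w| ≤ 2 / (1 + w.re ^ 2) := by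
  have hw0 : w ≠ 0 := by rintro rfl; simp at hw; linarith
  have hpos : 0 < ‖w‖ := by linarith
  have h := re_mul_log_add_sub (w := w) (u := 1) (c := w + 1 / 2) (by simp; linarith) (by simp)
  have e : stirlingStep w = ((w + 1 / 2) * Complex.log (1 + w⁻¹) - 1).re := by
    rw [Complex.sub_re, ← one_div]
    have h' := h
    push_cast at h'
    rw [← h', stirlingStep]
    simp
  set v := w⁻¹ with hv
  have hvn : ‖v‖ = ‖w‖⁻¹ := norm_inv w
  have hv3 : ‖v‖ ≤ 1 / 3 := by
    rw [hvn, inv_le_comm₀ hpos (by norm_num)]; norm_num; exact hw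
  have ht := Complex.norm_log_sub_logTaylor_le 2 (z := v) (by linarith)
  have hT : Complex.logTaylor 3 v = v - v ^ 2 / 2 := by
    simp [Complex.logTaylor, Finset.sum_range_succ]; ring
  rw [show 2 + 1 = 3 from rfl, hT] at ht
  set R := Complex.log (1 + v) - (v - v ^ 2 / 2) with hR
  have hwv : w * v = 1 := mul_inv_cancel₀ hw0
  have e2 : (w + 1 / 2) * Complex.log (1 + v) - 1 = -(v ^ 2 / 4) + (w + 1 / 2) * R := by
    rw [show Complex.log (1 + v) = R + (v - v ^ 2 / 2) by rw [hR]; ring]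
    linear_combination (1 - v / 2) * hwv
  have hRle : ‖R‖ ≤ ‖v‖ ^ 3 / 2 := by
    refine ht.trans ?_
    have : (1 - ‖v‖)⁻¹ ≤ 3 / 2 := by
      rw [inv_le_comm₀ (by linarith) (by norm_num)]; linarith
    have h3 : 0 ≤ ‖v‖ ^ 3 := by positivity
    push_cast
    nlinarith
  have hvw : ‖w‖ * ‖v‖ = 1 := by rw [hvn]; exact mul_inv_cancel₀ hpos.ne'
  have hb : ‖(w + 1 / 2) * Complex.log (1 + v) - 1‖ ≤ ‖v‖ ^ 2 := by
    rw [e2]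
    have a1 : ‖w + 1 / 2‖ ≤ ‖w‖ + 1 / 2 := by
      refine (norm_add_le _ _).trans ?_; norm_num
    calc _ ≤ ‖v‖ ^ 2 / 4 + (‖w‖ + 1 / 2) * (‖v‖ ^ 3 / 2) := by
          refine (norm_add_le _ _).trans ?_
          rw [norm_neg, norm_mul, norm_div, norm_pow]
          norm_num
          gcongr
      _ = ‖v‖ ^ 2 / 4 + ‖v‖ ^ 2 / 2 * (‖w‖ * ‖v‖) + ‖v‖ ^ 2 * ‖v‖ / 4 := by ring
      _ ≤ _ := by rw [hvw]; nlinarith [sq_nonneg ‖v‖]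
  rw [e]
  refine (Complex.abs_re_le_norm _).trans (hb.trans ?_)
  rw [hvn, inv_pow, inv_le_comm₀ (by positivity) (by positivity), inv_div]
  have := Complex.sq_norm w
  rw [Complex.normSq_apply] at this
  nlinarith [mul_self_nonneg w.im]

theorem abs_im_mul_arg_sub_le {w : ℂ} (hw : ‖w‖ ≤ 3) :
    |w.im * ((w + 1).arg - w.arg)| ≤ 24 := by
  rw [abs_mul]
  have h1 := (Complex.abs_im_le_norm w).trans hw
  have h2 : |(w + 1).arg - w.arg| ≤ 8 := by
    have a1 := abs_le.mp (Complex.abs_arg_le_pi w)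
    have a2 := abs_le.mp (Complex.abs_arg_le_pi (w + 1))
    have := Real.pi_le_four
    rw [abs_le]; constructor <;> linarith [a1.1, a1.2, a2.1, a2.2]
  calc _ ≤ (3 : ℝ) * 8 := by gcongr
    _ = 24 := by norm_num

theorem log_le_two {t : ℝ} (h0 : 0 ≤ t) (ht : t ≤ 4) : Real.log t ≤ 2 := by
  rcases h0.eq_or_lt with rfl | h
  · simp
  have h4 : Real.log 4 = 2 * Real.log 2 := by
    rw [show (4 : ℝ) = 2 ^ 2 by norm_num, Real.log_pow]; norm_num
  have := Real.log_le_log h ht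
  linarith [Real.log_two_lt_d9]

theorem neg_one_le_log {t : ℝ} (ht : 1 / 2 ≤ t) : -1 ≤ Real.log t := by
  have := Real.log_le_log (by norm_num) ht
  rw [one_div, Real.log_inv] at this
  linarith [Real.log_two_lt_d9]

/-- The logarithmic singularities at w = 0 and w = -1 both drive the step to +∞, so the lower bound
needs no distance from the poles. -/
theorem neg_stirlingStep_le {w : ℂ} (hw : ‖w‖ ≤ 3) : -stirlingStep w ≤ 40 := by
  have h1 := (abs_le.mp (abs_im_mul_arg_sub_le hw)).2
  have hre := abs_le.mp ((Complex.abs_re_le_norm w).trans hw)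
  have hw1 : ‖w + 1‖ ≤ 4 := by
    refine (norm_add_le _ _).trans ?_; norm_num; linarith
  have l0 := log_le_two (norm_nonneg w) (by linarith)
  have l1 := log_le_two (norm_nonneg (w + 1)) hw1
  have hn0 := Complex.abs_re_le_norm w
  have hn1 := Complex.abs_re_le_norm (w + 1)
  simp only [Complex.add_re, Complex.one_re] at hn1
  unfold stirlingStep
  rcases le_total 0 (w.re + 1 / 2) with h | h
  · have : 1 / 2 ≤ ‖w + 1‖ := by
      have := le_abs_self (w.re + 1); linarith
    have := neg_one_le_log this
    nlinarith
  · have : 1 / 2 ≤ ‖w‖ := by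
      have := neg_abs_le w.re; linarith
    have := neg_one_le_log this
    nlinarith

theorem abs_log_le_of_le {d t : ℝ} (hd : 0 < d) (hd1 : d ≤ 1) (h1 : d ≤ t) (h2 : t ≤ 4) :
    |Real.log t| ≤ 2 - Real.log d := by
  have a := Real.log_le_log hd h1
  have b := log_le_two (by linarith) h2
  have c := Real.log_nonpos hd.le hd1
  rw [abs_le]; constructor <;> linarith

theorem stirlingStep_le {w : ℂ} (hw : ‖w‖ ≤ 3) {d : ℝ} (hd : 0 < d) (hd1 : d ≤ 1)
    (h0 : d ≤ ‖w‖) (h1 : d ≤ ‖w + 1‖) : stirlingStep w ≤ 40 - 7 * Real.log d := by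
  have h2 := (abs_le.mp (abs_im_mul_arg_sub_le hw)).1
  have hre := abs_le.mp ((Complex.abs_re_le_norm w).trans hw)
  have hw1 : ‖w + 1‖ ≤ 4 := by
    refine (norm_add_le _ _).trans ?_; norm_num; linarith
  have l0 := abs_log_le_of_le hd hd1 h0 (by linarith)
  have l1 := abs_log_le_of_le hd hd1 h1 hw1
  have c := Real.log_nonpos hd.le hd1
  have hx : |w.re + 1 / 2| ≤ 7 / 2 := by rw [abs_le]; constructor <;> linarith
  have : (w.re + 1 / 2) * (Real.log ‖w + 1‖ - Real.log ‖w‖) ≤ 7 / 2 * (2 * (2 - Real.log d)) := by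
    refine (le_abs_self _).trans ?_
    rw [abs_mul]
    gcongr
    refine (abs_sub _ _).trans ?_
    linarith
  unfold stirlingStep
  linarith

/-- By the mean value theorem the summable weight is dominated by increments of arctan, which
telescope; the resulting bound does not depend on the starting point, however negative. -/
theorem two_div_one_add_sq_le (v : ℝ) :
    2 / (1 + v ^ 2) ≤ 6 * (Real.arctan (v + 1) - Real.arctan v) := by
  obtain ⟨c, hc, h⟩ := exists_deriv_eq_slope Real.arctan (lt_add_one v)
    Real.continuous_arctan.continuousOn
    (Real.differentiable_arctan.differentiableOn)
  rw [Real.deriv_arctan, add_sub_cancel_left, div_one] at h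
  rw [← h, ← mul_one_div]
  have h1 : 1 + c ^ 2 ≤ 3 * (1 + v ^ 2) := by
    have := hc.1; have := hc.2
    nlinarith [sq_nonneg (v - 1), sq_nonneg (v + 1), sq_nonneg (c - v), mul_pos (sub_pos.mpr hc.1) (sub_pos.mpr hc.2)]
  rw [mul_one_div, mul_one_div, div_le_div_iff₀ (by positivity) (by positivity)]
  linarith

theorem sum_two_div_one_add_sq_le (x : ℝ) (n : ℕ) :
    ∑ k ∈ Finset.range n, 2 / (1 + (x + k) ^ 2) ≤ 20 := by
  have h : ∑ k ∈ Finset.range n, 2 / (1 + (x + k) ^ 2) ≤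
      6 * (Real.arctan (x + n) - Real.arctan x) := by
    induction n with
    | zero => simp
    | succ n ih =>
      rw [Finset.sum_range_succ]
      have := two_div_one_add_sq_le (x + n)
      push_cast
      rw [← add_assoc]
      linarith
  have := Real.arctan_lt_pi_div_two (x + n)
  have := Real.neg_pi_div_two_lt_arctan x
  linarith [Real.pi_lt_d2]

/-- The points of z + ℕ within distance 3 of the origin are charged to the same summable weight, so
they need not be counted. -/
theorem one_le_five_mul_of_norm_le {w : ℂ} (hw : ‖w‖ ≤ 3) : 1 ≤ 5 * (2 / (1 + w.re ^ 2)) := by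
  have h := abs_le.mp ((Complex.abs_re_le_norm w).trans hw)
  rw [← mul_div_assoc, le_div_iff₀ (by positivity)]
  nlinarith

theorem sum_stirlingStep_ge (z : ℂ) (n : ℕ) :
    -4000 ≤ ∑ k ∈ Finset.range n, stirlingStep (z + k) := by
  -- The 200 is 40 · 5, the near bound times the charge; multiplied by the total weight 20 it gives
  -- 4000. The upper bound obtains 700 as 7 · 5 · 20.
  have h : ∀ k ∈ Finset.range n, -(200 * (2 / (1 + (z.re + k) ^ 2))) ≤ stirlingStep (z + k) := by
    intro k _
    have hp : 0 < 2 / (1 + (z.re + k) ^ 2) := by positivity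
    have hr : (z + k).re = z.re + k := by simp
    rcases le_total 3 ‖z + k‖ with h | h
    · have := (abs_le.mp (abs_stirlingStep_le h)).1
      rw [hr] at this
      linarith
    · have h1 := neg_stirlingStep_le h
      have h2 := one_le_five_mul_of_norm_le h
      rw [hr] at h2
      linarith
  have := Finset.sum_le_sum h
  rw [Finset.sum_neg_distrib, ← Finset.mul_sum] at this
  linarith [sum_two_div_one_add_sq_le z.re n]

theorem sum_stirlingStep_le {z : ℂ} {d : ℝ} (hd : 0 < d) (hd1 : d ≤ 1)
    (hz : ∀ k : ℕ, d ≤ ‖z + k‖) (n : ℕ) :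
    ∑ k ∈ Finset.range n, stirlingStep (z + k) ≤ 4000 - 700 * Real.log d := by
  have c := Real.log_nonpos hd.le hd1
  have h : ∀ k ∈ Finset.range n,
      stirlingStep (z + k) ≤ (200 - 35 * Real.log d) * (2 / (1 + (z.re + k) ^ 2)) := by
    intro k _
    have hp : 0 < 2 / (1 + (z.re + k) ^ 2) := by positivity
    have hr : (z + k).re = z.re + k := by simp
    rcases le_total 3 ‖z + k‖ with h | h
    · have := (abs_le.mp (abs_stirlingStep_le h)).2
      rw [hr] at this
      nlinarith
    · have h1 := stirlingStep_le h hd hd1 (hz k) (by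
        have := hz (k + 1); push_cast at this; rwa [← add_assoc] at this)
      have h2 := one_le_five_mul_of_norm_le h
      rw [hr] at h2
      nlinarith
  have := Finset.sum_le_sum h
  rw [← Finset.mul_sum] at this
  have h3 := sum_two_div_one_add_sq_le z.re n
  nlinarith

end

noncomputable section

/-! ### Limit of the Stirling correction, and global bounds for Γ and 1/Γ -/

theorem Gamma_add_nat {z : ℂ} (hz : ∀ k : ℕ, z ≠ -k) (n : ℕ) :
    Complex.Gamma (z + n) = (∏ j ∈ Finset.range n, (z + j)) * Complex.Gamma z := by
  induction n with
  | zero => simp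
  | succ n ih =>
    have h : z + n ≠ 0 := fun h => hz n (by linear_combination h)
    rw [Finset.prod_range_succ, Nat.cast_succ, ← add_assoc, Complex.Gamma_add_one _ h, ih]
    ring

/-- Γ(z + n + 1) is read off from Euler's sequence n^z n!/(z ⋯ (z + n)), and n! from Stirling's
sequence; every term left over has an evident limit. -/
theorem stirlingRem_add_nat_eq {z : ℂ} (hz : ∀ k : ℕ, z ≠ -k) {n : ℕ} (hn : 0 < n) :
    stirlingRem (z + (n + 1 : ℕ)) =
      -Real.log ‖Complex.GammaSeq z n / Complex.Gamma z‖ + Real.log (Stirling.stirlingSeq n) +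
      1 / 2 * Real.log 2 + (-(z.re + 1 / 2) * (Complex.log (1 + (z + 1) / n)).re -
        (n * Complex.log (1 + (z + 1) / n)).re + z.im * (Complex.log (1 + (z + 1) / n)).im +
        z.re + 1) := by
  have hnR : (0 : ℝ) < n := by exact_mod_cast hn
  have hnC : (n : ℂ) ≠ 0 := by exact_mod_cast hn.ne'
  have hG : Complex.Gamma z ≠ 0 := Complex.Gamma_ne_zero hz
  set w : ℂ := z + (n + 1 : ℕ) with hw
  have hw' : ∀ k : ℕ, w ≠ -k := by
    intro k hk
    refine hz (n + 1 + k) ?_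
    rw [hw] at hk
    push_cast at hk ⊢; linear_combination hk
  have hw0 : w ≠ 0 := by simpa using hw' 0
  have hGw : Complex.Gamma w ≠ 0 := Complex.Gamma_ne_zero hw'
  have hwn : 1 + (z + 1) / n = w / n := by rw [hw]; push_cast; field_simp; ring
  have hlre : (Complex.log (1 + (z + 1) / n)).re = Real.log ‖w‖ - Real.log n := by
    rw [Complex.log_re, hwn, norm_div, Complex.norm_natCast, Real.log_div (norm_ne_zero_iff.mpr hw0)
      hnR.ne']
  have hlim : (Complex.log (1 + (z + 1) / n)).im = w.arg := by
    rw [Complex.log_im, hwn, div_eq_inv_mul]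
    have : ((n : ℂ))⁻¹ = (((n : ℝ)⁻¹ : ℝ) : ℂ) := by push_cast; rfl
    rw [this, Complex.arg_real_mul _ (by positivity)]
  have hprod : ∏ j ∈ Finset.range (n + 1), (z + j) = Complex.Gamma w / Complex.Gamma z := by
    rw [hw, Gamma_add_nat hz, mul_div_assoc, div_self hG, mul_one]
  have hfac : (0 : ℝ) < n.factorial := by exact_mod_cast n.factorial_pos
  have hseq : Complex.GammaSeq z n / Complex.Gamma z =
      (n : ℂ) ^ z * n.factorial / Complex.Gamma w := by
    rw [Complex.GammaSeq, hprod]; field_simp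
  have hlog : Real.log ‖Complex.GammaSeq z n / Complex.Gamma z‖ =
      z.re * Real.log n + Real.log n.factorial - Real.log ‖Complex.Gamma w‖ := by
    rw [hseq, norm_div, norm_mul, Complex.norm_natCast_cpow_of_pos hn, Complex.norm_natCast,
      Real.log_div (by positivity) (norm_ne_zero_iff.mpr hGw),
      Real.log_mul (by positivity) hfac.ne', Real.log_rpow hnR]
  rw [hlog, Stirling.log_stirlingSeq_formula, Real.log_div hnR.ne' (Real.exp_pos 1).ne',
    Real.log_exp, Real.log_mul (by norm_num) hnR.ne', Complex.mul_re, hlre, hlim]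
  have hwre : w.re = z.re + n + 1 := by rw [hw]; simp; ring
  have hwim : w.im = z.im := by rw [hw]; simp
  simp only [stirlingRem, stirlingExp, hwre, hwim, Complex.natCast_re, Complex.natCast_im]
  ring

/-- Euler's limit for Γ and Stirling's formula for factorials, with n log(1 + (z + 1)/n) → z + 1.
This fixes the value from which the correction is summed backwards. -/
theorem tendsto_stirlingRem {z : ℂ} (hz : ∀ k : ℕ, z ≠ -k) :
    Tendsto (fun n : ℕ => stirlingRem (z + (n + 1 : ℕ))) atTop
      (𝓝 (1 / 2 * Real.log (2 * Real.pi))) := by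
  have hG : Complex.Gamma z ≠ 0 := Complex.Gamma_ne_zero hz
  have h1 : Tendsto (fun n : ℕ => Real.log ‖Complex.GammaSeq z n / Complex.Gamma z‖) atTop
      (𝓝 0) := by
    have := ((Complex.GammaSeq_tendsto_Gamma z).div_const (Complex.Gamma z)).norm.log
      (by simp [hG])
    simpa [hG] using this
  have h2 : Tendsto (fun n => Real.log (Stirling.stirlingSeq n)) atTop
      (𝓝 (1 / 2 * Real.log Real.pi)) := by
    have := Stirling.tendsto_stirlingSeq_sqrt_pi.log (by positivity)
    rwa [Real.log_sqrt Real.pi_pos.le, div_eq_inv_mul, ← one_div] at this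
  have hq : Tendsto (fun n : ℕ => (z + 1) / (n : ℂ)) atTop (𝓝 0) :=
    tendsto_const_div_atTop_nhds_zero_nat (z + 1)
  have h3 : Tendsto (fun n : ℕ => Complex.log (1 + (z + 1) / n)) atTop (𝓝 0) := by
    have : Tendsto (fun n : ℕ => 1 + (z + 1) / (n : ℂ)) atTop (𝓝 1) := by
      simpa using hq.const_add 1
    have := this.clog (by simp)
    simpa using this
  have h4 : Tendsto (fun n : ℕ => n * Complex.log (1 + (z + 1) / n)) atTop (𝓝 (z + 1)) := by
    refine Complex.tendsto_nat_mul_log_one_add_of_tendsto ?_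
    refine tendsto_const_nhds.congr' ?_
    filter_upwards [eventually_gt_atTop 0] with n hn
    have hnC : (n : ℂ) ≠ 0 := by exact_mod_cast hn.ne'
    field_simp
  have h3re := (Complex.continuous_re.tendsto _).comp h3
  have h3im := (Complex.continuous_im.tendsto _).comp h3
  have h4re := (Complex.continuous_re.tendsto _).comp h4
  have key := ((h1.neg.add h2).add_const (1 / 2 * Real.log 2)).add
    (((((h3re.const_mul (-(z.re + 1 / 2))).sub h4re).add (h3im.const_mul z.im)).add_const
      z.re).add_const 1)
  refine (key.congr' ?_).trans_eq ?_
  · filter_upwards [eventually_gt_atTop 0] with n hn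
    rw [stirlingRem_add_nat_eq hz hn]
    rfl
  · congr 1
    rw [Real.log_mul (by norm_num) Real.pi_pos.ne']
    simp
    ring

theorem stirlingRem_ge {z : ℂ} (hz : ∀ k : ℕ, z ≠ -k) : -4000 ≤ stirlingRem z := by
  have h : ∀ n : ℕ, stirlingRem (z + (n + 1 : ℕ)) - 4000 ≤ stirlingRem z := by
    intro n
    rw [stirlingRem_add_nat hz (n + 1)]
    linarith [sum_stirlingStep_ge z (n + 1)]
  have := le_of_tendsto' ((tendsto_stirlingRem hz).sub_const 4000) h
  have h0 : 0 ≤ Real.log (2 * Real.pi) := Real.log_nonneg (by linarith [Real.pi_gt_three])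
  linarith

theorem stirlingRem_le {z : ℂ} {d : ℝ} (hd : 0 < d) (hd1 : d ≤ 1)
    (hz : ∀ k : ℕ, d ≤ ‖z + k‖) : stirlingRem z ≤ 4010 - 700 * Real.log d := by
  have hz' : ∀ k : ℕ, z ≠ -k := by
    intro k hk
    have := hz k
    rw [hk] at this
    simp at this
    linarith
  have h : ∀ n : ℕ, stirlingRem z ≤ stirlingRem (z + (n + 1 : ℕ)) + (4000 - 700 * Real.log d) := by
    intro n
    rw [stirlingRem_add_nat hz' (n + 1)]
    linarith [sum_stirlingStep_le hd hd1 hz (n + 1)]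
  have := ge_of_tendsto' ((tendsto_stirlingRem hz').add_const (4000 - 700 * Real.log d)) h
  have h0 : Real.log (2 * Real.pi) ≤ 20 := by
    have := Real.log_le_sub_one_of_pos (x := 2 * Real.pi) (by positivity)
    linarith [Real.pi_lt_d2]
  linarith

/-- Stirling's upper bound for the reciprocal Gamma function, on the whole plane. -/
theorem exists_norm_inv_Gamma_le : ∃ C : ℝ, 0 < C ∧ ∀ z : ℂ,
    ‖(Complex.Gamma z)⁻¹‖ ≤ C * (1 + ‖z‖) * Real.exp (-stirlingExp z) := by
  refine ⟨Real.exp 4000, Real.exp_pos _, fun z => ?_⟩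
  by_cases hz : ∀ k : ℕ, z ≠ -k
  · have hG : 0 < ‖Complex.Gamma z‖ := norm_pos_iff.mpr (Complex.Gamma_ne_zero hz)
    have h0 : z ≠ 0 := by simpa using hz 0
    have hn : 0 < ‖z‖ := norm_pos_iff.mpr h0
    have h := stirlingRem_ge hz
    unfold stirlingRem at h
    rw [norm_inv, ← Real.exp_log (inv_pos.mpr hG), Real.log_inv]
    have hl : 1 / 2 * Real.log ‖z‖ ≤ Real.log (1 + ‖z‖) := by
      have h1 := Real.log_le_log hn (by linarith : ‖z‖ ≤ 1 + ‖z‖)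
      have h2 := Real.log_nonneg (by linarith : 1 ≤ 1 + ‖z‖)
      linarith
    calc _ ≤ Real.exp (4000 + Real.log (1 + ‖z‖) + -stirlingExp z) :=
          Real.exp_le_exp.mpr (by linarith)
      _ = _ := by rw [Real.exp_add, Real.exp_add, Real.exp_log (by positivity)]
  · push Not at hz
    obtain ⟨k, hk⟩ := hz
    -- At a pole Γ has the default value 0, so its inverse is 0, the true value of the entire
    -- function 1/Γ.
    rw [hk, Complex.Gamma_neg_nat_eq_zero, inv_zero, norm_zero]
    positivity

/-- Stirling's upper bound for the Gamma function away from the poles. -/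
theorem exists_norm_Gamma_le : ∃ C : ℝ, 0 < C ∧ ∃ N : ℕ, ∀ (z : ℂ) (d : ℝ), 0 < d → d ≤ 1 →
    (∀ k : ℕ, d ≤ ‖z + k‖) →
    ‖Complex.Gamma z‖ ≤ C * d⁻¹ ^ N * Real.exp (stirlingExp z) := by
  -- Of the exponent 701, 700 comes from summing the steps and the last unit absorbs -½ log‖z‖ ≤
  -- -log d.
  refine ⟨Real.exp 4010, Real.exp_pos _, 701, fun z d hd hd1 hz => ?_⟩
  have hz' : ∀ k : ℕ, z ≠ -k := by
    intro k hk
    have := hz k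
    rw [hk] at this
    simp at this
    linarith
  have hG : 0 < ‖Complex.Gamma z‖ := norm_pos_iff.mpr (Complex.Gamma_ne_zero hz')
  have h := stirlingRem_le hd hd1 hz
  have hdz : d ≤ ‖z‖ := by simpa using hz 0
  have hl := Real.log_le_log hd hdz
  have hl0 := Real.log_nonpos hd.le hd1
  unfold stirlingRem at h
  rw [← Real.exp_log hG]
  calc _ ≤ Real.exp (4010 + (701 : ℕ) * Real.log d⁻¹ + stirlingExp z) := by
        refine Real.exp_le_exp.mpr ?_
        rw [Real.log_inv]; push_cast; linarith
    _ = _ := by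
        rw [Real.exp_add, Real.exp_add, Real.exp_nat_mul, Real.exp_log (inv_pos.mpr hd)]

end

noncomputable section

/-! ### Deformation of Lipschitz contours -/

/-- An integral depending holomorphically on a parameter, under a uniform bound only. -/
theorem differentiableAt_integral_of_bound {α : Type*} [MeasurableSpace α] {μ : Measure α}
    {F : ℂ → α → ℂ} {z₀ : ℂ} {ε : ℝ} (hε : 0 < ε) {bound : α → ℝ}
    (hmeas : ∀ z ∈ Metric.ball z₀ ε, AEStronglyMeasurable (F z) μ)
    (hdiff : ∀ᵐ a ∂μ, DifferentiableOn ℂ (fun z => F z a) (Metric.ball z₀ ε))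
    (hb : ∀ᵐ a ∂μ, ∀ z ∈ Metric.ball z₀ ε, ‖F z a‖ ≤ bound a) (hint : Integrable bound μ) :
    DifferentiableAt ℂ (fun z => ∫ a, F z a ∂μ) z₀ := by
  have hz₀ : z₀ ∈ Metric.ball z₀ ε := Metric.mem_ball_self hε
  have hsub : ∀ z ∈ Metric.ball z₀ (ε / 2), Metric.closedBall z (ε / 4) ⊆ Metric.ball z₀ ε := by
    intro z hz v hv
    have h1 := Metric.mem_ball.mp hz
    have h2 := Metric.mem_closedBall.mp hv
    have := dist_triangle v z z₀
    rw [Metric.mem_ball]; linarith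
  have hderiv : ∀ᵐ a ∂μ, ∀ z ∈ Metric.ball z₀ (ε / 2), HasDerivAt (fun z => F z a)
      (deriv (fun z => F z a) z) z := by
    filter_upwards [hdiff] with a ha z hz
    exact (ha.differentiableAt (Metric.isOpen_ball.mem_nhds
      (Metric.ball_subset_ball (by linarith) hz))).hasDerivAt
  -- The derivative is an almost everywhere limit of difference quotients along a sequence tending
  -- to 0, so no joint measurability is needed.
  have hmeas' : AEStronglyMeasurable (fun a => deriv (fun z => F z a) z₀) μ := by
    let u : ℕ → ℂ := fun n => ((ε / 2 * (1 / ((n : ℝ) + 1)) : ℝ) : ℂ)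
    have hu0 : ∀ n, u n ≠ 0 := fun n => by
      simp only [u]; exact_mod_cast (by positivity : ε / 2 * (1 / ((n : ℝ) + 1)) ≠ 0)
    have hu : Tendsto u atTop (𝓝 0) := by
      have := (tendsto_one_div_add_atTop_nhds_zero_nat (𝕜 := ℝ)).const_mul (ε / 2)
      rw [mul_zero] at this
      have h2 := (Complex.continuous_ofReal.tendsto 0).comp this
      rw [Complex.ofReal_zero] at h2
      exact h2
    have humem : ∀ n, z₀ + u n ∈ Metric.ball z₀ ε := by
      intro n
      rw [Metric.mem_ball, dist_eq_norm, add_sub_cancel_left]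
      simp only [u]
      rw [Complex.norm_real, Real.norm_eq_abs, abs_of_pos (by positivity)]
      have : 1 / ((n : ℝ) + 1) ≤ 1 := by
        rw [div_le_one (by positivity)]; linarith [(Nat.cast_nonneg n : (0 : ℝ) ≤ n)]
      nlinarith
    refine aestronglyMeasurable_of_tendsto_ae atTop
      (f := fun n a => (u n)⁻¹ • (F (z₀ + u n) a - F z₀ a)) (fun n => ?_) ?_
    · exact ((hmeas _ (humem n)).sub (hmeas _ hz₀)).const_smul (u n)⁻¹
    · filter_upwards [hderiv] with a ha
      have h1 := (ha z₀ (Metric.mem_ball_self (by positivity))).tendsto_slope_zero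
      exact h1.comp (tendsto_nhdsWithin_iff.mpr ⟨hu, Eventually.of_forall hu0⟩)
  refine (hasDerivAt_integral_of_dominated_loc_of_deriv_le
    (F' := fun z a => deriv (fun z => F z a) z) (bound := fun a => bound a / (ε / 4))
    (Metric.ball_mem_nhds z₀ (half_pos hε)) ?_ ?_ hmeas' ?_ (hint.div_const _)
    hderiv).2.differentiableAt
  · exact Filter.eventually_of_mem (Metric.ball_mem_nhds z₀ hε) hmeas
  · exact hint.mono' (hmeas _ hz₀) (hb.mono fun a ha => ha _ hz₀)
  -- Cauchy's estimate on circles of radius ε/4 turns the bound on the function into a bound on its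
  -- derivative.
  · filter_upwards [hdiff, hb] with a ha hba z hz
    refine Complex.norm_deriv_le_of_forall_mem_sphere_norm_le (by positivity) ?_ ?_
    · exact (ha.mono (hsub z hz)).diffContOnCl_ball subset_rfl
    · exact fun v hv => hba v (hsub z hz (Metric.sphere_subset_closedBall hv))

variable {s : ℕ}

/-- In the sup norm the s-dimensional Hausdorff measure is Lebesgue measure, and Lipschitz maps
enlarge it by at most a constant factor. -/
theorem volume_image_eq_zero_of_lipschitz {K : NNReal} {f : (Fin s → ℝ) → (Fin s → ℝ)}
    (hf : LipschitzWith K f) {S : Set (Fin s → ℝ)} (hS : volume S = 0) :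
    volume (f '' S) = 0 := by
  have h := hf.hausdorffMeasure_image_le (d := Fintype.card (Fin s)) (by positivity) S
  rw [hausdorffMeasure_pi_real, hS, mul_zero] at h
  exact le_antisymm h bot_le

/-- Change of variables for Lipschitz perturbations of the identity. -/
theorem eventually_integral_comp_add_smul {K : NNReal} {w : (Fin s → ℝ) → (Fin s → ℝ)}
    (hw : LipschitzWith K w) {R : ℝ} (hsupp : ∀ x, R ≤ ‖x‖ → w x = 0) :
    ∀ᶠ t in 𝓝 (0 : ℝ), ∀ g : (Fin s → ℝ) → ℂ,
      ∫ x in Metric.ball 0 R, (1 + t • fderiv ℝ w x).det • g (x + t • w x) =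
        ∫ x in Metric.ball 0 R, g x := by
  -- Positivity of the determinant for small t lets the absolute value in the change of variables be
  -- dropped, so that the formula becomes polynomial in t.
  have hdet : ∀ᶠ A in 𝓝 (0 : (Fin s → ℝ) →L[ℝ] (Fin s → ℝ)), 0 < (1 + A).det := by
    have hc : Continuous fun A : (Fin s → ℝ) →L[ℝ] (Fin s → ℝ) => (1 + A).det :=
      ContinuousLinearMap.continuous_det.comp (by fun_prop)
    refine hc.continuousAt.eventually (lt_mem_nhds ?_)
    simp [ContinuousLinearMap.det]
  obtain ⟨δ, hδ, hδ'⟩ := Metric.eventually_nhds_iff.mp hdet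
  have h0 : Tendsto (fun t : ℝ => |t| * (K : ℝ)) (𝓝 0) (𝓝 0) := by
    have := (continuous_abs.tendsto (0 : ℝ)).mul_const (K : ℝ)
    simpa using this
  have h1 : ∀ᶠ t in 𝓝 (0 : ℝ), |t| * (K : ℝ) < δ := h0.eventually (gt_mem_nhds hδ)
  have h2 : ∀ᶠ t in 𝓝 (0 : ℝ), |t| * (K : ℝ) < 1 := h0.eventually (gt_mem_nhds one_pos)
  filter_upwards [h1, h2] with t ht1 ht2 g
  set T : (Fin s → ℝ) → (Fin s → ℝ) := fun x => x + t • w x with hT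
  set c : NNReal := ‖t‖₊ * K with hc
  have hcR : (c : ℝ) = |t| * K := by simp [hc]
  have hc1 : c < 1 := by rw [← NNReal.coe_lt_coe, hcR]; exact ht2
  have hlip : LipschitzWith c (fun x => t • w x) := (lipschitzWith_smul t).comp hw
  have hTlip : LipschitzWith (1 + c) T := LipschitzWith.id.add hlip
  have hinj : Function.Injective T := by
    intro x x' h
    have h' : x - x' = t • w x' - t • w x := by
      simp only [hT] at h
      rw [sub_eq_sub_iff_add_eq_add, h, add_comm]
    have := hlip.dist_le_mul x' x
    rw [dist_eq_norm, ← h', dist_comm, dist_eq_norm] at this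
    have hc1' : (c : ℝ) < 1 := hc1
    have h0 : ‖x - x'‖ = 0 := by nlinarith [norm_nonneg (x - x')]
    exact sub_eq_zero.mp (norm_eq_zero.mp h0)
  -- A preimage of z is a fixed point of the contraction x ↦ z - t w(x).
  have hsurj : Function.Surjective T := by
    intro z
    have hcon : ContractingWith c (fun x => z - t • w x) := by
      refine ⟨hc1, ?_⟩
      have := (LipschitzWith.const z).sub hlip
      rwa [zero_add] at this
    refine ⟨hcon.fixedPoint, ?_⟩
    have h : z - t • w hcon.fixedPoint = hcon.fixedPoint := hcon.fixedPoint_isFixedPt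
    simp only [hT]
    nth_rewrite 1 [← h]
    simp
  set B := Metric.ball (0 : Fin s → ℝ) R with hB
  -- T is a bijection of the whole space and the identity off B, hence preserves B.
  have hTB : T '' B = B := by
    have hfix : ∀ x ∉ B, T x = x := by
      intro x hx
      have : R ≤ ‖x‖ := by simpa [hB] using hx
      simp [hT, hsupp x this]
    ext z
    constructor
    · rintro ⟨x, hx, rfl⟩
      by_contra hz
      have := hinj (hfix _ hz)
      rw [this] at hz
      exact hz hx
    · intro hz
      obtain ⟨x, rfl⟩ := hsurj z
      refine ⟨x, ?_, rfl⟩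
      by_contra hx
      rw [hfix x hx] at hz
      exact hx hz
  set D := {x | DifferentiableAt ℝ w x} with hD
  have hDm : MeasurableSet D := measurableSet_of_differentiableAt ℝ w
  have hDae : volume Dᶜ = 0 := hw.ae_differentiableAt
  have hBm : MeasurableSet B := Metric.isOpen_ball.measurableSet
  have hder : ∀ x ∈ B ∩ D, HasFDerivWithinAt T (1 + t • fderiv ℝ w x) (B ∩ D) x := by
    intro x hx
    exact ((hasFDerivAt_id x).add ((hx.2.hasFDerivAt).const_smul t)).hasFDerivWithinAt
  have hcv := integral_image_eq_integral_abs_det_fderiv_smul volume (hBm.inter hDm) hder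
    (hinj.injOn) g
  -- Rademacher's theorem: w is differentiable off a null set, and T maps null sets to null sets.
  have e1 : (T '' (B ∩ D) : Set (Fin s → ℝ)) =ᵐ[volume] B := by
    refine (LE.le.eventuallyLE ?_).antisymm ?_
    · exact (Set.image_mono Set.inter_subset_left).trans hTB.le
    · rw [ae_le_set]
      refine measure_mono_null ?_ (volume_image_eq_zero_of_lipschitz hTlip hDae)
      rintro z ⟨hz, hz'⟩
      rw [← hTB] at hz
      obtain ⟨x, hx, rfl⟩ := hz
      exact ⟨x, fun hxD => hz' ⟨x, ⟨hx, hxD⟩, rfl⟩, rfl⟩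
  have e2 : (B ∩ D : Set (Fin s → ℝ)) =ᵐ[volume] B := by
    refine (LE.le.eventuallyLE Set.inter_subset_left).antisymm ?_
    rw [ae_le_set]
    refine measure_mono_null ?_ hDae
    rintro x ⟨hx, hx'⟩ hxD
    exact hx' ⟨hx, hxD⟩
  rw [setIntegral_congr_set e1, setIntegral_congr_set e2] at hcv
  rw [hcv]
  refine setIntegral_congr_fun hBm fun x _ => ?_
  have hpos : 0 < (1 + t • fderiv ℝ w x).det := by
    refine hδ' ?_
    rw [dist_zero_right, norm_smul, Real.norm_eq_abs]
    refine lt_of_le_of_lt ?_ ht1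
    gcongr
    exact norm_fderiv_le_of_lipschitz ℝ hw
  simp only [abs_of_pos hpos, hT]

/-- The Jacobian determinant `det (1 + κ Dw)` for a complex number `κ`. -/
def scaledJacobian (w : (Fin s → ℝ) → (Fin s → ℝ)) (κ : ℂ) (x : Fin s → ℝ) : ℂ :=
  (Matrix.of fun j k : Fin s =>
    (if j = k then (1 : ℂ) else 0) + κ * (fderiv ℝ w x (Pi.single k 1) j : ℂ)).det

theorem scaledJacobian_ofReal (w : (Fin s → ℝ) → (Fin s → ℝ)) (t : ℝ) (x : Fin s → ℝ) :
    scaledJacobian w t x = ((1 + t • fderiv ℝ w x).det : ℝ) := by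
  rw [ContinuousLinearMap.det, ← LinearMap.det_toMatrix', scaledJacobian,
    ← Complex.ofRealHom_eq_coe, ← Complex.ofRealHom_eq_coe, RingHom.map_det]
  congr 1
  ext j k
  simp [LinearMap.toMatrix'_apply, Matrix.one_apply]
  split_ifs <;> simp

theorem graphJacobian_const_add (y0 : Fin s → ℝ) (w : (Fin s → ℝ) → (Fin s → ℝ))
    (x : Fin s → ℝ) :
    graphJacobian (fun x => y0 + w x) x = scaledJacobian w Complex.I x := by
  unfold graphJacobian scaledJacobian
  rw [fderiv_const_add]

theorem norm_det_le {A : Matrix (Fin s) (Fin s) ℂ} {c : ℝ} (h : ∀ i j, ‖A i j‖ ≤ c) :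
    ‖A.det‖ ≤ s.factorial * c ^ s := by
  have := Matrix.det_le (abv := NormedField.toAbsoluteValue ℂ) (A := A) (x := c) h
  rw [Fintype.card_fin, nsmul_eq_mul] at this
  exact this

theorem norm_scaledJacobian_le {w : (Fin s → ℝ) → (Fin s → ℝ)} {κ : ℂ} {x : Fin s → ℝ}
    {c : ℝ} (h : ‖fderiv ℝ w x‖ ≤ c) :
    ‖scaledJacobian w κ x‖ ≤ s.factorial * (1 + ‖κ‖ * c) ^ s := by
  refine norm_det_le fun i j => ?_
  rw [Matrix.of_apply]
  refine (norm_add_le _ _).trans ?_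
  refine add_le_add (by split_ifs <;> simp) ?_
  rw [norm_mul, Complex.norm_real]
  gcongr
  refine (norm_le_pi_norm _ i).trans ((ContinuousLinearMap.le_opNorm _ _).trans ?_)
  rw [Pi.norm_single, norm_one, mul_one]
  exact h

theorem measurable_scaledJacobian (w : (Fin s → ℝ) → (Fin s → ℝ)) (κ : ℂ) :
    Measurable (scaledJacobian w κ) := by
  unfold scaledJacobian
  simp only [Matrix.det_apply]
  refine Finset.measurable_sum _ fun σ _ => ?_
  refine Measurable.const_smul (Finset.measurable_prod _ fun i _ => ?_) _
  simp only [Matrix.of_apply]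
  refine Measurable.const_add (Measurable.const_mul ?_ _) _
  refine Complex.measurable_ofReal.comp ?_
  exact (measurable_pi_apply _).comp (measurable_fderiv_apply_const ℝ w _)

theorem differentiable_scaledJacobian (w : (Fin s → ℝ) → (Fin s → ℝ)) (x : Fin s → ℝ) :
    Differentiable ℂ fun κ => scaledJacobian w κ x := by
  unfold scaledJacobian
  simp only [Matrix.det_apply, Matrix.of_apply]
  fun_prop

end

noncomputable section
variable {s : ℕ}

/-! ### Compactly supported deformations of a contour -/

theorem continuous_graphPoint {y : (Fin s → ℝ) → (Fin s → ℝ)} (hy : Continuous y) :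
    Continuous (graphPoint y) := by
  unfold graphPoint
  refine continuous_pi fun k => ?_
  have h1 : Continuous fun x : Fin s → ℝ => x k := continuous_apply k
  have h2 : Continuous fun x => y x k := (continuous_apply k).comp hy
  fun_prop

/-- A compactly supported Lipschitz deformation of a flat contour which stays in the domain of
holomorphy of the integrand does not change the integral. -/
theorem integral_deformation_eq_flat {Ω : Set (Fin s → ℂ)} (hΩ : IsOpen Ω)
    {G : (Fin s → ℂ) → ℂ} (hG : DifferentiableOn ℂ G Ω) (y0 : Fin s → ℝ)
    {w : (Fin s → ℝ) → (Fin s → ℝ)} {K : NNReal} (hw : LipschitzWith K w) {R : ℝ}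
    (hsupp : ∀ x, R ≤ ‖x‖ → w x = 0)
    (hmem : ∀ l ∈ Set.Icc (0 : ℝ) 1, ∀ x, graphPoint (fun x => y0 + l • w x) x ∈ Ω) :
    IntegrableOn (fun x => G (graphPoint (fun x => y0 + w x) x) *
        graphJacobian (fun x => y0 + w x) x) (Metric.ball 0 R) ∧
      ∫ x in Metric.ball 0 R, G (graphPoint (fun x => y0 + w x) x) *
        graphJacobian (fun x => y0 + w x) x =
      ∫ x in Metric.ball 0 R, G (graphPoint (fun _ => y0) x) := by
  -- A single complex parameter governs two motions: a real κ slides points along the flat contour,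
  -- while κ = il lifts the contour to height l w. The integral is holomorphic in κ.
  let pt : ℂ → (Fin s → ℝ) → (Fin s → ℂ) := fun κ x k =>
    graphPoint (fun _ => y0) x k + κ * (w x k : ℂ)
  have hptc : Continuous fun q : ℂ × (Fin s → ℝ) => pt q.1 q.2 := by
    refine continuous_pi fun k => ?_
    have h1 : Continuous fun q : ℂ × (Fin s → ℝ) => w q.2 k :=
      (continuous_apply k).comp (hw.continuous.comp continuous_snd)
    have h2 : Continuous fun q : ℂ × (Fin s → ℝ) => graphPoint (fun _ => y0) q.2 k :=
      (continuous_apply k).comp ((continuous_graphPoint continuous_const).comp continuous_snd)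
    exact h2.add (continuous_fst.mul (Complex.continuous_ofReal.comp h1))
  have hptI : ∀ (l : ℝ) x, pt (Complex.I * l) x = graphPoint (fun x => y0 + l • w x) x := by
    intro l x
    ext k
    simp only [pt, graphPoint, Pi.add_apply, Pi.smul_apply, smul_eq_mul]
    push_cast; ring
  have hB : IsCompact (Metric.closedBall (0 : Fin s → ℝ) R) := isCompact_closedBall 0 R
  have hBm : MeasurableSet (Metric.ball (0 : Fin s → ℝ) R) := Metric.isOpen_ball.measurableSet
  have hvol : volume (Metric.ball (0 : Fin s → ℝ) R) < ⊤ := measure_ball_lt_top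
  -- By compactness of the ball in x, each point il of the segment has a neighbourhood in κ on which
  -- the points stay in Ω and G is uniformly bounded.
  have hloc : ∀ l ∈ Set.Icc (0 : ℝ) 1, ∃ C : ℝ, ∃ ε > 0, ∀ κ ∈ Metric.ball (Complex.I * l) ε,
      ∀ x ∈ Metric.closedBall (0 : Fin s → ℝ) R, pt κ x ∈ Ω ∧ ‖G (pt κ x)‖ ≤ C := by
    intro l hl
    have hc1 : ContinuousOn (fun x => G (pt (Complex.I * l) x)) (Metric.closedBall 0 R) :=
      hG.continuousOn.comp (by fun_prop) (fun x _ => by rw [hptI]; exact hmem l hl x)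
    obtain ⟨C, hC⟩ := hB.exists_bound_of_continuousOn hc1
    refine ⟨C + 1, ?_⟩
    have := hB.eventually_forall_of_forall_eventually (x₀ := Complex.I * (l : ℂ))
      (P := fun κ x => pt κ x ∈ Ω ∧ ‖G (pt κ x)‖ ≤ C + 1) ?_
    · obtain ⟨ε, hε, h⟩ := Metric.eventually_nhds_iff_ball.mp this
      exact ⟨ε, hε, h⟩
    · intro x hx
      have hx' : pt (Complex.I * l) x ∈ Ω := by rw [hptI]; exact hmem l hl x
      have e1 : ∀ᶠ q : ℂ × (Fin s → ℝ) in 𝓝 (Complex.I * (l : ℂ), x), pt q.1 q.2 ∈ Ω :=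
        hptc.continuousAt.eventually (hΩ.mem_nhds hx')
      have hcG : ContinuousAt (fun q : ℂ × (Fin s → ℝ) => ‖G (pt q.1 q.2)‖)
          (Complex.I * (l : ℂ), x) := by
        have h1 : ContinuousAt G (pt (Complex.I * l) x) := hG.continuousOn.continuousAt (hΩ.mem_nhds hx')
        exact (ContinuousAt.comp (f := fun q : ℂ × (Fin s → ℝ) => pt q.1 q.2)
          h1 hptc.continuousAt).norm
      have e2 := hcG.eventually (gt_mem_nhds (lt_of_le_of_lt (hC x hx) (lt_add_one C)))
      filter_upwards [e1, e2] with q h1 h2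
      exact ⟨h1, h2.le⟩
  let F : ℂ → (Fin s → ℝ) → ℂ := fun κ x => G (pt κ x) * scaledJacobian w κ x
  have hmeas : ∀ κ, (∀ x ∈ Metric.closedBall (0 : Fin s → ℝ) R, pt κ x ∈ Ω) →
      AEStronglyMeasurable (F κ) (volume.restrict (Metric.ball 0 R)) := by
    intro κ hκ
    refine AEStronglyMeasurable.mul ?_
      (measurable_scaledJacobian w κ).stronglyMeasurable.aestronglyMeasurable
    refine ContinuousOn.aestronglyMeasurable ?_ hBm
    exact hG.continuousOn.comp (by fun_prop)
      (fun x hx => hκ x (Metric.ball_subset_closedBall hx))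
  have hJ : ∀ κ x, ‖scaledJacobian w κ x‖ ≤ s.factorial * (1 + ‖κ‖ * K) ^ s := fun κ x =>
    norm_scaledJacobian_le (norm_fderiv_le_of_lipschitz ℝ hw)
  have hint : ∀ l ∈ Set.Icc (0 : ℝ) 1, IntegrableOn (F (Complex.I * l)) (Metric.ball 0 R) := by
    intro l hl
    obtain ⟨C, ε, hε, h⟩ := hloc l hl
    have h0 := h _ (Metric.mem_ball_self hε)
    refine Integrable.mono' (g := fun _ => C * (s.factorial * (1 + ‖Complex.I * l‖ * K) ^ s))
      (integrableOn_const hvol.ne) (hmeas _ fun x hx => (h0 x hx).1) ?_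
    filter_upwards [ae_restrict_mem hBm] with x hx
    rw [norm_mul]
    have h1 := (h0 x (Metric.ball_subset_closedBall hx)).2
    exact mul_le_mul h1 (hJ _ _) (norm_nonneg _) ((norm_nonneg _).trans h1)
  let S : Set ℂ := (fun l : ℝ => Complex.I * (l : ℂ)) '' Set.Icc 0 1
  have hS : IsPreconnected S := (isPreconnected_Icc).image _ (by fun_prop)
  have hdiff : ∀ κ₀ ∈ S, ∃ ε > 0, ∀ κ ∈ Metric.ball κ₀ ε,
      DifferentiableAt ℂ (fun κ => ∫ x in Metric.ball 0 R, F κ x) κ := by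
    rintro _ ⟨l, hl, rfl⟩
    obtain ⟨C, ε, hε, h⟩ := hloc l hl
    refine ⟨ε / 2, half_pos hε, fun κ₁ hκ₁ => ?_⟩
    have hsub : Metric.ball κ₁ (ε / 2) ⊆ Metric.ball (Complex.I * (l : ℂ)) ε :=
      Metric.ball_subset_ball' (by linarith [Metric.mem_ball.mp hκ₁])
    refine differentiableAt_integral_of_bound (half_pos hε)
      (bound := fun _ => C * (s.factorial * (1 + (1 + ε) * K) ^ s))
      (fun κ hκ => hmeas κ fun x hx => (h κ (hsub hκ) x hx).1) ?_ ?_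
      (integrableOn_const hvol.ne)
    · filter_upwards [ae_restrict_mem hBm] with x hx
      refine DifferentiableOn.mul (fun κ hκ => ?_)
        (differentiable_scaledJacobian w x).differentiableOn
      have hx' := (h κ (hsub hκ) x (Metric.ball_subset_closedBall hx)).1
      have h1 : DifferentiableAt ℂ G (pt κ x) := hG.differentiableAt (hΩ.mem_nhds hx')
      have h2 : DifferentiableAt ℂ (fun κ => pt κ x) κ := by
        refine differentiableAt_pi.mpr fun k => ?_
        simp only [pt]
        fun_prop
      exact (DifferentiableAt.comp κ h1 h2).differentiableWithinAt
    · filter_upwards [ae_restrict_mem hBm] with x hx κ hκ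
      rw [norm_mul]
      have h1 := (h κ (hsub hκ) x (Metric.ball_subset_closedBall hx)).2
      refine mul_le_mul h1 ((hJ _ _).trans ?_) (norm_nonneg _) ((norm_nonneg _).trans h1)
      have hk : ‖κ‖ ≤ 1 + ε := by
        have h3 := mem_ball_iff_norm.mp (hsub hκ)
        have h4 : ‖Complex.I * (l : ℂ)‖ ≤ 1 := by
          rw [norm_mul, Complex.norm_I, one_mul, Complex.norm_real, Real.norm_eq_abs,
            abs_of_nonneg hl.1]
          exact hl.2
        have := norm_le_norm_add_norm_sub' κ (Complex.I * (l : ℂ))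
        linarith
      gcongr
  have han : AnalyticOnNhd ℂ (fun κ => ∫ x in Metric.ball 0 R, F κ x) S := by
    intro κ hκ
    obtain ⟨ε, hε, h⟩ := hdiff κ hκ
    exact DifferentiableOn.analyticAt (s := Metric.ball κ ε)
      (fun z hz => (h z hz).differentiableWithinAt) (Metric.ball_mem_nhds κ hε)
  have h0S : (0 : ℂ) ∈ S := ⟨0, by simp, by simp⟩
  have h1S : Complex.I ∈ S := ⟨1, by simp, by simp⟩
  -- For real t the integrand is the pullback of G on the flat contour under x ↦ x + t w(x),
  -- Jacobian included.
  have hreal : ∀ᶠ t : ℝ in 𝓝 (0 : ℝ), ∫ x in Metric.ball 0 R, F (t : ℂ) x =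
      ∫ x in Metric.ball 0 R, G (graphPoint (fun _ => y0) x) := by
    filter_upwards [eventually_integral_comp_add_smul hw hsupp] with t ht
    rw [← ht fun x => G (graphPoint (fun _ => y0) x)]
    refine setIntegral_congr_fun hBm fun x _ => ?_
    have : pt t x = graphPoint (fun _ => y0) (x + t • w x) := by
      ext k
      simp only [pt, graphPoint, Pi.add_apply, Pi.smul_apply, smul_eq_mul]
      push_cast; ring
    simp only [F, scaledJacobian_ofReal, this, Complex.real_smul]
    ring
  have hfreq : ∃ᶠ κ in 𝓝[≠] (0 : ℂ), ∫ x in Metric.ball 0 R, F κ x =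
      ∫ x in Metric.ball 0 R, G (graphPoint (fun _ => y0) x) := by
    have hT : Tendsto (fun t : ℝ => (t : ℂ)) (𝓝[≠] 0) (𝓝[≠] 0) := by
      refine tendsto_nhdsWithin_iff.mpr ⟨?_, ?_⟩
      · have := Complex.continuous_ofReal.tendsto 0
        rw [Complex.ofReal_zero] at this
        exact this.mono_left nhdsWithin_le_nhds
      · filter_upwards [self_mem_nhdsWithin] with t ht
        simpa using ht
    exact hT.frequently (hreal.filter_mono nhdsWithin_le_nhds).frequently
  -- Identity theorem on the segment from 0 to i: real κ accumulating at 0 suffice.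
  have key := han.eqOn_of_preconnected_of_frequently_eq
    (g := fun _ => ∫ x in Metric.ball 0 R, G (graphPoint (fun _ => y0) x))
    (fun _ _ => analyticAt_const) hS h0S hfreq h1S
  have e : F Complex.I = fun x => G (graphPoint (fun x => y0 + w x) x) *
        graphJacobian (fun x => y0 + w x) x := by
    ext x
    have := hptI 1 x
    rw [Complex.ofReal_one, mul_one] at this
    simp only [F, this, graphJacobian_const_add, one_smul]
  refine ⟨?_, ?_⟩
  · have := hint 1 (by simp)
    rwa [Complex.ofReal_one, mul_one, e] at this
  · rw [← e]; exact key

/-! ### Lipschitz cutoffs and comparison of two contours -/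

/-- The cutoff function which is `1` for `‖x‖ ≤ R` and `0` for `‖x‖ ≥ R + 1`. -/
def cutoff (R : ℝ) (x : Fin s → ℝ) : ℝ := max 0 (min 1 (R + 1 - ‖x‖))

theorem cutoff_mem (R : ℝ) (x : Fin s → ℝ) : cutoff R x ∈ Set.Icc (0 : ℝ) 1 :=
  ⟨le_max_left _ _, max_le zero_le_one (min_le_left _ _)⟩

theorem cutoff_eq_one {R : ℝ} {x : Fin s → ℝ} (h : ‖x‖ ≤ R) : cutoff R x = 1 := by
  rw [cutoff, min_eq_left (by linarith), max_eq_right zero_le_one]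

theorem cutoff_eq_zero {R : ℝ} {x : Fin s → ℝ} (h : R + 1 ≤ ‖x‖) : cutoff R x = 0 := by
  rw [cutoff, max_eq_left]
  exact (min_le_right _ _).trans (by linarith)

theorem abs_cutoff_sub_le (R : ℝ) (x x' : Fin s → ℝ) :
    |cutoff R x - cutoff R x'| ≤ ‖x - x'‖ := by
  have h1 : |cutoff R x - cutoff R x'| ≤ |min 1 (R + 1 - ‖x‖) - min 1 (R + 1 - ‖x'‖)| := by
    unfold cutoff
    rw [max_comm 0, max_comm 0]
    exact abs_max_sub_max_le_abs _ _ _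
  have h2 : |min 1 (R + 1 - ‖x‖) - min 1 (R + 1 - ‖x'‖)| ≤ |‖x'‖ - ‖x‖| := by
    have := abs_min_sub_min_le_max 1 (R + 1 - ‖x‖) 1 (R + 1 - ‖x'‖)
    refine this.trans ?_
    rw [sub_self, abs_zero, max_eq_right (abs_nonneg _)]
    apply le_of_eq; congr 1; ring
  refine h1.trans (h2.trans ?_)
  rw [norm_sub_rev]
  exact abs_norm_sub_norm_le x' x

/-- Nothing is assumed of v outside the closed ball, but the cutoff vanishes on its boundary and
beyond; a pair of points straddling it is handled by the Lipschitz bound of the cutoff alone. -/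
theorem lipschitzWith_cutoff_smul {R : ℝ} {v : (Fin s → ℝ) → (Fin s → ℝ)} {K : NNReal}
    (hv : LipschitzOnWith K v (Metric.closedBall 0 (R + 1))) :
    ∃ K' : NNReal, LipschitzWith K' fun x => cutoff R x • v x := by
  obtain ⟨M, hM⟩ := (isCompact_closedBall (0 : Fin s → ℝ) (R + 1)).exists_bound_of_continuousOn
    hv.continuousOn
  have hM' : ∀ x ∈ Metric.closedBall (0 : Fin s → ℝ) (R + 1), ‖v x‖ ≤ |M| :=
    fun x hx => (hM x hx).trans (le_abs_self M)
  have hin : ∀ x x', x ∈ Metric.closedBall (0 : Fin s → ℝ) (R + 1) →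
      x' ∈ Metric.closedBall (0 : Fin s → ℝ) (R + 1) →
      ‖cutoff R x • v x - cutoff R x' • v x'‖ ≤ (|M| + K) * ‖x - x'‖ := by
    intro x x' hx hx'
    have e : cutoff R x • v x - cutoff R x' • v x' =
        (cutoff R x - cutoff R x') • v x + cutoff R x' • (v x - v x') := by
      rw [sub_smul, smul_sub]; abel
    have hc := cutoff_mem R x'
    rw [e]
    refine (norm_add_le _ _).trans ?_
    rw [norm_smul, norm_smul, Real.norm_eq_abs, Real.norm_eq_abs, abs_of_nonneg hc.1]
    have h1 := abs_cutoff_sub_le R x x'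
    have h2 := hM' x hx
    have h3 := hv.norm_sub_le hx hx'
    have h4 : cutoff R x' * ‖v x - v x'‖ ≤ 1 * (K * ‖x - x'‖) :=
      mul_le_mul hc.2 h3 (norm_nonneg _) zero_le_one
    have h5 : |cutoff R x - cutoff R x'| * ‖v x‖ ≤ ‖x - x'‖ * |M| :=
      mul_le_mul h1 h2 (norm_nonneg _) (norm_nonneg _)
    linarith
  have hmix : ∀ x x', x ∈ Metric.closedBall (0 : Fin s → ℝ) (R + 1) →
      x' ∉ Metric.closedBall (0 : Fin s → ℝ) (R + 1) →
      ‖cutoff R x • v x - cutoff R x' • v x'‖ ≤ (|M| + K) * ‖x - x'‖ := by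
    intro x x' hx hx'
    have h0 : cutoff R x' = 0 := by
      apply cutoff_eq_zero
      simp only [Metric.mem_closedBall, dist_zero_right, not_le] at hx'
      exact hx'.le
    have h1 := abs_cutoff_sub_le R x x'
    have hK : (0 : ℝ) ≤ K := K.2
    have h2 := hM' x hx
    rw [h0, sub_zero] at h1
    rw [h0, zero_smul, sub_zero, norm_smul, Real.norm_eq_abs]
    have h5 : |cutoff R x| * ‖v x‖ ≤ ‖x - x'‖ * |M| :=
      mul_le_mul h1 h2 (norm_nonneg _) (norm_nonneg _)
    nlinarith [norm_nonneg (x - x')]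
  refine ⟨⟨|M| + K, by positivity⟩, LipschitzWith.of_dist_le_mul fun x x' => ?_⟩
  rw [dist_eq_norm, dist_eq_norm]
  change _ ≤ (|M| + K) * ‖x - x'‖
  by_cases hx : x ∈ Metric.closedBall (0 : Fin s → ℝ) (R + 1) <;>
    by_cases hx' : x' ∈ Metric.closedBall (0 : Fin s → ℝ) (R + 1)
  · exact hin x x' hx hx'
  · exact hmix x x' hx hx'
  · rw [norm_sub_rev, norm_sub_rev x]; exact hmix x' x hx' hx
  · simp only [Metric.mem_closedBall, dist_zero_right, not_le] at hx hx'
    rw [cutoff_eq_zero hx.le, cutoff_eq_zero hx'.le, zero_smul, zero_smul, sub_zero, norm_zero]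
    positivity

theorem graphJacobian_congr {y1 y2 : (Fin s → ℝ) → (Fin s → ℝ)} {x : Fin s → ℝ}
    (h : y1 =ᶠ[𝓝 x] y2) : graphJacobian y1 x = graphJacobian y2 x := by
  unfold graphJacobian
  rw [h.fderiv_eq]

/-- Two locally Lipschitz contours which agree outside a compact set, and which can both be
contracted to the same flat contour inside the domain of holomorphy of the integrand, give the same
integral. -/
theorem integral_contour_congr {Ω : Set (Fin s → ℂ)} (hΩ : IsOpen Ω)
    {G : (Fin s → ℂ) → ℂ} (hG : DifferentiableOn ℂ G Ω) (y0 : Fin s → ℝ)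
    {y1 y2 : (Fin s → ℝ) → (Fin s → ℝ)}
    (hy1 : ∀ R, ∃ K, LipschitzOnWith K y1 (Metric.closedBall 0 R))
    (hy2 : ∀ R, ∃ K, LipschitzOnWith K y2 (Metric.closedBall 0 R))
    {R : ℝ} (heq : ∀ x, R ≤ ‖x‖ → y1 x = y2 x)
    (hmem1 : ∀ l ∈ Set.Icc (0 : ℝ) 1, ∀ x, graphPoint (fun x => y0 + l • (y1 x - y0)) x ∈ Ω)
    (hmem2 : ∀ l ∈ Set.Icc (0 : ℝ) 1, ∀ x, graphPoint (fun x => y0 + l • (y2 x - y0)) x ∈ Ω)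
    (hint1 : Integrable fun x => G (graphPoint y1 x) * graphJacobian y1 x)
    (hint2 : Integrable fun x => G (graphPoint y2 x) * graphJacobian y2 x) :
    ∫ x, G (graphPoint y1 x) * graphJacobian y1 x =
      ∫ x, G (graphPoint y2 x) * graphJacobian y2 x := by
  -- Each contour is flattened outside radius R + 2 by the same cutoff, and the result is compared
  -- with the flat contour. The cutoff contour stays in Ω because it only reparametrizes the given
  -- contraction pointwise.
  have main : ∀ y : (Fin s → ℝ) → (Fin s → ℝ),
      (∀ R, ∃ K, LipschitzOnWith K y (Metric.closedBall 0 R)) →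
      (∀ l ∈ Set.Icc (0 : ℝ) 1, ∀ x, graphPoint (fun x => y0 + l • (y x - y0)) x ∈ Ω) →
      IntegrableOn (fun x => G (graphPoint (fun x => y0 + cutoff (R + 1) x • (y x - y0)) x) *
        graphJacobian (fun x => y0 + cutoff (R + 1) x • (y x - y0)) x)
        (Metric.ball 0 (R + 1 + 1)) ∧
      ∫ x in Metric.ball 0 (R + 1 + 1),
        G (graphPoint (fun x => y0 + cutoff (R + 1) x • (y x - y0)) x) *
        graphJacobian (fun x => y0 + cutoff (R + 1) x • (y x - y0)) x =
      ∫ x in Metric.ball 0 (R + 1 + 1), G (graphPoint (fun _ => y0) x) := by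
    intro y hy hmem
    obtain ⟨K, hK⟩ := hy (R + 1 + 1)
    have hK' : LipschitzOnWith K (fun x => y x - y0) (Metric.closedBall 0 (R + 1 + 1)) := by
      refine LipschitzOnWith.of_dist_le_mul fun x hx x' hx' => ?_
      rw [dist_sub_right]
      exact hK.dist_le_mul x hx x' hx'
    obtain ⟨K', hw⟩ := lipschitzWith_cutoff_smul hK'
    refine integral_deformation_eq_flat hΩ hG y0 hw (fun x hx => ?_) fun l hl x => ?_
    · rw [cutoff_eq_zero hx, zero_smul]
    · have hc := cutoff_mem (R + 1) x
      have := hmem (l * cutoff (R + 1) x) ⟨mul_nonneg hl.1 hc.1, mul_le_one₀ hl.2 hc.1 hc.2⟩ x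
      have e : graphPoint (fun x' => y0 + (l * cutoff (R + 1) x) • (y x' - y0)) x =
          graphPoint (fun x => y0 + l • cutoff (R + 1) x • (y x - y0)) x := by
        simp only [mul_smul]; rfl
      rwa [e] at this
  obtain ⟨i1, m1⟩ := main y1 hy1 hmem1
  obtain ⟨i2, m2⟩ := main y2 hy2 hmem2
  rw [← sub_eq_zero, ← integral_sub hint1 hint2]
  rw [← m2, ← sub_eq_zero, ← integral_sub i1 i2] at m1
  set w1 := fun x => y0 + cutoff (R + 1) x • (y1 x - y0) with hw1
  set w2 := fun x => y0 + cutoff (R + 1) x • (y2 x - y0) with hw2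
  have hnear : ∀ y : (Fin s → ℝ) → (Fin s → ℝ), ∀ x ∈ Metric.ball (0 : Fin s → ℝ) (R + 1),
      (fun x => y0 + cutoff (R + 1) x • (y x - y0)) =ᶠ[𝓝 x] y := by
    intro y x hx
    filter_upwards [Metric.isOpen_ball.mem_nhds hx] with z hz
    rw [cutoff_eq_one (by simpa using (Metric.mem_ball.mp hz).le), one_smul, add_sub_cancel]
  -- The Jacobian depends on the germ of the contour, so agreement is needed near x. This is why the
  -- cutoff starts at R + 1 and not at R.
  have hfar : ∀ x ∉ Metric.ball (0 : Fin s → ℝ) (R + 1), y1 =ᶠ[𝓝 x] y2 := by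
    intro x hx
    have hx' : R < ‖x‖ := by
      simp only [Metric.mem_ball, dist_zero_right, not_lt] at hx; linarith
    filter_upwards [(isOpen_lt continuous_const continuous_norm).mem_nhds hx'] with z hz
    exact heq z (le_of_lt hz)
  have hpt : ∀ {u v : (Fin s → ℝ) → (Fin s → ℝ)} {x}, u =ᶠ[𝓝 x] v →
      G (graphPoint u x) * graphJacobian u x = G (graphPoint v x) * graphJacobian v x := by
    intro u v x h
    rw [graphJacobian_congr h]
    congr 2
    ext k; simp only [graphPoint, h.eq_of_nhds]
  rw [← setIntegral_eq_integral_of_forall_compl_eq_zero (s := Metric.ball 0 (R + 1))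
    (fun x hx => by rw [hpt (hfar x hx), sub_self])]
  -- In the shell between R + 1 and R + 2 the two cutoff contours coincide, so their difference also
  -- lives in the ball of radius R + 1, where they are the given contours.
  rw [setIntegral_eq_of_subset_of_forall_sdiff_eq_zero (s := Metric.ball 0 (R + 1))
    Metric.isOpen_ball.measurableSet (Metric.ball_subset_ball (by linarith))] at m1
  · rw [← m1]
    refine setIntegral_congr_fun Metric.isOpen_ball.measurableSet fun x hx => ?_
    rw [hpt (hnear y1 x hx), hpt (hnear y2 x hx)]
  · intro x hx
    have : w1 =ᶠ[𝓝 x] w2 := by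
      filter_upwards [hfar x hx.2] with z hz
      change y0 + cutoff (R + 1) z • (y1 z - y0) = y0 + cutoff (R + 1) z • (y2 z - y0)
      rw [hz]
    rw [hpt this, sub_self]

end

noncomputable section

/-! ### Integrals of exponentials of linear forms, and their derivatives -/

section ExpIntegral

variable {α : Type*} [MeasurableSpace α] {μ : Measure α} {m : Type*} [Fintype m]

/-- The integral `∫ g exp (∑_c u_c Λ_c)` as a function of `Λ`. -/
def expIntegral (μ : Measure α) (g : α → ℂ) (u : α → m → ℂ) (Λ : m → ℂ) : ℂ :=
  ∫ a, g a * Complex.exp (∑ c, u a c * Λ c) ∂μ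

/-- The exponential moment condition under which `expIntegral` is analytic at `Λ`. -/
def HasExpMoment (μ : Measure α) (g : α → ℂ) (u : α → m → ℂ) (Λ : m → ℂ) : Prop :=
  ∃ ε : ℝ, 0 < ε ∧
    Integrable (fun a => ‖g a * Complex.exp (∑ c, u a c * Λ c)‖ * Real.exp (ε * ∑ c, ‖u a c‖)) μ

/-- The linear form with coefficients `v`. -/
def coeffForm (v : m → ℂ) : (m → ℂ) →L[ℂ] ℂ :=
  ∑ c, v c • ContinuousLinearMap.proj (R := ℂ) (φ := fun _ : m => ℂ) c

theorem coeffForm_apply (v h : m → ℂ) : coeffForm v h = ∑ c, v c * h c := by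
  simp [coeffForm]

theorem norm_coeffForm_le (v : m → ℂ) : ‖coeffForm v‖ ≤ ∑ c, ‖v c‖ := by
  refine ContinuousLinearMap.opNorm_le_bound _ (by positivity) fun h => ?_
  rw [coeffForm_apply, Finset.sum_mul]
  refine (norm_sum_le _ _).trans (Finset.sum_le_sum fun c _ => ?_)
  rw [norm_mul]
  gcongr
  exact norm_le_pi_norm h c

/-- The `n`-linear form `(h_1, …, h_n) ↦ L h_1 ⋯ L h_n / n!`. -/
def expTerm (n : ℕ) (L : (m → ℂ) →L[ℂ] ℂ) : (m → ℂ) [×n]→L[ℂ] ℂ :=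
  ((n.factorial : ℂ)⁻¹) •
    (ContinuousMultilinearMap.mkPiAlgebraFin ℂ n ℂ).compContinuousLinearMap fun _ => L

theorem continuous_expTerm (n : ℕ) : Continuous (expTerm (m := m) n) := by
  have h := (ContinuousMultilinearMap.compContinuousLinearMapLRight
    (E := fun _ : Fin n => m → ℂ) (ContinuousMultilinearMap.mkPiAlgebraFin ℂ n ℂ)).cont
  have h2 : Continuous fun L : (m → ℂ) →L[ℂ] ℂ =>
      (ContinuousMultilinearMap.mkPiAlgebraFin ℂ n ℂ).compContinuousLinearMap
        fun _ : Fin n => L :=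
    h.comp (continuous_pi fun _ => continuous_id)
  exact h2.const_smul ((n.factorial : ℂ)⁻¹)

theorem norm_expTerm_le (n : ℕ) (L : (m → ℂ) →L[ℂ] ℂ) :
    ‖expTerm n L‖ ≤ ‖L‖ ^ n / n.factorial := by
  unfold expTerm
  rw [norm_smul, norm_inv, Complex.norm_natCast, inv_mul_eq_div]
  gcongr
  refine (ContinuousMultilinearMap.norm_compContinuousLinearMap_le _ _).trans ?_
  simp

theorem expTerm_diag (n : ℕ) (L : (m → ℂ) →L[ℂ] ℂ) (h : m → ℂ) :
    expTerm n L (fun _ => h) = (L h) ^ n / n.factorial := by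
  simp [expTerm, ContinuousMultilinearMap.mkPiAlgebraFin_apply, inv_mul_eq_div]

/-- Expand exp(∑ u_c h_c) and integrate term by term; for ‖h‖ ≤ ε everything is dominated by the
exponential moment. This gives joint analyticity at once, with explicit Taylor coefficients. -/
theorem hasFPowerSeriesOnBall_expIntegral {g : α → ℂ} {u : α → m → ℂ} {Λ : m → ℂ}
    (hg : AEStronglyMeasurable g μ) (hu : ∀ c, AEStronglyMeasurable (fun a => u a c) μ)
    {ε : ℝ} (hε : 0 < ε) (hint : Integrable
      (fun a => ‖g a * Complex.exp (∑ c, u a c * Λ c)‖ * Real.exp (ε * ∑ c, ‖u a c‖)) μ) :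
    (∀ n, Integrable (fun a => (g a * Complex.exp (∑ c, u a c * Λ c)) •
      expTerm n (coeffForm (u a))) μ) ∧
    HasFPowerSeriesOnBall (expIntegral μ g u)
      (fun n => ∫ a, (g a * Complex.exp (∑ c, u a c * Λ c)) • expTerm n (coeffForm (u a)) ∂μ)
      Λ (ENNReal.ofReal ε) := by
  set G : α → ℂ := fun a => g a * Complex.exp (∑ c, u a c * Λ c) with hGdef
  set S : α → ℝ := fun a => ∑ c, ‖u a c‖ with hS
  have hS0 : ∀ a, 0 ≤ S a := fun a => Finset.sum_nonneg fun _ _ => norm_nonneg _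
  have hGm : AEStronglyMeasurable G μ := by
    refine hg.mul (Complex.continuous_exp.comp_aestronglyMeasurable ?_)
    exact Finset.aestronglyMeasurable_fun_sum _ fun c _ => (hu c).mul_const _
  have hLm : AEStronglyMeasurable (fun a => coeffForm (u a)) μ := by
    unfold coeffForm
    exact Finset.aestronglyMeasurable_fun_sum _ fun c _ => (hu c).smul_const _
  have hterm : ∀ n a, ‖G a • expTerm n (coeffForm (u a))‖ ≤ ‖G a‖ * (S a ^ n / n.factorial) := by
    intro n a
    rw [norm_smul]
    gcongr
    refine (norm_expTerm_le _ _).trans ?_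
    gcongr
    exact norm_coeffForm_le _
  -- The inequality tⁿ/n! ≤ eᵗ yields both the integrability of each coefficient and the radius of
  -- convergence.
  have hpow : ∀ n a, S a ^ n / n.factorial * ε ^ n ≤ Real.exp (ε * S a) := by
    intro n a
    have := Real.pow_div_factorial_le_exp (ε * S a) (mul_nonneg hε.le (hS0 a)) n
    rwa [mul_pow, mul_comm (ε ^ n), mul_div_right_comm] at this
  have hmeasn : ∀ n, AEStronglyMeasurable (fun a => G a • expTerm n (coeffForm (u a))) μ :=
    fun n => hGm.smul ((continuous_expTerm n).comp_aestronglyMeasurable hLm)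
  have hboundn : ∀ n a, ‖G a • expTerm n (coeffForm (u a))‖ ≤
      (ε ^ n)⁻¹ * (‖G a‖ * Real.exp (ε * S a)) := by
    intro n a
    refine (hterm n a).trans ?_
    rw [inv_mul_eq_div, le_div_iff₀ (by positivity), mul_assoc]
    gcongr
    exact hpow n a
  have hintn : ∀ n, Integrable (fun a => G a • expTerm n (coeffForm (u a))) μ := fun n =>
    (hint.const_mul ((ε ^ n)⁻¹)).mono' (hmeasn n) (Eventually.of_forall (hboundn n))
  refine ⟨hintn, ?_, by simpa using hε, ?_⟩
  · refine FormalMultilinearSeries.le_radius_of_bound _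
      (∫ a, ‖G a‖ * Real.exp (ε * S a) ∂μ) fun n => ?_
    rw [Real.coe_toNNReal _ hε.le]
    refine (mul_le_mul_of_nonneg_right (norm_integral_le_of_norm_le (hint.const_mul _)
      (Eventually.of_forall (hboundn n))) (by positivity)).trans ?_
    rw [integral_const_mul, mul_comm, ← mul_assoc, mul_inv_cancel₀ (by positivity), one_mul]
  · intro h hh
    have hh' : ‖h‖ ≤ ε := by
      rw [Metric.mem_eball, edist_zero_right, ← ofReal_norm,
        ENNReal.ofReal_lt_ofReal_iff hε] at hh
      exact hh.le
    have e : ∀ n a, (G a • expTerm n (coeffForm (u a))) (fun _ => h) =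
        G a * ((∑ c, u a c * h c) ^ n / n.factorial) := by
      intro n a
      rw [_root_.smul_apply, expTerm_diag, coeffForm_apply, smul_eq_mul]
    have e0 : (fun n => (∫ a, G a • expTerm n (coeffForm (u a)) ∂μ) fun _ => h) =
        fun n => ∫ a, G a * ((∑ c, u a c * h c) ^ n / n.factorial) ∂μ := by
      funext n
      rw [ContinuousMultilinearMap.integral_apply (hintn n)]
      simp only [e]
    change HasSum (fun n => (∫ a, G a • expTerm n (coeffForm (u a)) ∂μ) fun _ => h) _
    rw [e0]
    have hle : ∀ a, ‖∑ c, u a c * h c‖ ≤ ε * S a := by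
      intro a
      refine (norm_sum_le _ _).trans ?_
      rw [hS, Finset.mul_sum]
      refine Finset.sum_le_sum fun c _ => ?_
      rw [norm_mul, mul_comm]
      gcongr
      exact (norm_le_pi_norm h c).trans hh'
    have hsum : ∀ x : ℝ, HasSum (fun n : ℕ => x ^ n / n.factorial) (Real.exp x) := by
      intro x
      rw [Real.exp_eq_exp_ℝ]
      exact NormedSpace.expSeries_div_hasSum_exp x
    have hsumC : ∀ x : ℂ, HasSum (fun n : ℕ => x ^ n / n.factorial) (Complex.exp x) := by
      intro x
      rw [Complex.exp_eq_exp_ℂ]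
      exact NormedSpace.expSeries_div_hasSum_exp x
    have := hasSum_integral_of_dominated_convergence (μ := μ)
      (F := fun (n : ℕ) a => G a * ((∑ c, u a c * h c) ^ n / n.factorial))
      (f := fun a => G a * Complex.exp (∑ c, u a c * h c))
      (fun n a => ‖G a‖ * ((ε * S a) ^ n / n.factorial)) (fun n => ?_) (fun n => ?_) ?_ ?_ ?_
    · suffices e3 : expIntegral μ g u (Λ + h) = ∫ a, G a * Complex.exp (∑ c, u a c * h c) ∂μ by
        rw [e3]; exact this
      unfold expIntegral
      refine integral_congr_ae (Eventually.of_forall fun a => ?_)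
      simp only [hGdef, Pi.add_apply, mul_add, Finset.sum_add_distrib, Complex.exp_add]
      ring
    · simp only [div_eq_mul_inv]
      exact hGm.mul (((Finset.aestronglyMeasurable_fun_sum _ fun c _ =>
        (hu c).mul_const _).pow n).mul_const _)
    · refine Eventually.of_forall fun a => ?_
      rw [norm_mul, norm_div, norm_pow, Complex.norm_natCast]
      gcongr
      exact hle a
    · exact Eventually.of_forall fun a => (hsum _).summable.mul_left _
    · simpa only [tsum_mul_left, (hsum _).tsum_eq] using hint
    · exact Eventually.of_forall fun a => (hsumC _).mul_left _

theorem analyticAt_expIntegral {g : α → ℂ} {u : α → m → ℂ} {Λ : m → ℂ}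
    (hg : AEStronglyMeasurable g μ) (hu : ∀ c, AEStronglyMeasurable (fun a => u a c) μ)
    (h : HasExpMoment μ g u Λ) : AnalyticAt ℂ (expIntegral μ g u) Λ := by
  obtain ⟨ε, hε, hint⟩ := h
  exact (hasFPowerSeriesOnBall_expIntegral hg hu hε hint).2.analyticAt

/-- The derivative is the linear Taylor coefficient, whose integrand carries one factor u_c. -/
theorem fderiv_expIntegral_single [DecidableEq m] {g : α → ℂ} {u : α → m → ℂ} {Λ : m → ℂ}
    (hg : AEStronglyMeasurable g μ) (hu : ∀ c, AEStronglyMeasurable (fun a => u a c) μ)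
    (h : HasExpMoment μ g u Λ) (c : m) :
    fderiv ℂ (expIntegral μ g u) Λ (Pi.single c 1) =
      expIntegral μ (fun a => g a * u a c) u Λ := by
  obtain ⟨ε, hε, hint⟩ := h
  obtain ⟨hi, hp⟩ := hasFPowerSeriesOnBall_expIntegral hg hu hε hint
  rw [hp.hasFPowerSeriesAt.hasFDerivAt.fderiv, continuousMultilinearCurryFin1_apply,
    ContinuousMultilinearMap.integral_apply (hi 1), expIntegral]
  refine integral_congr_ae (Eventually.of_forall fun a => ?_)
  simp only [_root_.smul_apply]
  have : (Fin.snoc 0 (Pi.single c 1) : Fin 1 → m → ℂ) = fun _ => Pi.single c 1 := by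
    ext i; fin_cases i; rfl
  rw [this, expTerm_diag, coeffForm_apply]
  simp [Pi.single_apply]
  ring

end ExpIntegral

end

noncomputable section

/-! ### GKZ operators on integrals of monomials -/

/-- The falling factorial `u (u - 1) ⋯ (u - n + 1)`. -/
def fallProd (u : ℂ) (n : ℕ) : ℂ := ∏ j ∈ Finset.range n, (u - j)

theorem fallProd_succ (u : ℂ) (n : ℕ) : fallProd u (n + 1) = fallProd u n * (u - n) :=
  Finset.prod_range_succ _ _

section GKZIntegral

variable {α : Type*} [MeasurableSpace α] {μ : Measure α} {m : Type*} [Fintype m] [DecidableEq m]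

/-- The result of applying `∂^n` to the integral `∫ g ∏_c x_c^{u_c}`, where the powers are
`exp (u_c Λ_c (x))` for a branch `Λ_c` of `log x_c`. -/
def gkzIntegral (μ : Measure α) (g : α → ℂ) (u : α → m → ℂ) (Λ : (m → ℂ) → m → ℂ) (n : m → ℕ)
    (x : m → ℂ) : ℂ :=
  expIntegral μ (fun a => g a * ∏ c, fallProd (u a c) (n c)) (fun a c => u a c - n c) (Λ x)

/-- `Λ` is an analytic branch of the logarithms of the coordinates on `W`. -/
structure IsLogChart (W : Set (m → ℂ)) (Λ : (m → ℂ) → m → ℂ) : Prop where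
  isOpen : IsOpen W
  ne_zero : ∀ x ∈ W, ∀ c, x c ≠ 0
  exp_eq : ∀ x ∈ W, ∀ c, Complex.exp (Λ x c) = x c
  analyticAt : ∀ x ∈ W, AnalyticAt ℂ Λ x

omit [DecidableEq m] in
-- Differentiate exp(Λ_c) = x_c.
theorem IsLogChart.fderiv_apply {W : Set (m → ℂ)} {Λ : (m → ℂ) → m → ℂ} (h : IsLogChart W Λ)
    {x : m → ℂ} (hx : x ∈ W) (v : m → ℂ) : fderiv ℂ Λ x v = fun c => (x c)⁻¹ * v c := by
  ext c
  have hd : HasFDerivAt Λ (fderiv ℂ Λ x) x := (h.analyticAt x hx).differentiableAt.hasFDerivAt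
  have h1 := (hasFDerivAt_pi'.mp hd c).cexp
  have h2 : HasFDerivAt (fun x : m → ℂ => Complex.exp (Λ x c))
      (ContinuousLinearMap.proj (R := ℂ) (φ := fun _ : m => ℂ) c) x := by
    refine (ContinuousLinearMap.proj (R := ℂ) (φ := fun _ : m => ℂ) c).hasFDerivAt.congr_of_eventuallyEq ?_
    filter_upwards [h.isOpen.mem_nhds hx] with z hz
    exact h.exp_eq z hz c
  have h3 := congrArg (fun L : (m → ℂ) →L[ℂ] ℂ => L v) (h1.unique h2)
  simp only [h.exp_eq x hx c] at h3
  have h4 : x c * (fderiv ℂ Λ x v) c = v c := by simpa using h3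
  rw [← h4, ← mul_assoc, inv_mul_cancel₀ (h.ne_zero x hx c), one_mul]

variable {g : α → ℂ} {u : α → m → ℂ} {Λ : (m → ℂ) → m → ℂ} {W : Set (m → ℂ)}

theorem aestronglyMeasurable_mul_fallProd (hg : AEStronglyMeasurable g μ)
    (hu : ∀ c, AEStronglyMeasurable (fun a => u a c) μ) (n : m → ℕ) :
    AEStronglyMeasurable (fun a => g a * ∏ c, fallProd (u a c) (n c)) μ := by
  refine hg.mul (Finset.aestronglyMeasurable_fun_prod _ fun c _ => ?_)
  unfold fallProd
  exact Finset.aestronglyMeasurable_fun_prod _ fun j _ => (hu c).sub aestronglyMeasurable_const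

theorem partialDeriv_gkzIntegral (hΛ : IsLogChart W Λ) (hg : AEStronglyMeasurable g μ)
    (hu : ∀ c, AEStronglyMeasurable (fun a => u a c) μ) {n : m → ℕ} {x : m → ℂ} (hx : x ∈ W)
    (hmom : HasExpMoment μ (fun a => g a * ∏ c, fallProd (u a c) (n c))
      (fun a c => u a c - n c) (Λ x)) (c : m) :
    partialDeriv c (gkzIntegral μ g u Λ n) x =
      (x c)⁻¹ * expIntegral μ (fun a => (g a * ∏ c, fallProd (u a c) (n c)) * (u a c - n c))
        (fun a c => u a c - n c) (Λ x) := by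
  have hg' := aestronglyMeasurable_mul_fallProd hg hu n
  have hu' : ∀ c, AEStronglyMeasurable (fun a => u a c - n c) μ := fun c =>
    (hu c).sub aestronglyMeasurable_const
  have h1 := (analyticAt_expIntegral hg' hu' hmom).differentiableAt
  have h2 := (hΛ.analyticAt x hx).differentiableAt
  unfold partialDeriv gkzIntegral
  have h3 := fderiv_comp x h1 h2
  rw [Function.comp_def] at h3
  rw [h3, ContinuousLinearMap.comp_apply, hΛ.fderiv_apply hx]
  have h4 : (fun c' => (x c')⁻¹ * (Pi.single c 1 : m → ℂ) c') = (x c)⁻¹ • Pi.single c 1 := by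
    ext c'
    by_cases h : c' = c
    · subst h; simp
    · simp [h]
  rw [h4, map_smul, fderiv_expIntegral_single hg' hu' hmom, smul_eq_mul]

/-- The factor u_c - n_c extends the falling factorial by one term, and x_c⁻¹ lowers the exponent by
one, so the family of integrals is closed under ∂_c. -/
theorem partialDeriv_gkzIntegral_eq (hΛ : IsLogChart W Λ) (hg : AEStronglyMeasurable g μ)
    (hu : ∀ c, AEStronglyMeasurable (fun a => u a c) μ) {n : m → ℕ} {x : m → ℂ} (hx : x ∈ W)
    (hmom : HasExpMoment μ (fun a => g a * ∏ c, fallProd (u a c) (n c))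
      (fun a c => u a c - n c) (Λ x)) (c : m) :
    partialDeriv c (gkzIntegral μ g u Λ n) x = gkzIntegral μ g u Λ (n + Pi.single c 1) x := by
  rw [partialDeriv_gkzIntegral hΛ hg hu hx hmom, gkzIntegral, expIntegral, expIntegral,
    ← integral_const_mul]
  refine integral_congr_ae (Eventually.of_forall fun a => ?_)
  simp only []
  have h1 : ∏ c', fallProd (u a c') ((n + Pi.single c 1 : m → ℕ) c') =
      (∏ c', fallProd (u a c') (n c')) * (u a c - n c) := by
    rw [← Finset.mul_prod_erase _ _ (Finset.mem_univ c),
      ← Finset.mul_prod_erase Finset.univ (fun c' => fallProd (u a c') (n c')) (Finset.mem_univ c)]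
    have : ∏ c' ∈ Finset.univ.erase c, fallProd (u a c') ((n + Pi.single c 1 : m → ℕ) c') =
        ∏ c' ∈ Finset.univ.erase c, fallProd (u a c') (n c') := by
      refine Finset.prod_congr rfl fun c' hc' => ?_
      rw [Pi.add_apply, Pi.single_eq_of_ne (Finset.ne_of_mem_erase hc'), add_zero]
    rw [this, Pi.add_apply, Pi.single_eq_same, fallProd_succ]
    ring
  have h2 : ∑ c', (u a c' - ((n + Pi.single c 1 : m → ℕ) c' : ℕ)) * Λ x c' =
      (∑ c', (u a c' - n c') * Λ x c') - Λ x c := by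
    have : ∀ c', (u a c' - ((n + Pi.single c 1 : m → ℕ) c' : ℕ)) * Λ x c' =
        (u a c' - n c') * Λ x c' - if c' = c then Λ x c' else 0 := by
      intro c'
      by_cases h : c' = c
      · subst h; simp; ring
      · simp [h]
    rw [Finset.sum_congr rfl fun c' _ => this c', Finset.sum_sub_distrib]
    simp
  rw [h1, h2, Complex.exp_sub, hΛ.exp_eq x hx]
  ring

theorem partialDeriv_eqOn {Φ Ψ : (m → ℂ) → ℂ} (hW : IsOpen W) (h : Set.EqOn Φ Ψ W) (c : m) :
    Set.EqOn (partialDeriv c Φ) (partialDeriv c Ψ) W := by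
  intro x hx
  unfold partialDeriv
  rw [Filter.EventuallyEq.fderiv_eq (Filter.eventuallyEq_of_mem (hW.mem_nhds hx) h)]

/-- The equalities are carried on the open set W and not at a point, since every further derivative
needs the previous one on a neighbourhood. -/
theorem multiPartial_eqOn_gkzIntegral (hΛ : IsLogChart W Λ) (hg : AEStronglyMeasurable g μ)
    (hu : ∀ c, AEStronglyMeasurable (fun a => u a c) μ)
    (hmom : ∀ n : m → ℕ, ∀ x ∈ W, HasExpMoment μ (fun a => g a * ∏ c, fallProd (u a c) (n c))
      (fun a c => u a c - n c) (Λ x))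
    {Φ : (m → ℂ) → ℂ} (hΦ : Set.EqOn Φ (gkzIntegral μ g u Λ 0) W) (ℓ : m → ℕ) :
    Set.EqOn (multiPartial ℓ Φ) (gkzIntegral μ g u Λ ℓ) W := by
  have iter : ∀ (Ψ : (m → ℂ) → ℂ) (n : m → ℕ) (c : m) (k : ℕ),
      Set.EqOn Ψ (gkzIntegral μ g u Λ n) W →
      Set.EqOn ((partialDeriv c)^[k] Ψ) (gkzIntegral μ g u Λ (n + Pi.single c k)) W := by
    intro Ψ n c k h
    induction k with
    | zero => simpa using h
    | succ k ih =>
      rw [Function.iterate_succ_apply']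
      intro x hx
      rw [partialDeriv_eqOn hΛ.isOpen ih c hx, partialDeriv_gkzIntegral_eq hΛ hg hu hx (hmom _ x hx),
        add_assoc, ← Pi.single_add]
  have fold : ∀ l : List m, l.Nodup →
      Set.EqOn (l.foldr (fun j Ψ => (partialDeriv j)^[ℓ j] Ψ) Φ)
        (gkzIntegral μ g u Λ (fun c => if c ∈ l then ℓ c else 0)) W := by
    intro l
    induction l with
    | nil => intro _; simpa [← Pi.zero_def] using hΦ
    | cons j l ih =>
      intro hl
      obtain ⟨hj, hl⟩ := List.nodup_cons.mp hl
      have := iter _ _ j (ℓ j) (ih hl)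
      rw [List.foldr_cons]
      convert this using 2
      ext c
      by_cases h : c = j
      · subst h; simp [hj]
      · simp [h]
  have := fold (Finset.univ : Finset m).toList (Finset.nodup_toList _)
  simpa [multiPartial] using this

/-- The exponential moment absorbs one factor u_c, by t ≤ e^{εt}/ε. -/
theorem integrable_mul_coeff (hg : AEStronglyMeasurable g μ)
    (hu : ∀ c, AEStronglyMeasurable (fun a => u a c) μ) {Λ₀ : m → ℂ}
    (h : HasExpMoment μ g u Λ₀) (c : m) :
    Integrable (fun a => g a * u a c * Complex.exp (∑ c, u a c * Λ₀ c)) μ := by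
  obtain ⟨ε, hε, hint⟩ := h
  refine (hint.const_mul ε⁻¹).mono' ?_ (Eventually.of_forall fun a => ?_)
  · refine (hg.mul (hu c)).mul (Complex.continuous_exp.comp_aestronglyMeasurable ?_)
    exact Finset.aestronglyMeasurable_fun_sum _ fun c _ => (hu c).mul_const _
  · have h1 : ‖u a c‖ ≤ ∑ c, ‖u a c‖ :=
      Finset.single_le_sum (f := fun c => ‖u a c‖) (fun _ _ => norm_nonneg _) (Finset.mem_univ c)
    have h2 : ‖u a c‖ ≤ ε⁻¹ * Real.exp (ε * ∑ c, ‖u a c‖) := by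
      rw [inv_mul_eq_div, le_div_iff₀ hε]
      have := Real.add_one_le_exp (ε * ∑ c, ‖u a c‖)
      nlinarith
    calc _ = ‖g a * Complex.exp (∑ c, u a c * Λ₀ c)‖ * ‖u a c‖ := by
          rw [norm_mul, norm_mul, norm_mul]; ring
      _ ≤ ‖g a * Complex.exp (∑ c, u a c * Λ₀ c)‖ * (ε⁻¹ * Real.exp (ε * ∑ c, ‖u a c‖)) := by
          gcongr
      _ = _ := by ring

/-- Under the integral x_c ∂_c is multiplication by u_c, so the Euler operator vanishes already on
the integrand. -/
theorem euler_gkzIntegral (hΛ : IsLogChart W Λ) (hg : AEStronglyMeasurable g μ)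
    (hu : ∀ c, AEStronglyMeasurable (fun a => u a c) μ) {x : m → ℂ} (hx : x ∈ W)
    (hmom : HasExpMoment μ g u (Λ x)) {A : m → ℂ} {β : ℂ} (hA : ∀ a, ∑ c, A c * u a c = β) :
    ∑ c, A c * x c * partialDeriv c (gkzIntegral μ g u Λ 0) x = β * gkzIntegral μ g u Λ 0 x := by
  have h0 : (fun a => g a * ∏ c, fallProd (u a c) ((0 : m → ℕ) c)) = g := by
    ext a; simp [fallProd]
  have h0' : (fun a c => u a c - ((0 : m → ℕ) c : ℂ)) = u := by
    ext a c; simp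
  have h1 : ∀ c, A c * x c * partialDeriv c (gkzIntegral μ g u Λ 0) x =
      ∫ a, A c * (g a * u a c * Complex.exp (∑ c, u a c * Λ x c)) ∂μ := by
    intro c
    rw [partialDeriv_gkzIntegral hΛ hg hu hx (by rwa [h0, h0']), integral_const_mul, h0']
    simp only [congrFun h0, expIntegral]
    rw [mul_assoc, ← mul_assoc (x c), mul_inv_cancel₀ (hΛ.ne_zero x hx c), one_mul]
    simp
  rw [Finset.sum_congr rfl fun c _ => h1 c, ← integral_finsetSum _ fun c _ =>
    (integrable_mul_coeff hg hu hmom c).const_mul _, gkzIntegral, h0, h0', expIntegral,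
    ← integral_const_mul]
  refine integral_congr_ae (Eventually.of_forall fun a => ?_)
  simp only []
  rw [← hA a, Finset.sum_mul]
  refine Finset.sum_congr rfl fun c _ => ?_
  ring

end GKZIntegral

end

noncomputable section

/-! ### Functions of polynomial growth -/

section PolyBounded

variable {E : Type*} [NormedAddCommGroup E]

/-- The real function `h` has at most polynomial growth. -/
def PolyBounded (h : E → ℝ) : Prop :=
  ∃ C : ℝ, 0 ≤ C ∧ ∃ N : ℕ, ∀ x, |h x| ≤ C * (1 + ‖x‖) ^ N

namespace PolyBounded

variable {h k : E → ℝ}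

theorem mono (hk : PolyBounded k) (hle : ∀ x, |h x| ≤ |k x|) : PolyBounded h := by
  obtain ⟨C, hC, N, hN⟩ := hk
  exact ⟨C, hC, N, fun x => (hle x).trans (hN x)⟩

theorem const (c : ℝ) : PolyBounded fun _ : E => c :=
  ⟨|c|, abs_nonneg c, 0, fun x => by simp⟩

theorem norm_id : PolyBounded fun x : E => ‖x‖ :=
  ⟨1, zero_le_one, 1, fun x => by simp⟩

theorem add (hh : PolyBounded h) (hk : PolyBounded k) : PolyBounded fun x => h x + k x := by
  obtain ⟨C, hC, N, hN⟩ := hh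
  obtain ⟨D, hD, M, hM⟩ := hk
  refine ⟨C + D, add_nonneg hC hD, N + M, fun x => ?_⟩
  have h1 : 1 ≤ 1 + ‖x‖ := by linarith [norm_nonneg x]
  have a := pow_le_pow_right₀ h1 (Nat.le_add_right N M)
  have b := pow_le_pow_right₀ h1 (Nat.le_add_left M N)
  calc _ ≤ |h x| + |k x| := abs_add_le _ _
    _ ≤ C * (1 + ‖x‖) ^ N + D * (1 + ‖x‖) ^ M := add_le_add (hN x) (hM x)
    _ ≤ C * (1 + ‖x‖) ^ (N + M) + D * (1 + ‖x‖) ^ (N + M) := by gcongr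
    _ = _ := by ring

theorem mul (hh : PolyBounded h) (hk : PolyBounded k) : PolyBounded fun x => h x * k x := by
  obtain ⟨C, hC, N, hN⟩ := hh
  obtain ⟨D, hD, M, hM⟩ := hk
  refine ⟨C * D, mul_nonneg hC hD, N + M, fun x => ?_⟩
  rw [abs_mul, pow_add]
  calc _ ≤ (C * (1 + ‖x‖) ^ N) * (D * (1 + ‖x‖) ^ M) :=
        mul_le_mul (hN x) (hM x) (abs_nonneg _) (by positivity)
    _ = _ := by ring

theorem pow (hh : PolyBounded h) (n : ℕ) : PolyBounded fun x => h x ^ n := by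
  induction n with
  | zero => simpa using const 1
  | succ n ih => simpa only [pow_succ] using ih.mul hh

theorem sum {ι : Type*} {S : Finset ι} {h : ι → E → ℝ} (hh : ∀ i ∈ S, PolyBounded (h i)) :
    PolyBounded fun x => ∑ i ∈ S, h i x := by
  classical
  induction S using Finset.induction_on with
  | empty => simpa using const 0
  | insert i S hi ih =>
    simp only [Finset.sum_insert hi]
    exact (hh i (Finset.mem_insert_self _ _)).add
      (ih fun j hj => hh j (Finset.mem_insert_of_mem hj))

theorem prod {ι : Type*} {S : Finset ι} {h : ι → E → ℝ} (hh : ∀ i ∈ S, PolyBounded (h i)) :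
    PolyBounded fun x => ∏ i ∈ S, h i x := by
  classical
  induction S using Finset.induction_on with
  | empty => simpa using const 1
  | insert i S hi ih =>
    simp only [Finset.prod_insert hi]
    exact (hh i (Finset.mem_insert_self _ _)).mul
      (ih fun j hj => hh j (Finset.mem_insert_of_mem hj))

theorem mono' (hk : PolyBounded k) (h0 : ∀ x, 0 ≤ h x) (hle : ∀ x, h x ≤ k x) :
    PolyBounded h :=
  hk.mono fun x => by
    rw [abs_of_nonneg (h0 x)]
    exact (hle x).trans (le_abs_self _)

end PolyBounded

end PolyBounded

/-! ### Growth of the integrand along a contour -/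

section Growth

variable {s : ℕ} {G : AbelianGLSM s} {y : (Fin s → ℝ) → (Fin s → ℝ)}

theorem AbelianGLSM.IsContour.polyBounded_y (hy : G.IsContour y) : PolyBounded fun x => ‖y x‖ := by
  obtain ⟨C, N, h⟩ := hy.lipschitz
  have h1 : PolyBounded fun x : Fin s → ℝ => ‖y 0‖ + C * (1 + ‖x‖) ^ N * ‖x‖ :=
    (PolyBounded.const _).add (((PolyBounded.const C).mul
      (((PolyBounded.const 1).add PolyBounded.norm_id).pow N)).mul PolyBounded.norm_id)
  refine h1.mono' (fun x => norm_nonneg _) fun x => ?_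
  have := h x 0
  rw [norm_zero, add_zero, sub_zero] at this
  have h2 := norm_le_norm_add_norm_sub' (y x) (y 0)
  linarith

theorem AbelianGLSM.IsContour.continuous (hy : G.IsContour y) : Continuous y := by
  obtain ⟨C, N, h⟩ := hy.lipschitz
  refine continuous_iff_continuousAt.mpr fun x₀ => ?_
  rw [ContinuousAt, tendsto_iff_norm_sub_tendsto_zero]
  have h1 : Continuous fun x : Fin s → ℝ => C * (1 + ‖x‖ + ‖x₀‖) ^ N * ‖x - x₀‖ := by fun_prop
  have h2 := h1.tendsto x₀
  rw [sub_self, norm_zero, mul_zero] at h2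
  exact squeeze_zero (fun _ => norm_nonneg _) (fun x => h x x₀) h2

theorem norm_fderiv_le_of_polyLipschitz {w : (Fin s → ℝ) → (Fin s → ℝ)} {C : ℝ} {N : ℕ}
    (h : ∀ x x', ‖w x - w x'‖ ≤ C * (1 + ‖x‖ + ‖x'‖) ^ N * ‖x - x'‖) (x : Fin s → ℝ) :
    ‖fderiv ℝ w x‖ ≤ |C| * (1 + (‖x‖ + 1) + ‖x‖) ^ N := by
  refine norm_fderiv_le_of_lip' ℝ (by positivity) ?_
  filter_upwards [Metric.ball_mem_nhds x one_pos] with x' hx'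
  refine (h x' x).trans ?_
  have h1 : ‖x'‖ ≤ ‖x‖ + 1 := by
    have := mem_ball_iff_norm.mp hx'
    have := norm_le_norm_add_norm_sub' x' x
    linarith
  gcongr
  exact le_abs_self C

theorem graphJacobian_eq_scaledJacobian (w : (Fin s → ℝ) → (Fin s → ℝ)) (x : Fin s → ℝ) :
    graphJacobian w x = scaledJacobian w Complex.I x := rfl

/-- One bound for all contours with given Lipschitz constants, because it is applied to a whole
family of translated and cut off contours. -/
theorem exists_norm_graphJacobian_le (C : ℝ) (N : ℕ) : ∃ D : (Fin s → ℝ) → ℝ, PolyBounded D ∧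
    ∀ w : (Fin s → ℝ) → (Fin s → ℝ),
      (∀ x x', ‖w x - w x'‖ ≤ C * (1 + ‖x‖ + ‖x'‖) ^ N * ‖x - x'‖) →
      ∀ x, ‖graphJacobian w x‖ ≤ D x := by
  refine ⟨fun x => s.factorial * (1 + ‖Complex.I‖ * (|C| * (1 + (‖x‖ + 1) + ‖x‖) ^ N)) ^ s,
    ?_, fun w hw x => ?_⟩
  · have h1 : PolyBounded fun x : Fin s → ℝ => 1 + (‖x‖ + 1) + ‖x‖ :=
      ((PolyBounded.const 1).add (PolyBounded.norm_id.add (PolyBounded.const 1))).add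
        PolyBounded.norm_id
    exact (PolyBounded.const _).mul (((PolyBounded.const 1).add ((PolyBounded.const _).mul
      ((PolyBounded.const _).mul (h1.pow N)))).pow s)
  · rw [graphJacobian_eq_scaledJacobian]
    exact norm_scaledJacobian_le (norm_fderiv_le_of_polyLipschitz hw x)

theorem AbelianGLSM.IsContour.polyBounded_graphPoint (hy : G.IsContour y) (k : Fin s) :
    PolyBounded fun x => ‖graphPoint y x k‖ := by
  refine (PolyBounded.norm_id.add hy.polyBounded_y).mono' (fun _ => norm_nonneg _) fun x => ?_
  refine (norm_add_le _ _).trans ?_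
  rw [norm_mul, Complex.norm_I, one_mul, Complex.norm_real, Complex.norm_real]
  exact add_le_add (norm_le_pi_norm x k) (norm_le_pi_norm (y x) k)

theorem norm_pairing_le (w : Fin s → ℤ) (σ : Fin s → ℂ) :
    ‖pairing w σ‖ ≤ ∑ k, ‖(w k : ℂ)‖ * ‖σ k‖ := by
  refine (norm_sum_le _ _).trans (Finset.sum_le_sum fun k _ => ?_)
  rw [norm_mul]

theorem AbelianGLSM.IsContour.polyBounded_pairing (hy : G.IsContour y) (w : Fin s → ℤ) :
    PolyBounded fun x => ‖pairing w (graphPoint y x)‖ :=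
  (PolyBounded.sum fun k _ => (PolyBounded.const _).mul (hy.polyBounded_graphPoint k)).mono'
    (fun _ => norm_nonneg _) fun _ => norm_pairing_le _ _

theorem continuous_pairing (w : Fin s → ℤ) : Continuous (pairing w) := by
  unfold pairing; fun_prop

theorem AbelianGLSM.IsContour.continuous_pairing (hy : G.IsContour y) (w : Fin s → ℤ) :
    Continuous fun x => pairing w (graphPoint y x) :=
  (DoubleCoverPeriods.continuous_pairing w).comp (continuous_graphPoint hy.continuous)

/-- Im(-Q(log(iQ) - 1)) is Re(iQ(log(iQ) - 1)), the Stirling exponent at iQ. Thus exp(Im W_eff) is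
the Stirling size of the Gamma product times the moduli of the other exponentials. -/
theorem AbelianGLSM.effPotential_im (G : AbelianGLSM s) (q : Fin s → ℤ) (t σ : Fin s → ℂ) :
    (G.effPotential q t σ).im = ∑ j, stirlingExp (Complex.I * pairing (G.charge j) σ) -
      (∑ k, t k * σ k).im + 2 * Real.pi * (pairing q σ).re := by
  have h1 : ∀ j, (-(pairing (G.charge j) σ *
      (Complex.log (Complex.I * pairing (G.charge j) σ) - 1))).im =
      stirlingExp (Complex.I * pairing (G.charge j) σ) := by
    intro j
    rw [stirlingExp_eq_re, mul_assoc, Complex.I_mul_re, Complex.neg_im]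
  unfold effPotential
  rw [Complex.add_im, Complex.sub_im, ← Finset.sum_neg_distrib, Complex.im_sum]
  simp only [h1]
  congr 1
  have : 2 * (Real.pi : ℂ) * Complex.I * pairing q σ =
      Complex.I * ((2 * Real.pi : ℝ) * pairing q σ) := by push_cast; ring
  rw [this, Complex.I_mul_im, Complex.re_ofReal_mul]

theorem AbelianGLSM.IsContour.polyBounded_stirlingExp (hy : G.IsContour y) (w : Fin s → ℤ) :
    PolyBounded fun x => stirlingExp (Complex.I * pairing w (graphPoint y x)) := by
  have h := hy.polyBounded_pairing w
  refine (((PolyBounded.const 1).add (h.pow 2)).add ((PolyBounded.const 5).mul h)).mono fun x => ?_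
  refine (abs_stirlingExp_le _).trans ((le_of_eq ?_).trans (le_abs_self _))
  rw [norm_mul, Complex.norm_I, one_mul]

theorem AbelianGLSM.IsContour.polyBounded_effPotential_im (hy : G.IsContour y) (q : Fin s → ℤ)
    (t : Fin s → ℂ) : PolyBounded fun x => (G.effPotential q t (graphPoint y x)).im := by
  have h1 : PolyBounded fun x => (∑ k, t k * graphPoint y x k).im := by
    refine (PolyBounded.sum (S := Finset.univ) (h := fun k x => ‖t k‖ * ‖graphPoint y x k‖)
      fun k _ => (PolyBounded.const _).mul (hy.polyBounded_graphPoint k)).mono fun x => ?_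
    refine (Complex.abs_im_le_norm _).trans (((norm_sum_le _ _).trans (le_of_eq ?_)).trans
      (le_abs_self _))
    simp only [norm_mul]
  have h2 : PolyBounded fun x => (pairing q (graphPoint y x)).re :=
    (hy.polyBounded_pairing q).mono fun x => by
      rw [abs_norm]; exact Complex.abs_re_le_norm _
  have h3 : PolyBounded fun x => -(∑ k, t k * graphPoint y x k).im :=
    h1.mono fun x => by rw [abs_neg]
  simp only [AbelianGLSM.effPotential_im, sub_eq_add_neg]
  exact ((PolyBounded.sum fun j _ => hy.polyBounded_stirlingExp _).add h3).add
    ((PolyBounded.const _).mul h2)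

variable {B : Brane G}

/-- Outside a compact set Im W_eff ≤ -N log‖x‖, which beats the power N; on the compact set
polynomial growth of the exponent suffices. -/
theorem exists_exp_effPotential_le (hy : G.IsContour y) {t : Fin s → ℂ}
    (ht : t ∈ B.admissibleParams y) (a : B.ι) (N : ℕ) : ∃ C : ℝ, 0 ≤ C ∧ ∀ x,
    (1 + ‖x‖) ^ N * Real.exp (G.effPotential (B.gaugeWeight a) t (graphPoint y x)).im ≤ C := by
  obtain ⟨C, hC, M, hM⟩ := hy.polyBounded_effPotential_im (B.gaugeWeight a) t
  have e1 := (ht a).eventually (eventually_le_atBot (-(N : ℝ)))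
  have e2 : ∀ᶠ x in cocompact (Fin s → ℝ), 2 ≤ ‖x‖ :=
    (tendsto_norm_cocompact_atTop (E := Fin s → ℝ)).eventually (eventually_ge_atTop 2)
  obtain ⟨K, hK, hKs⟩ := mem_cocompact.mp (e1.and e2)
  obtain ⟨ρ, hρ⟩ := hK.isBounded.exists_norm_le
  refine ⟨2 ^ N + (1 + |ρ|) ^ N * Real.exp (C * (1 + |ρ|) ^ M), by positivity, fun x => ?_⟩
  by_cases hx : x ∈ K
  · have h1 : ‖x‖ ≤ |ρ| := (hρ x hx).trans (le_abs_self ρ)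
    have h2 : (G.effPotential (B.gaugeWeight a) t (graphPoint y x)).im ≤ C * (1 + |ρ|) ^ M :=
      (le_abs_self _).trans ((hM x).trans (by gcongr))
    calc _ ≤ (1 + |ρ|) ^ N * Real.exp (C * (1 + |ρ|) ^ M) := by gcongr
      _ ≤ _ := le_add_of_nonneg_left (by positivity)
  · obtain ⟨h1, h2⟩ := hKs hx
    have hpos : 0 < ‖x‖ := by linarith
    have hl : 0 < Real.log ‖x‖ := Real.log_pos (by linarith)
    rw [div_le_iff₀ hl] at h1
    calc _ ≤ (2 * ‖x‖) ^ N * Real.exp (-N * Real.log ‖x‖) := by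
          gcongr; linarith
      _ = 2 ^ N := by
          rw [neg_mul, Real.exp_neg, Real.exp_nat_mul, Real.exp_log hpos, mul_pow, mul_assoc,
            mul_inv_cancel₀ (by positivity), mul_one]
      _ ≤ _ := le_add_of_nonneg_right (by positivity)

/-- In the interior of the set of admissible parameters, the majorants of the integrand decay
faster than any power, even after multiplication with a small exponential. -/
theorem exists_exp_effPotential_mul_exp_le (hy : G.IsContour y) {t : Fin s → ℂ}
    (ht : t ∈ interior (B.admissibleParams y)) : ∃ ε : ℝ, 0 < ε ∧ ∀ N : ℕ, ∃ C : ℝ, 0 ≤ C ∧ ∀ x a,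
    (1 + ‖x‖) ^ N * (Real.exp (G.effPotential (B.gaugeWeight a) t (graphPoint y x)).im *
      Real.exp (ε * ∑ k, ‖graphPoint y x k‖)) ≤ C := by
  obtain ⟨δ, hδ, hδ'⟩ := Metric.mem_nhds_iff.mp (mem_interior_iff_mem_nhds.mp ht)
  -- Modulus signs are traded for finitely many linear perturbations: for each ζ one of the four
  -- directions satisfies -Im(2vζ) ≥ ‖ζ‖, because ‖ζ‖ ≤ 2 max(|Re ζ|, |Im ζ|).
  let v : Fin 4 → ℂ := ![1, Complex.I, -1, -Complex.I]
  have hv : ∀ j, ‖v j‖ = 1 := by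
    intro j; fin_cases j <;> simp [v]
  have hv' : ∀ ζ : ℂ, ∃ j, ‖ζ‖ ≤ -(2 * v j * ζ).im := by
    intro ζ
    have h := Complex.norm_le_abs_re_add_abs_im ζ
    rcases le_total |ζ.re| |ζ.im| with h1 | h1
    · rcases le_total 0 ζ.im with h2 | h2
      · rw [abs_of_nonneg h2] at h h1
        exact ⟨2, by simp [v]; linarith⟩
      · rw [abs_of_nonpos h2] at h h1
        exact ⟨0, by simp [v]; linarith⟩
    · rcases le_total 0 ζ.re with h2 | h2
      · rw [abs_of_nonneg h2] at h h1
        exact ⟨3, by simp [v]; linarith⟩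
      · rw [abs_of_nonpos h2] at h h1
        exact ⟨1, by simp [v]; linarith⟩
  -- Each perturbation then has size 2ε = δ/2 < δ, so all 4^s perturbed parameters remain
  -- admissible.
  set ε : ℝ := δ / 4 with hε
  let T : (Fin s → Fin 4) → Fin s → ℂ := fun u k => t k + ε * (2 * v (u k))
  have hT : ∀ u, T u ∈ B.admissibleParams y := by
    intro u
    refine hδ' ?_
    rw [Metric.mem_ball, dist_pi_lt_iff hδ]
    intro k
    rw [dist_eq_norm]
    simp only [T, add_sub_cancel_left]
    rw [norm_mul, norm_mul, hv, Complex.norm_real, Real.norm_eq_abs, abs_of_pos (by positivity)]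
    norm_num
    linarith
  refine ⟨ε, by positivity, fun N => ?_⟩
  choose C hC0 hC using fun (u : Fin s → Fin 4) (a : B.ι) =>
    exists_exp_effPotential_le hy (hT u) a N
  refine ⟨∑ u, ∑ a, C u a, Finset.sum_nonneg fun u _ => Finset.sum_nonneg fun a _ => hC0 u a,
    fun x a => ?_⟩
  choose u hu using fun k => hv' (graphPoint y x k)
  have hle : (G.effPotential (B.gaugeWeight a) t (graphPoint y x)).im +
      ε * ∑ k, ‖graphPoint y x k‖ ≤
      (G.effPotential (B.gaugeWeight a) (T u) (graphPoint y x)).im := by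
    simp only [AbelianGLSM.effPotential_im]
    have h1 : ∑ k, T u k * graphPoint y x k =
        ∑ k, t k * graphPoint y x k + (ε : ℂ) * ∑ k, 2 * v (u k) * graphPoint y x k := by
      rw [Finset.mul_sum, ← Finset.sum_add_distrib]
      exact Finset.sum_congr rfl fun k _ => by simp only [T]; ring
    have h2 : ∑ k, ‖graphPoint y x k‖ ≤ -(∑ k, 2 * v (u k) * graphPoint y x k).im := by
      rw [Complex.im_sum, ← Finset.sum_neg_distrib]
      exact Finset.sum_le_sum fun k _ => hu k
    rw [h1, Complex.add_im, Complex.im_ofReal_mul]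
    have h3 := mul_le_mul_of_nonneg_left h2 (by positivity : 0 ≤ ε)
    linarith
  calc _ ≤ (1 + ‖x‖) ^ N *
        Real.exp (G.effPotential (B.gaugeWeight a) (T u) (graphPoint y x)).im := by
        rw [← Real.exp_add]; gcongr
    _ ≤ C u a := hC u a x
    _ ≤ ∑ a, C u a := Finset.single_le_sum (f := fun a => C u a) (fun a _ => hC0 u a)
        (Finset.mem_univ a)
    _ ≤ _ := Finset.single_le_sum (f := fun u => ∑ a, C u a)
        (fun u _ => Finset.sum_nonneg fun a _ => hC0 u a) (Finset.mem_univ u)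

end Growth

end

noncomputable section

/-! ### Gamma bounds along maps of polynomial growth -/

section GammaGrowth

variable {E : Type*} [NormedAddCommGroup E] {ζ : E → ℂ}

theorem exists_exp_stirlingExp_add_le (hζ : PolyBounded fun x => ‖ζ x‖) (M : ℕ) :
    ∃ D : E → ℝ, PolyBounded D ∧ (∀ x, 0 ≤ D x) ∧ ∀ x (u : ℝ), |u| ≤ M →
      Real.exp (stirlingExp (ζ x + u)) ≤ D x * Real.exp (stirlingExp (ζ x)) := by
  obtain ⟨C, hC, N, h⟩ := exp_stirlingExp_add_le M
  exact ⟨fun x => C * (1 + ‖ζ x‖) ^ N,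
    (PolyBounded.const C).mul (((PolyBounded.const 1).add hζ).pow N),
    fun x => by positivity, fun x u hu => h _ u hu⟩

theorem exists_exp_neg_stirlingExp_add_le (hζ : PolyBounded fun x => ‖ζ x‖) (M : ℕ) :
    ∃ D : E → ℝ, PolyBounded D ∧ (∀ x, 0 ≤ D x) ∧ ∀ x (u : ℝ), |u| ≤ M →
      Real.exp (-stirlingExp (ζ x + u)) ≤ D x * Real.exp (-stirlingExp (ζ x)) := by
  obtain ⟨C, hC, N, h⟩ := exp_stirlingExp_add_le M
  refine ⟨fun x => C * (1 + (‖ζ x‖ + M)) ^ N, (PolyBounded.const C).mul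
    (((PolyBounded.const 1).add (hζ.add (PolyBounded.const _))).pow N),
    fun x => by positivity, fun x u hu => ?_⟩
  have h1 := h (ζ x + u) (-u) (by rwa [abs_neg])
  rw [Complex.ofReal_neg, add_neg_cancel_right] at h1
  have h2 : ‖ζ x + u‖ ≤ ‖ζ x‖ + M := by
    refine (norm_add_le _ _).trans ?_
    rw [Complex.norm_real, Real.norm_eq_abs]
    linarith
  have h3 : Real.exp (stirlingExp (ζ x)) ≤
      C * (1 + (‖ζ x‖ + M)) ^ N * Real.exp (stirlingExp (ζ x + u)) :=
    h1.trans (by gcongr)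
  rw [Real.exp_neg, Real.exp_neg, ← div_eq_mul_inv, inv_eq_one_div,
    div_le_div_iff₀ (Real.exp_pos _) (Real.exp_pos _), one_mul]
  exact h3

theorem exists_norm_Gamma_add_le (hζ : PolyBounded fun x => ‖ζ x‖) (M : ℕ) {c : ℝ} (hc : 0 < c)
    (N : ℕ) : ∃ D : E → ℝ, PolyBounded D ∧ (∀ x, 0 ≤ D x) ∧ ∀ x (u : ℝ), |u| ≤ M →
      (∀ k : ℕ, c ≤ (1 + ‖x‖) ^ N * ‖ζ x + u + k‖) →
      ‖Complex.Gamma (ζ x + u)‖ ≤ D x * Real.exp (stirlingExp (ζ x)) := by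
  obtain ⟨C, hC, N', h⟩ := exists_norm_Gamma_le
  obtain ⟨D, hD, hD0, hD'⟩ := exists_exp_stirlingExp_add_le hζ M
  refine ⟨fun x => C * (1 + c⁻¹ * (1 + ‖x‖) ^ N) ^ N' * D x, ?_, fun x => ?_, fun x u hu hx => ?_⟩
  · exact ((PolyBounded.const C).mul (((PolyBounded.const 1).add ((PolyBounded.const _).mul
      (((PolyBounded.const 1).add PolyBounded.norm_id).pow N))).pow N')).mul hD
  · have := hD0 x
    positivity
  · have hp : 0 < (1 + ‖x‖) ^ N := by positivity
    have hq : 0 ≤ c⁻¹ * (1 + ‖x‖) ^ N := by positivity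
    -- This radius is at most 1 and at most the guaranteed distance c(1 + ‖x‖)^{-N} from the poles,
    -- as the Stirling bound requires; its inverse is polynomially bounded.
    have h1 := h (ζ x + u) (1 + c⁻¹ * (1 + ‖x‖) ^ N)⁻¹ (by positivity)
      (inv_le_one_of_one_le₀ (by linarith)) (fun k => ?_)
    · rw [inv_inv] at h1
      refine h1.trans ?_
      rw [mul_assoc _ (D x)]
      gcongr
      exact hD' x u hu
    · have h2 := hx k
      rw [mul_comm, ← div_le_iff₀ hp] at h2
      refine le_trans ?_ h2
      rw [inv_le_comm₀ (by positivity) (by positivity), inv_div, div_eq_inv_mul]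
      linarith

theorem exists_norm_inv_Gamma_add_le (hζ : PolyBounded fun x => ‖ζ x‖) (M : ℕ) :
    ∃ D : E → ℝ, PolyBounded D ∧ (∀ x, 0 ≤ D x) ∧ ∀ x (u : ℝ), |u| ≤ M →
      ‖(Complex.Gamma (ζ x + u))⁻¹‖ ≤ D x * Real.exp (-stirlingExp (ζ x)) := by
  obtain ⟨C, hC, h⟩ := exists_norm_inv_Gamma_le
  obtain ⟨D, hD, hD0, hD'⟩ := exists_exp_neg_stirlingExp_add_le hζ M
  refine ⟨fun x => C * (1 + (‖ζ x‖ + M)) * D x, ?_, fun x => ?_, fun x u hu => ?_⟩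
  · exact ((PolyBounded.const C).mul ((PolyBounded.const 1).add
      (hζ.add (PolyBounded.const _)))).mul hD
  · have := hD0 x
    positivity
  · refine (h _).trans ?_
    have h2 : ‖ζ x + u‖ ≤ ‖ζ x‖ + M := by
      refine (norm_add_le _ _).trans ?_
      rw [Complex.norm_real, Real.norm_eq_abs]
      linarith
    rw [mul_assoc _ (D x)]
    gcongr
    exact hD' x u hu

end GammaGrowth

/-! ### The majorant of the hemisphere integrand, and absolute convergence -/

section Integrand

variable {s : ℕ} {G : AbelianGLSM s} {y : (Fin s → ℝ) → (Fin s → ℝ)} {B : Brane G}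

/-- The R-charge is a bounded real shift and costs a polynomial; the distance from the poles comes
from avoidance of ℝ_{≤0} at the points -k. -/
theorem exists_norm_Gamma_gammaArg_le (hy : G.IsContour y) (j : G.Matter) :
    ∃ D : (Fin s → ℝ) → ℝ, PolyBounded D ∧ (∀ x, 0 ≤ D x) ∧ ∀ x,
      ‖Complex.Gamma (G.gammaArg j (graphPoint y x))‖ ≤
        D x * Real.exp (stirlingExp (Complex.I * pairing (G.charge j) (graphPoint y x))) := by
  obtain ⟨c, hc, N, h⟩ := hy.avoids j
  have hζ : PolyBounded fun x => ‖Complex.I * pairing (G.charge j) (graphPoint y x)‖ := by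
    simpa using hy.polyBounded_pairing (G.charge j)
  obtain ⟨M, hM⟩ := exists_nat_ge |G.rCharge j / 2|
  obtain ⟨D, hD, hD0, hD'⟩ := exists_norm_Gamma_add_le hζ M hc N
  refine ⟨D, hD, hD0, fun x => ?_⟩
  have e : G.gammaArg j (graphPoint y x) = Complex.I * pairing (G.charge j) (graphPoint y x) +
      ((G.rCharge j / 2 : ℝ) : ℂ) := by
    rw [AbelianGLSM.gammaArg]; push_cast; rfl
  rw [e]
  refine hD' x _ hM fun k => ?_
  have := h x (-k) (by simp)
  rw [e] at this
  simpa using this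

theorem exists_norm_gammaProduct_le (hy : G.IsContour y) :
    ∃ D : (Fin s → ℝ) → ℝ, PolyBounded D ∧ (∀ x, 0 ≤ D x) ∧ ∀ x,
      ‖G.gammaProduct (graphPoint y x)‖ ≤ D x *
        Real.exp (∑ j, stirlingExp (Complex.I * pairing (G.charge j) (graphPoint y x))) := by
  choose D hD hD0 hD' using exists_norm_Gamma_gammaArg_le hy
  refine ⟨fun x => ∏ j, D j x, PolyBounded.prod fun j _ => hD j,
    fun x => Finset.prod_nonneg fun j _ => hD0 j x, fun x => ?_⟩
  rw [AbelianGLSM.gammaProduct, norm_prod, Real.exp_sum, ← Finset.prod_mul_distrib]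
  exact Finset.prod_le_prod (fun _ _ => norm_nonneg _) fun j _ => hD' j x

theorem Brane.factor_eq (B : Brane G) (σ : Fin s → ℂ) :
    B.factor σ = ∑ a, Complex.exp (Complex.I * Real.pi * (B.rWeight a : ℂ)) *
      Complex.exp (2 * Real.pi * pairing (B.gaugeWeight a) σ) := by
  rw [Brane.factor, Brane.rMatrix, Brane.gaugeMatrix, Matrix.diagonal_mul_diagonal,
    Matrix.trace_diagonal]

theorem norm_exp_two_pi_mul (ζ : ℂ) :
    ‖Complex.exp (2 * Real.pi * ζ)‖ = Real.exp (2 * Real.pi * ζ.re) := by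
  rw [Complex.norm_exp]
  congr 1
  rw [show (2 * Real.pi * ζ : ℂ) = ((2 * Real.pi : ℝ) : ℂ) * ζ by push_cast; ring,
    Complex.re_ofReal_mul]

theorem Brane.norm_factor_le (B : Brane G) (σ : Fin s → ℂ) :
    ‖B.factor σ‖ ≤ ∑ a, Real.exp (2 * Real.pi * (pairing (B.gaugeWeight a) σ).re) := by
  rw [B.factor_eq]
  refine (norm_sum_le _ _).trans (Finset.sum_le_sum fun a _ => ?_)
  have h1 : ‖Complex.exp (Complex.I * Real.pi * (B.rWeight a : ℂ))‖ = 1 := by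
    rw [show Complex.I * Real.pi * (B.rWeight a : ℂ) =
      ((Real.pi * (B.rWeight a : ℝ) : ℝ) : ℂ) * Complex.I by push_cast; ring,
      Complex.norm_exp_ofReal_mul_I]
  rw [norm_mul, h1, one_mul, norm_exp_two_pi_mul]

/-- The sum over the weights `q` of `exp (Im W_{eff,q})`. -/
def Brane.majorant (B : Brane G) (y : (Fin s → ℝ) → (Fin s → ℝ)) (t : Fin s → ℂ)
    (x : Fin s → ℝ) : ℝ :=
  ∑ a, Real.exp (G.effPotential (B.gaugeWeight a) t (graphPoint y x)).im

theorem Brane.majorant_eq (B : Brane G) (t : Fin s → ℂ) (x : Fin s → ℝ) :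
    B.majorant y t x =
      Real.exp (∑ j, stirlingExp (Complex.I * pairing (G.charge j) (graphPoint y x))) *
      (∑ a, Real.exp (2 * Real.pi * (pairing (B.gaugeWeight a) (graphPoint y x)).re)) *
      ‖Complex.exp (Complex.I * ∑ k, t k * graphPoint y x k)‖ := by
  rw [Brane.majorant, Finset.mul_sum, Finset.sum_mul]
  refine Finset.sum_congr rfl fun a _ => ?_
  rw [Complex.norm_exp, ← Real.exp_add, ← Real.exp_add, AbelianGLSM.effPotential_im,
    Complex.I_mul_re]
  congr 1; ring

theorem Brane.majorant_nonneg (B : Brane G) (t : Fin s → ℂ) (x : Fin s → ℝ) :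
    0 ≤ B.majorant y t x := Finset.sum_nonneg fun _ _ => (Real.exp_pos _).le

theorem exists_norm_integrand_le (hy : G.IsContour y) (B : Brane G) :
    ∃ D : (Fin s → ℝ) → ℝ, PolyBounded D ∧ (∀ x, 0 ≤ D x) ∧ ∀ t x,
      ‖B.integrand y t x‖ ≤ D x * B.majorant y t x := by
  obtain ⟨D, hD, hD0, hD'⟩ := exists_norm_gammaProduct_le hy
  obtain ⟨C, N, hl⟩ := hy.lipschitz
  obtain ⟨D2, hD2, hD2'⟩ := exists_norm_graphJacobian_le (s := s) C N
  refine ⟨fun x => D x * D2 x, hD.mul hD2, fun x => mul_nonneg (hD0 x)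
    ((norm_nonneg _).trans (hD2' y hl x)), fun t x => ?_⟩
  rw [Brane.integrand, norm_mul, norm_mul, norm_mul, B.majorant_eq]
  have h1 := hD' x
  have h2 := B.norm_factor_le (graphPoint y x)
  have h3 := hD2' y hl x
  have h0 := hD0 x
  calc _ ≤ (D x * Real.exp (∑ j, stirlingExp
          (Complex.I * pairing (G.charge j) (graphPoint y x)))) *
        (∑ a, Real.exp (2 * Real.pi * (pairing (B.gaugeWeight a) (graphPoint y x)).re)) *
        ‖Complex.exp (Complex.I * ∑ k, t k * graphPoint y x k)‖ * D2 x := by gcongr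
    _ = _ := by ring

/-- Rapid decay of a function, against a small exponential in `∑_k ‖σ_k‖`. -/
theorem exists_majorant_mul_exp_le (hy : G.IsContour y) {t : Fin s → ℂ}
    (ht : t ∈ interior (B.admissibleParams y)) : ∃ ε : ℝ, 0 < ε ∧ ∀ N : ℕ, ∃ C : ℝ, 0 ≤ C ∧ ∀ x,
    (1 + ‖x‖) ^ N * (B.majorant y t x * Real.exp (ε * ∑ k, ‖graphPoint y x k‖)) ≤ C := by
  obtain ⟨ε, hε, h⟩ := exists_exp_effPotential_mul_exp_le hy ht
  refine ⟨ε, hε, fun N => ?_⟩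
  obtain ⟨C, hC, hC'⟩ := h N
  refine ⟨∑ _a : B.ι, C, Finset.sum_nonneg fun _ _ => hC, fun x => ?_⟩
  rw [Brane.majorant, Finset.sum_mul, Finset.mul_sum]
  exact Finset.sum_le_sum fun a _ => hC' x a

/-- The power s + 1 exceeds the dimension. -/
theorem integrable_of_rapid_decay {f : (Fin s → ℝ) → ℝ} (hf : AEStronglyMeasurable f volume)
    (h : ∀ N : ℕ, ∃ C : ℝ, ∀ x, (1 + ‖x‖) ^ N * |f x| ≤ C) : Integrable f := by
  obtain ⟨C, hC⟩ := h (s + 1)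
  have h1 : Integrable fun x : Fin s → ℝ => C * (1 + ‖x‖) ^ (-((s + 1 : ℕ) : ℝ)) :=
    (integrable_one_add_norm (by simp)).const_mul C
  refine h1.mono' hf (Eventually.of_forall fun x => ?_)
  have hp : 0 < (1 + ‖x‖) ^ (s + 1) := by positivity
  rw [Real.rpow_neg (by positivity), Real.rpow_natCast, ← div_eq_mul_inv, le_div_iff₀ hp,
    mul_comm]
  exact hC x

/-- Anything bounded by a polynomial multiple of the majorant is integrable, also after
multiplication by a small exponential. -/
theorem exists_integrable_mul_exp (hy : G.IsContour y) {t : Fin s → ℂ}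
    (ht : t ∈ interior (B.admissibleParams y)) : ∃ ε : ℝ, 0 < ε ∧
    ∀ (D : (Fin s → ℝ) → ℝ) (f : (Fin s → ℝ) → ℝ), PolyBounded D →
      AEStronglyMeasurable f volume → (∀ x, |f x| ≤ D x * B.majorant y t x) →
      Integrable fun x => f x * Real.exp (ε * ∑ k, ‖graphPoint y x k‖) := by
  obtain ⟨ε, hε, h⟩ := exists_majorant_mul_exp_le hy ht
  refine ⟨ε, hε, fun D f hD hfm hf => integrable_of_rapid_decay ?_ fun N => ?_⟩
  · refine hfm.mul (Continuous.aestronglyMeasurable ?_)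
    have : ∀ k, Continuous fun x => graphPoint y x k := fun k =>
      (continuous_apply k).comp (continuous_graphPoint hy.continuous)
    fun_prop
  · obtain ⟨C1, hC1, M, hM⟩ := hD
    obtain ⟨C2, hC2, h2⟩ := h (N + M)
    refine ⟨C1 * C2, fun x => ?_⟩
    have hm := B.majorant_nonneg (y := y) t x
    rw [abs_mul, Real.abs_exp]
    calc _ ≤ (1 + ‖x‖) ^ N * ((C1 * (1 + ‖x‖) ^ M * B.majorant y t x) *
          Real.exp (ε * ∑ k, ‖graphPoint y x k‖)) := by
          gcongr
          exact (hf x).trans (mul_le_mul_of_nonneg_right ((le_abs_self _).trans (hM x)) hm)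
      _ = C1 * ((1 + ‖x‖) ^ (N + M) * (B.majorant y t x *
          Real.exp (ε * ∑ k, ‖graphPoint y x k‖))) := by rw [pow_add]; ring
      _ ≤ _ := by gcongr; exact h2 x

theorem AbelianGLSM.IsContour.continuous_gammaProduct (hy : G.IsContour y) :
    Continuous fun x => G.gammaProduct (graphPoint y x) := by
  unfold AbelianGLSM.gammaProduct
  refine continuous_finsetProd _ fun j _ => continuous_iff_continuousAt.mpr fun x => ?_
  obtain ⟨c, hc, N, h⟩ := hy.avoids j
  have h1 : Continuous fun x => G.gammaArg j (graphPoint y x) := by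
    unfold AbelianGLSM.gammaArg
    exact (continuous_const.mul (hy.continuous_pairing _)).add continuous_const
  refine ContinuousAt.comp (f := fun x => G.gammaArg j (graphPoint y x))
    (Complex.continuousAt_Gamma _ fun k hk => ?_) h1.continuousAt
  have := h x (-k) (by simp)
  rw [hk] at this
  simp at this
  linarith

theorem AbelianGLSM.IsContour.aestronglyMeasurable_integrand (hy : G.IsContour y) (B : Brane G)
    (t : Fin s → ℂ) : AEStronglyMeasurable (B.integrand y t) volume := by
  unfold Brane.integrand
  have hc := continuous_graphPoint hy.continuous
  have hk : ∀ k, Continuous fun x => graphPoint y x k := fun k => (continuous_apply k).comp hc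
  refine AEStronglyMeasurable.mul (Continuous.aestronglyMeasurable ?_)
    (measurable_scaledJacobian y Complex.I).stronglyMeasurable.aestronglyMeasurable
  refine (hy.continuous_gammaProduct.mul ?_).mul (by fun_prop)
  simp only [Brane.factor_eq]
  refine continuous_finsetSum _ fun a _ => continuous_const.mul (Complex.continuous_exp.comp ?_)
  exact continuous_const.mul (hy.continuous_pairing _)

theorem integrable_integrand (hy : G.IsContour y) {t : Fin s → ℂ}
    (ht : t ∈ interior (B.admissibleParams y)) : Integrable (B.integrand y t) := by
  obtain ⟨D, hD, -, hD'⟩ := exists_norm_integrand_le hy B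
  obtain ⟨ε, hε, h⟩ := exists_integrable_mul_exp hy ht
  have hm := hy.aestronglyMeasurable_integrand B t
  have h1 := h D (fun x => ‖B.integrand y t x‖) hD hm.norm fun x => by
    rw [abs_norm]; exact hD' t x
  refine h1.mono' hm (Eventually.of_forall fun x => ?_)
  refine le_mul_of_one_le_right (norm_nonneg _) (Real.one_le_exp ?_)
  positivity

end Integrand

end

noncomputable section

/-! ### Gamma function identities -/

/-- Written with 1/Γ so as to include positive integers z, where both sides vanish. -/
theorem Gamma_mul_sin {z : ℂ} (hz : ∀ k : ℕ, z ≠ -k) :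
    Complex.Gamma z * Complex.sin (Real.pi * z) = Real.pi * (Complex.Gamma (1 - z))⁻¹ := by
  have hG := Complex.Gamma_ne_zero hz
  have hpi : (Real.pi : ℂ) ≠ 0 := by exact_mod_cast Real.pi_ne_zero
  have h := Complex.Gamma_mul_Gamma_one_sub z
  by_cases h1 : Complex.Gamma (1 - z) = 0
  · obtain ⟨m, hm⟩ := (Complex.Gamma_eq_zero_iff _).mp h1
    have hz' : z = (m + 1 : ℕ) := by push_cast; linear_combination -hm
    rw [h1, inv_zero, mul_zero, hz', mul_comm (Real.pi : ℂ), Complex.sin_nat_mul_pi, mul_zero]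
  · have hs : Complex.sin (Real.pi * z) ≠ 0 := by
      intro h0
      rw [h0, div_zero] at h
      exact mul_ne_zero hG h1 h
    rw [eq_div_iff hs] at h
    rw [eq_mul_inv_iff_mul_eq₀ h1]
    linear_combination h

theorem Gamma_half_sub_mul_cos {z : ℂ} (hz : ∀ k : ℕ, 1 / 2 - z ≠ -k) :
    Complex.Gamma (1 / 2 - z) * Complex.cos (Real.pi * z) =
      Real.pi * (Complex.Gamma (1 / 2 + z))⁻¹ := by
  have h := Gamma_mul_sin hz
  rw [show (Real.pi : ℂ) * (1 / 2 - z) = Real.pi / 2 - Real.pi * z by ring,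
    Complex.sin_pi_div_two_sub, show (1 : ℂ) - (1 / 2 - z) = 1 / 2 + z by ring] at h
  exact h

theorem Gamma_two_mul {z : ℂ} : Complex.Gamma (2 * z) * (2 * Real.sqrt Real.pi) =
    Complex.Gamma z * Complex.Gamma (z + 1 / 2) * Complex.exp (2 * Real.log 2 * z) := by
  have h := Complex.Gamma_mul_Gamma_add_half z
  have h2 : (2 : ℂ) ^ (1 - 2 * z) * Complex.exp (2 * Real.log 2 * z) = 2 := by
    rw [Complex.cpow_def_of_ne_zero two_ne_zero, ← Complex.exp_add,
      show Complex.log 2 = (Real.log 2 : ℝ) by rw [Complex.ofReal_log (by norm_num)]; norm_num]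
    rw [show ((Real.log 2 : ℝ) : ℂ) * (1 - 2 * z) + 2 * (Real.log 2 : ℝ) * z = (Real.log 2 : ℝ) by
      ring, ← Complex.ofReal_exp, Real.exp_log (by norm_num)]
    norm_num
  rw [h]
  linear_combination -(Complex.Gamma (2 * z) * (Real.sqrt Real.pi : ℂ)) * h2

/-- The brane factor of a ray in J contains both trigonometric factors: the cosine cancels the poles
of Γ(1/2 - z), the sine those of Γ(z). -/
theorem one_sub_exp_four_pi (z : ℂ) : 1 - Complex.exp (-(4 * Real.pi * Complex.I * z)) =
    4 * Complex.I * Complex.exp (-(2 * Real.pi * Complex.I * z)) *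
      (Complex.sin (Real.pi * z) * Complex.cos (Real.pi * z)) := by
  have h1 := Complex.sin_two_mul (Real.pi * z)
  have h2 : Complex.sin (2 * (Real.pi * z)) = (Complex.exp (-(2 * Real.pi * Complex.I * z)) -
      Complex.exp (2 * Real.pi * Complex.I * z)) * Complex.I / 2 := by
    rw [Complex.sin]; congr 4 <;> ring
  have h3 : Complex.exp (-(4 * Real.pi * Complex.I * z)) =
      Complex.exp (-(2 * Real.pi * Complex.I * z)) * Complex.exp (-(2 * Real.pi * Complex.I * z)) := by
    rw [← Complex.exp_add]; congr 1; ring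
  have h4 : Complex.exp (-(2 * Real.pi * Complex.I * z)) *
      Complex.exp (2 * Real.pi * Complex.I * z) = 1 := by
    rw [← Complex.exp_add]; simp
  have h5 : Complex.sin (Real.pi * z) * Complex.cos (Real.pi * z) =
      (Complex.exp (-(2 * Real.pi * Complex.I * z)) -
      Complex.exp (2 * Real.pi * Complex.I * z)) * Complex.I / 4 := by
    linear_combination (-1 / 2 : ℂ) * h1 + (1 / 2 : ℂ) * h2
  rw [h5, h3]
  linear_combination -h4 - (Complex.exp (-(2 * Real.pi * Complex.I * z)) ^ 2 - Complex.exp (-(2 * Real.pi * Complex.I * z)) * Complex.exp (2 * Real.pi * Complex.I * z)) * Complex.I_sq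

theorem one_add_exp_two_pi (z : ℂ) : 1 + Complex.exp (-(2 * Real.pi * Complex.I * z)) =
    2 * Complex.exp (-(Real.pi * Complex.I * z)) * Complex.cos (Real.pi * z) := by
  have h3 : Complex.exp (-(2 * Real.pi * Complex.I * z)) =
      Complex.exp (-(Real.pi * Complex.I * z)) * Complex.exp (-(Real.pi * Complex.I * z)) := by
    rw [← Complex.exp_add]; congr 1; ring
  have h4 : Complex.exp (-(Real.pi * Complex.I * z)) * Complex.exp (Real.pi * Complex.I * z) = 1 := by
    rw [← Complex.exp_add]; simp
  have h5 : Complex.cos (Real.pi * z) = (Complex.exp (Real.pi * Complex.I * z) +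
      Complex.exp (-(Real.pi * Complex.I * z))) / 2 := by
    rw [Complex.cos]; congr 3 <;> ring
  rw [h5, h3]
  linear_combination -h4

/-- Differentiation is absorbed into the Gamma argument, here for the reciprocal factors. -/
theorem inv_Gamma_mul_fallProd (u : ℂ) (n : ℕ) :
    (Complex.Gamma (1 + u))⁻¹ * fallProd u n = (Complex.Gamma (1 + u - n))⁻¹ := by
  induction n with
  | zero => simp [fallProd]
  | succ n ih =>
    rw [fallProd_succ, ← mul_assoc, ih,
      Complex.one_div_Gamma_eq_self_mul_one_div_Gamma_add_one (1 + u - (n + 1 : ℕ))]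
    push_cast
    rw [show 1 + u - ((n : ℂ) + 1) + 1 = 1 + u - n by ring]
    ring

theorem Gamma_mul_fallProd_neg {z : ℂ} (hz : ∀ k : ℕ, z ≠ -k) (n : ℕ) :
    Complex.Gamma z * fallProd (-z) n = (-1) ^ n * Complex.Gamma (z + n) := by
  rw [Gamma_add_nat hz, fallProd]
  have : ∏ j ∈ Finset.range n, (-z - (j : ℂ)) = (-1) ^ n * ∏ j ∈ Finset.range n, (z + j) := by
    rw [← Finset.card_range n, ← Finset.prod_const, Finset.card_range, ← Finset.prod_mul_distrib]
    exact Finset.prod_congr rfl fun j _ => by ring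
  rw [this]; ring

/-- The factor of the integrand attached to a ray in `J`. -/
def regFactorIn (n : ℕ) (z : ℂ) : ℂ :=
  2 * Complex.I * Real.sqrt Real.pi * Real.pi * Complex.exp (2 * Real.log 2 * z) *
    Complex.exp (-(2 * Real.pi * Complex.I * z)) * (Complex.Gamma (1 - z - n))⁻¹

/-- The factor of the integrand attached to a ray which is not in `J`. -/
def regFactorOut (n : ℕ) (z : ℂ) : ℂ :=
  Real.sqrt Real.pi * Complex.exp (2 * Real.log 2 * z) *
    Complex.exp (-(Real.pi * Complex.I * z)) * ((-1) ^ n * Complex.Gamma (z + n))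

/-- The factor of the integrand attached to a part of the nef-partition. -/
def regFactorPart (n : ℕ) (z : ℂ) : ℂ :=
  2 * Real.pi * Complex.exp (-(Real.pi * Complex.I * z)) * (Complex.Gamma (1 / 2 + z - n))⁻¹

theorem Gamma_add_half_ne_zero {z : ℂ} (h1 : ∀ k : ℕ, 2 * z ≠ -k) :
    Complex.Gamma (z + 1 / 2) ≠ 0 := by
  refine Complex.Gamma_ne_zero fun k hk => h1 (2 * k + 1) ?_
  push_cast; linear_combination 2 * hk

theorem ne_neg_nat_of_two_mul {z : ℂ} (h1 : ∀ k : ℕ, 2 * z ≠ -k) (k : ℕ) : z ≠ -k := by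
  intro hk
  refine h1 (2 * k) ?_
  push_cast; linear_combination 2 * hk

/-- Duplication splits Γ(2z) into Γ(z)Γ(z + 1/2), reflection turns Γ(1/2 - z) cos(πz) into π/Γ(z +
1/2), and the half-shifted Gammas cancel. -/
theorem Gamma_two_mul_mul_cos {z : ℂ} (h1 : ∀ k : ℕ, 2 * z ≠ -k)
    (h2 : ∀ k : ℕ, 1 / 2 - z ≠ -k) :
    2 * (Complex.Gamma (2 * z) * Complex.Gamma (1 / 2 - z) * Complex.cos (Real.pi * z)) =
      Real.sqrt Real.pi * Complex.exp (2 * Real.log 2 * z) * Complex.Gamma z := by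
  have hG := Gamma_add_half_ne_zero h1
  have a := Gamma_two_mul (z := z)
  have b := Gamma_half_sub_mul_cos h2
  have hsp : (Real.sqrt Real.pi : ℂ) ≠ 0 := by
    exact_mod_cast (Real.sqrt_pos.mpr Real.pi_pos).ne'
  have hsq : (Real.sqrt Real.pi : ℂ) * Real.sqrt Real.pi = Real.pi := by
    exact_mod_cast Real.mul_self_sqrt Real.pi_pos.le
  rw [show (1 : ℂ) / 2 + z = z + 1 / 2 by ring] at b
  have c : (Complex.Gamma (z + 1 / 2))⁻¹ * Complex.Gamma (z + 1 / 2) = 1 := inv_mul_cancel₀ hG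
  apply mul_right_cancel₀ hsp
  calc _ = (Complex.Gamma (2 * z) * (2 * Real.sqrt Real.pi)) *
        (Complex.Gamma (1 / 2 - z) * Complex.cos (Real.pi * z)) := by ring
    _ = Complex.Gamma z * Complex.exp (2 * Real.log 2 * z) * Real.pi *
        ((Complex.Gamma (z + 1 / 2))⁻¹ * Complex.Gamma (z + 1 / 2)) := by rw [a, b]; ring
    _ = _ := by rw [c, ← hsq]; ring

theorem regFactorIn_eq {z : ℂ} (h1 : ∀ k : ℕ, 2 * z ≠ -k)
    (h2 : ∀ k : ℕ, 1 / 2 - z ≠ -k) (n : ℕ) :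
    Complex.Gamma (2 * z) * Complex.Gamma (1 / 2 - z) *
      (1 - Complex.exp (-(4 * Real.pi * Complex.I * z))) * fallProd (-z) n = regFactorIn n z := by
  have a := Gamma_two_mul_mul_cos h1 h2
  have b := Gamma_mul_sin (ne_neg_nat_of_two_mul h1)
  have c := inv_Gamma_mul_fallProd (-z) n
  rw [← sub_eq_add_neg] at c
  rw [regFactorIn, ← c, one_sub_exp_four_pi]
  calc _ = 2 * Complex.I * Complex.exp (-(2 * Real.pi * Complex.I * z)) * fallProd (-z) n *
        (2 * (Complex.Gamma (2 * z) * Complex.Gamma (1 / 2 - z) * Complex.cos (Real.pi * z))) *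
        Complex.sin (Real.pi * z) := by ring
    _ = 2 * Complex.I * Complex.exp (-(2 * Real.pi * Complex.I * z)) * fallProd (-z) n *
        (Real.sqrt Real.pi * Complex.exp (2 * Real.log 2 * z)) *
        (Complex.Gamma z * Complex.sin (Real.pi * z)) := by rw [a]; ring
    _ = _ := by rw [b]; ring

/-- The brane factor supplies only a cosine here, so the poles of Γ(z) survive; they are the only
ones that a deformation of the contour has to avoid. -/
theorem regFactorOut_eq {z : ℂ} (h1 : ∀ k : ℕ, 2 * z ≠ -k)
    (h2 : ∀ k : ℕ, 1 / 2 - z ≠ -k) (n : ℕ) :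
    Complex.Gamma (2 * z) * Complex.Gamma (1 / 2 - z) *
      (1 + Complex.exp (-(2 * Real.pi * Complex.I * z))) * fallProd (-z) n = regFactorOut n z := by
  have a := Gamma_two_mul_mul_cos h1 h2
  have b := Gamma_mul_fallProd_neg (ne_neg_nat_of_two_mul h1) n
  rw [regFactorOut, ← b, one_add_exp_two_pi]
  calc _ = Complex.exp (-(Real.pi * Complex.I * z)) * fallProd (-z) n *
        (2 * (Complex.Gamma (2 * z) * Complex.Gamma (1 / 2 - z) *
          Complex.cos (Real.pi * z))) := by ring
    _ = _ := by rw [a]; ring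

theorem regFactorPart_eq {z : ℂ} (h2 : ∀ k : ℕ, 1 / 2 - z ≠ -k) (n : ℕ) :
    Complex.Gamma (1 / 2 - z) * (1 + Complex.exp (-(2 * Real.pi * Complex.I * z))) *
      fallProd (z - 1 / 2) n = regFactorPart n z := by
  have b := Gamma_half_sub_mul_cos h2
  have c := inv_Gamma_mul_fallProd (z - 1 / 2) n
  rw [show 1 + (z - 1 / 2) = 1 / 2 + z by ring] at c
  rw [regFactorPart, ← c, one_add_exp_two_pi]
  calc _ = 2 * Complex.exp (-(Real.pi * Complex.I * z)) * fallProd (z - 1 / 2) n *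
        (Complex.Gamma (1 / 2 - z) * Complex.cos (Real.pi * z)) := by ring
    _ = _ := by rw [b]; ring

theorem differentiable_regFactorIn (n : ℕ) : Differentiable ℂ (regFactorIn n) := by
  have h : Differentiable ℂ fun z : ℂ => (Complex.Gamma (1 - z - n))⁻¹ :=
    Complex.differentiable_one_div_Gamma.comp (by fun_prop)
  unfold regFactorIn
  fun_prop

theorem differentiable_regFactorPart (n : ℕ) : Differentiable ℂ (regFactorPart n) := by
  have h : Differentiable ℂ fun z : ℂ => (Complex.Gamma (1 / 2 + z - n))⁻¹ :=
    Complex.differentiable_one_div_Gamma.comp (by fun_prop)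
  unfold regFactorPart
  fun_prop

theorem differentiableAt_regFactorOut {n : ℕ} {z : ℂ} (hz : z + n ∈ Complex.slitPlane) :
    DifferentiableAt ℂ (regFactorOut n) z := by
  have h : DifferentiableAt ℂ (fun z : ℂ => Complex.Gamma (z + n)) z := by
    refine DifferentiableAt.comp (f := fun z : ℂ => z + n) z
      (Complex.differentiableAt_Gamma _ fun k hk => ?_) (by fun_prop)
    rw [hk] at hz
    simp [Complex.mem_slitPlane_iff] at hz
    linarith [(Nat.cast_nonneg k : (0 : ℝ) ≤ k)]
  unfold regFactorOut
  fun_prop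

/-! ### Behaviour under integral shifts -/

theorem exp_neg_pi_I_mul_int_shift (z : ℂ) (k : ℤ) :
    Complex.exp (-(Real.pi * Complex.I * (z - k))) =
      (-1) ^ k * Complex.exp (-(Real.pi * Complex.I * z)) := by
  rw [show -(Real.pi * Complex.I * (z - k)) = k * (Real.pi * Complex.I) + -(Real.pi * Complex.I * z)
    by ring, Complex.exp_add, Complex.exp_int_mul, Complex.exp_pi_mul_I]

theorem exp_log_two_int_shift (z : ℂ) (k : ℤ) :
    Complex.exp (2 * Real.log 2 * (z - k)) =
      (4 : ℂ) ^ (-k) * Complex.exp (2 * Real.log 2 * z) := by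
  have h4 : Complex.exp (2 * Real.log 2) = 4 := by
    rw [two_mul, Complex.exp_add, ← Complex.ofReal_exp, Real.exp_log (by norm_num)]; norm_num
  rw [show 2 * (Real.log 2 : ℂ) * (z - k) = ((-k : ℤ) : ℂ) * (2 * Real.log 2) +
    2 * Real.log 2 * z by push_cast; ring, Complex.exp_add, Complex.exp_int_mul, h4]

/-- The Gamma argument depends only on the sum of z and n, and e^{-2πiz} has period 1; only 4^z
feels the shift. -/
theorem regFactorIn_shift {n n' : ℕ} {k : ℤ} (h : k = n - n') (z : ℂ) :
    regFactorIn n (z - k) = (4 : ℂ) ^ (-k) * regFactorIn n' z := by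
  have e1 : Complex.exp (-(2 * Real.pi * Complex.I * (z - k))) =
      Complex.exp (-(2 * Real.pi * Complex.I * z)) := by
    rw [show -(2 * Real.pi * Complex.I * (z - k)) = -(2 * Real.pi * Complex.I * z) +
      k * (2 * Real.pi * Complex.I) by ring, Complex.exp_add, Complex.exp_int_mul_two_pi_mul_I,
      mul_one]
  have e2 : 1 - (z - k) - (n : ℂ) = 1 - z - n' := by rw [h]; push_cast; ring
  rw [regFactorIn, regFactorIn, e1, e2, exp_log_two_int_shift]
  ring

theorem neg_one_zpow_mul_pow {n n' : ℕ} {k : ℤ} (h : k = n - n') :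
    (-1 : ℂ) ^ k * (-1) ^ n = (-1) ^ n' := by
  have h2 : (n' : ℤ) = n - k := by rw [h]; ring
  rw [← zpow_natCast, ← zpow_natCast (-1 : ℂ) n', h2, zpow_sub₀ (by norm_num), div_eq_mul_inv,
    ← inv_zpow, mul_comm]
  norm_num

theorem regFactorOut_shift {n n' : ℕ} {k : ℤ} (h : k = n - n') (z : ℂ) :
    regFactorOut n (z - k) = (4 : ℂ) ^ (-k) * regFactorOut n' z := by
  have e2 : z - k + (n : ℂ) = z + n' := by rw [h]; push_cast; ring
  rw [regFactorOut, regFactorOut, e2, exp_log_two_int_shift, exp_neg_pi_I_mul_int_shift,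
    ← neg_one_zpow_mul_pow h]
  ring

theorem regFactorPart_shift {n n' : ℕ} {k : ℤ} (h : k = n - n') (z : ℂ) :
    regFactorPart n (z + k) = (-1 : ℂ) ^ k * regFactorPart n' z := by
  have e2 : 1 / 2 + (z + k) - (n : ℂ) = 1 / 2 + z - n' := by rw [h]; push_cast; ring
  have e3 := exp_neg_pi_I_mul_int_shift z (-k)
  rw [Int.cast_neg, sub_neg_eq_add] at e3
  have e4 : (-1 : ℂ) ^ (-k) = (-1) ^ k := by
    rw [zpow_neg, ← inv_zpow]; norm_num
  rw [regFactorPart, regFactorPart, e2, e3, e4]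
  ring

end

noncomputable section

variable {n p r s : ℕ}

/-! ### Factorization of the integrand and its majorant over 𝓘 -/

theorem pairing_sum {ι : Type*} (S : Finset ι) (w : ι → Fin s → ℤ) (σ : Fin s → ℂ) :
    pairing (∑ c ∈ S, w c) σ = ∑ c ∈ S, pairing (w c) σ := by
  simp only [pairing, Finset.sum_apply, Int.cast_sum, Finset.sum_mul]
  exact Finset.sum_comm

theorem pairing_two_nsmul (w : Fin s → ℤ) (σ : Fin s → ℂ) :
    pairing (2 • w) σ = 2 * pairing w σ := by
  rw [two_nsmul, pairing, pairing, two_mul, ← Finset.sum_add_distrib]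
  refine Finset.sum_congr rfl fun k _ => ?_
  rw [Pi.add_apply]; push_cast; ring

theorem pairing_neg (w : Fin s → ℤ) (σ : Fin s → ℂ) : pairing (-w) σ = -pairing w σ := by
  simp [pairing]

/-- The linear form `i θ_c(σ)`. -/
def weightArg (θ : Idx p r → Fin s → ℤ) (c : Idx p r) (σ : Fin s → ℂ) : ℂ :=
  Complex.I * pairing (θ c) σ

/-- The term contributed by `η̄_c` to the brane factor, as a function of `i θ_c(σ)`. -/
def stepExp (J : Finset (Fin p)) : Idx p r → ℂ → ℂ
  | Sum.inl a => fun z => if a ∈ J then -Complex.exp (-(4 * Real.pi * Complex.I * z))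
      else Complex.exp (-(2 * Real.pi * Complex.I * z))
  | Sum.inr _ => fun z => Complex.exp (-(2 * Real.pi * Complex.I * z))

/-- The product of the Gamma functions attached to the index `c`, as a function of `i θ_c(σ)`. -/
def gammaFactor : Idx p r → ℂ → ℂ
  | Sum.inl _ => fun z => Complex.Gamma (2 * z) * Complex.Gamma (1 / 2 - z)
  | Sum.inr _ => fun z => Complex.Gamma (1 / 2 - z)

/-- The exponent of `x_c` in the integral representation, as a function of `i θ_c(σ)`. -/
def gkzExponent : Idx p r → ℂ → ℂ
  | Sum.inl _ => fun z => -z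
  | Sum.inr _ => fun z => z - 1 / 2

/-- The factor attached to the index `c`, after cancellation of poles against the brane factor. -/
def regFactor (J : Finset (Fin p)) (N : ℕ) : Idx p r → ℂ → ℂ
  | Sum.inl a => if a ∈ J then regFactorIn N else regFactorOut N
  | Sum.inr _ => regFactorPart N

theorem gammaFactor_mul {J : Finset (Fin p)} {c : Idx p r} {z : ℂ}
    (h1 : ∀ a, c = Sum.inl a → ∀ k : ℕ, 2 * z ≠ -k) (h2 : ∀ k : ℕ, 1 / 2 - z ≠ -k) (N : ℕ) :
    gammaFactor c z * (1 + stepExp J c z) * fallProd (gkzExponent c z) N = regFactor J N c z := by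
  rcases c with a | k
  · by_cases ha : a ∈ J
    · simp only [gammaFactor, stepExp, gkzExponent, regFactor, ha, if_true, ← sub_eq_add_neg]
      exact regFactorIn_eq (h1 a rfl) h2 N
    · simp only [gammaFactor, stepExp, gkzExponent, regFactor, ha, if_false]
      exact regFactorOut_eq (h1 a rfl) h2 N
  · exact regFactorPart_eq h2 N

section Model

variable {X : SmoothCompleteFan n p} {P : X.NefPartition r} {b : Module.Basis (Fin s) ℤ X.Cl}
  {f : Fin r → MvPolynomial (Fin p) ℂ} {hf : IsSectionFamily (theta X P b) f}
  {J : Finset (Fin p)} {y : (Fin s → ℝ) → (Fin s → ℝ)}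

theorem gammaArg_inl (a : Fin p) (σ : Fin s → ℂ) :
    (doubleCoverModel X P b f hf).gammaArg (Sum.inl a) σ =
      2 * weightArg (theta X P b) (Sum.inl a) σ := by
  change Complex.I * pairing (2 • theta X P b (Sum.inl a)) σ + ((0 : ℝ) : ℂ) / 2 = _
  rw [pairing_two_nsmul, weightArg]; push_cast; ring

theorem gammaArg_inr (c : Idx p r) (σ : Fin s → ℂ) :
    (doubleCoverModel X P b f hf).gammaArg (Sum.inr c) σ =
      1 / 2 - weightArg (theta X P b) c σ := by
  change Complex.I * pairing (-theta X P b c) σ + ((1 : ℝ) : ℂ) / 2 = _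
  rw [pairing_neg, weightArg]; push_cast; ring

theorem gammaProduct_eq (σ : Fin s → ℂ) : (doubleCoverModel X P b f hf).gammaProduct σ =
    ∏ c, gammaFactor c (weightArg (theta X P b) c σ) := by
  rw [AbelianGLSM.gammaProduct]
  change ∏ j : Fin p ⊕ Idx p r, Complex.Gamma ((doubleCoverModel X P b f hf).gammaArg j σ) = _
  rw [Fintype.prod_sum_type, Fintype.prod_sum_type (f := fun c : Idx p r => _),
    Fintype.prod_sum_type (f := fun c : Idx p r => _), ← mul_assoc, ← Finset.prod_mul_distrib]
  simp only [gammaArg_inl, gammaArg_inr]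
  rfl

theorem stirlingExp_sum_eq (σ : Fin s → ℂ) :
    ∑ j, stirlingExp (Complex.I * pairing ((doubleCoverModel X P b f hf).charge j) σ) =
      ∑ c : Idx p r, ((match c with
        | Sum.inl _ => stirlingExp (2 * weightArg (theta X P b) c σ)
        | Sum.inr _ => 0) + stirlingExp (-weightArg (theta X P b) c σ)) := by
  change ∑ j : Fin p ⊕ Idx p r, stirlingExp (Complex.I * pairing (modelCharge (theta X P b) j) σ) = _
  rw [Fintype.sum_sum_type, Finset.sum_add_distrib]
  congr 1
  · rw [Fintype.sum_sum_type]
    simp only [Finset.sum_const_zero, add_zero, modelCharge, pairing_two_nsmul, weightArg]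
    exact Finset.sum_congr rfl fun a _ => congrArg _ (by ring)
  · refine Finset.sum_congr rfl fun c _ => ?_
    simp only [modelCharge, pairing_neg, weightArg, mul_neg]

/-- A trace over subsets of 𝓘 whose weights add up over the elements is a product. For a ray in J
the R-weight 1 of η̄_c contributes e^{iπ} = -1, which is what produces 1 - e^{-4πiz}. -/
theorem factor_braneJ (σ : Fin s → ℂ) : (braneJ X P b f hf J).factor σ =
    ∏ c, (1 + stepExp J c (weightArg (theta X P b) c σ)) := by
  rw [Brane.factor_eq, Finset.prod_one_add, Finset.powerset_univ]
  change ∑ I : Finset (Idx p r), Complex.exp (Complex.I * Real.pi *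
      ((∑ c ∈ I, stepRWeight J c : ℚ) : ℂ)) *
    Complex.exp (2 * Real.pi * pairing (∑ c ∈ I, stepWeight (theta X P b) J c) σ) = _
  refine Finset.sum_congr rfl fun I _ => ?_
  rw [pairing_sum, Rat.cast_sum, Finset.mul_sum, Finset.mul_sum, Complex.exp_sum, Complex.exp_sum,
    ← Finset.prod_mul_distrib]
  refine Finset.prod_congr rfl fun c _ => ?_
  have h2 : ∀ w : ℂ, 2 * Real.pi * w = -(2 * Real.pi * Complex.I * (Complex.I * w)) := fun w => by
    linear_combination (2 * Real.pi * w) * Complex.I_sq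
  rcases c with a | k
  · by_cases ha : a ∈ J
    · simp only [stepRWeight, stepWeight, stepExp, ha, if_true, pairing_two_nsmul, weightArg]
      rw [Rat.cast_one, mul_one, mul_comm Complex.I (Real.pi : ℂ), Complex.exp_pi_mul_I, neg_one_mul,
        h2]
      congr 2; ring
    · simp only [stepRWeight, stepWeight, stepExp, ha, if_false, weightArg]
      rw [Rat.cast_zero, mul_zero, Complex.exp_zero, one_mul, h2]
  · simp only [stepRWeight, stepWeight, stepExp, weightArg]
    rw [Rat.cast_zero, mul_zero, Complex.exp_zero, one_mul, h2]

theorem sum_exp_gaugeWeight (σ : Fin s → ℂ) :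
    ∑ I, Real.exp (2 * Real.pi * (pairing ((braneJ X P b f hf J).gaugeWeight I) σ).re) =
      ∏ c, (1 + Real.exp (2 * Real.pi * (pairing (stepWeight (theta X P b) J c) σ).re)) := by
  rw [Finset.prod_one_add, Finset.powerset_univ]
  change ∑ I : Finset (Idx p r),
    Real.exp (2 * Real.pi * (pairing (∑ c ∈ I, stepWeight (theta X P b) J c) σ).re) = _
  refine Finset.sum_congr rfl fun I _ => ?_
  rw [pairing_sum, Complex.re_sum, Finset.mul_sum, Real.exp_sum]

/-- The contribution of the index `c` to the majorant. -/
def localMajorant (J : Finset (Fin p)) : Idx p r → ℂ → ℝ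
  | Sum.inl a => fun z => Real.exp (stirlingExp (2 * z) + stirlingExp (-z)) *
      (1 + Real.exp ((if a ∈ J then 4 else 2) * Real.pi * z.im))
  | Sum.inr _ => fun z => Real.exp (stirlingExp (-z)) * (1 + Real.exp (2 * Real.pi * z.im))

theorem localMajorant_nonneg (c : Idx p r) (z : ℂ) : 0 ≤ localMajorant J c z := by
  rcases c with a | k <;> simp only [localMajorant] <;> positivity

/-- The sum over the weights factorizes as the brane factor does, with all signs positive; hence the
regularized factors can be estimated one index at a time. -/
theorem majorant_braneJ_eq (t : Fin s → ℂ) (x : Fin s → ℝ) :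
    (braneJ X P b f hf J).majorant y t x =
      (∏ c, localMajorant J c (weightArg (theta X P b) c (graphPoint y x))) *
      ‖Complex.exp (Complex.I * ∑ k, t k * graphPoint y x k)‖ := by
  rw [Brane.majorant_eq, stirlingExp_sum_eq, sum_exp_gaugeWeight, Real.exp_sum,
    ← Finset.prod_mul_distrib]
  congr 1
  refine Finset.prod_congr rfl fun c _ => ?_
  rcases c with a | k
  · by_cases ha : a ∈ J
    · simp only [stepWeight, ha, if_true, localMajorant, pairing_two_nsmul, weightArg]
      congr 3
      rw [Complex.I_mul_im, Complex.mul_re]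
      simp; ring
    · simp only [stepWeight, ha, if_false, localMajorant, weightArg, Complex.I_mul_im]
  · simp only [stepWeight, localMajorant, weightArg, Complex.I_mul_im, zero_add]

/-- All arguments stay off the poles on the contour, so the cancellation may be carried out factor
by factor, falling factorials included. -/
theorem gammaProduct_mul_factor_eq (hy : (doubleCoverModel X P b f hf).IsContour y)
    (N : Idx p r → ℕ) (x : Fin s → ℝ) :
    (doubleCoverModel X P b f hf).gammaProduct (graphPoint y x) *
      (braneJ X P b f hf J).factor (graphPoint y x) *
      ∏ c, fallProd (gkzExponent c (weightArg (theta X P b) c (graphPoint y x))) (N c) =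
    ∏ c, regFactor J (N c) c (weightArg (theta X P b) c (graphPoint y x)) := by
  have hne : ∀ j (k : ℕ), (doubleCoverModel X P b f hf).gammaArg j (graphPoint y x) ≠ -k := by
    intro j k hk
    obtain ⟨c, hc, M, h⟩ := hy.avoids j
    have := h x (-k) (by simp)
    rw [hk] at this
    simp at this
    linarith
  rw [gammaProduct_eq, factor_braneJ, ← Finset.prod_mul_distrib, ← Finset.prod_mul_distrib]
  refine Finset.prod_congr rfl fun c _ => gammaFactor_mul (fun a ha k => ?_) (fun k => ?_) _
  · subst ha
    rw [← gammaArg_inl (hf := hf)]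
    exact hne _ k
  · rw [← gammaArg_inr (hf := hf)]
    exact hne _ k

end Model

/-! ### Growth of the factors -/

section Growth

/-- With y = Im z: the exponential left after pole cancellation is no larger than the corresponding
term of the majorant. This serves rays outside J and parts; the next inequality serves rays in J. -/
theorem exp_pi_mul_le (y : ℝ) :
    Real.exp (Real.pi * y) ≤ Real.exp (-(Real.pi * |y|)) * (1 + Real.exp (2 * Real.pi * y)) := by
  rw [mul_add, mul_one, ← Real.exp_add]
  rcases le_total 0 y with h | h
  · rw [abs_of_nonneg h, show -(Real.pi * y) + 2 * Real.pi * y = Real.pi * y by ring]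
    linarith [Real.exp_pos (-(Real.pi * y))]
  · rw [abs_of_nonpos h, show -(Real.pi * -y) = Real.pi * y by ring]
    linarith [Real.exp_pos (Real.pi * y + 2 * Real.pi * y)]

theorem exp_two_pi_mul_le (y : ℝ) : Real.exp (2 * Real.pi * y + Real.pi * |y|) ≤
    Real.exp (-(Real.pi * |y|)) * (1 + Real.exp (4 * Real.pi * y)) := by
  rw [mul_add, mul_one, ← Real.exp_add]
  rcases le_total 0 y with h | h
  · rw [abs_of_nonneg h, show -(Real.pi * y) + 4 * Real.pi * y = 2 * Real.pi * y + Real.pi * y by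
      ring]
    linarith [Real.exp_pos (-(Real.pi * y))]
  · rw [abs_of_nonpos h, show -(Real.pi * -y) = 2 * Real.pi * y + Real.pi * -y by ring]
    linarith [Real.exp_pos (2 * Real.pi * y + Real.pi * -y + 4 * Real.pi * y)]

theorem norm_exp_log_two_mul (z : ℂ) :
    ‖Complex.exp (2 * Real.log 2 * z)‖ = Real.exp (2 * Real.log 2 * z.re) := by
  rw [Complex.norm_exp, show (2 * Real.log 2 * z : ℂ) = ((2 * Real.log 2 : ℝ) : ℂ) * z by
    push_cast; ring, Complex.re_ofReal_mul]

theorem norm_exp_neg_pi_mul (a : ℝ) (z : ℂ) :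
    ‖Complex.exp (-(a * Real.pi * Complex.I * z))‖ = Real.exp (a * Real.pi * z.im) := by
  rw [Complex.norm_exp, show (-(a * Real.pi * Complex.I * z) : ℂ) =
    ((a * Real.pi : ℝ) : ℂ) * -(Complex.I * z) by push_cast; ring, Complex.re_ofReal_mul,
    Complex.neg_re, Complex.I_mul_re, neg_neg]

variable {E : Type*} [NormedAddCommGroup E] {ζ : E → ℂ}

theorem exp_log_two_le {M : ℕ} {v : ℝ} (hv : |v| ≤ M) (z : ℂ) :
    ‖Complex.exp (2 * Real.log 2 * (z + v))‖ ≤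
      Real.exp (2 * Real.log 2 * M) * Real.exp (2 * Real.log 2 * z.re) := by
  rw [norm_exp_log_two_mul, ← Real.exp_add, Complex.add_re, Complex.ofReal_re, mul_add, add_comm]
  have := (abs_le.mp hv).2
  have := Real.log_pos one_lt_two
  gcongr

/-- Stirling for 1/Γ, with the Stirling exponents of 2z and -z rewritten through that of z, reduces
the estimate to `exp_two_pi_mul_le`. -/
theorem exists_norm_regFactorIn_le (hζ : PolyBounded fun x => ‖ζ x‖) (N M : ℕ) :
    ∃ D : E → ℝ, PolyBounded D ∧ (∀ x, 0 ≤ D x) ∧ ∀ x (v : ℝ), |v| ≤ M →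
      ‖regFactorIn N (ζ x + v)‖ ≤ D x * (Real.exp (stirlingExp (2 * ζ x) + stirlingExp (-ζ x)) *
        (1 + Real.exp (4 * Real.pi * (ζ x).im))) := by
  obtain ⟨D, hD, hD0, hD'⟩ := exists_norm_inv_Gamma_add_le (ζ := fun x => -ζ x)
    (by simpa using hζ) (1 + M + N)
  set K := ‖(2 * Complex.I * Real.sqrt Real.pi * Real.pi : ℂ)‖
  refine ⟨fun x => K * Real.exp (2 * Real.log 2 * M) * D x, (PolyBounded.const _).mul hD,
    fun x => mul_nonneg (by positivity) (hD0 x), fun x v hv => ?_⟩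
  have h1 := hD' x (1 - v - N) (by
    rw [abs_le] at hv ⊢; push_cast
    have : (0 : ℝ) ≤ N := by positivity
    constructor <;> linarith)
  rw [show -ζ x + ((1 - v - N : ℝ) : ℂ) = 1 - (ζ x + v) - N by push_cast; ring] at h1
  have h2 := exp_log_two_le hv (ζ x)
  have h3 := norm_exp_neg_pi_mul 2 (ζ x + v)
  rw [Complex.add_im, Complex.ofReal_im, add_zero, Complex.ofReal_ofNat] at h3
  have hD := hD0 x
  rw [regFactorIn, norm_mul, norm_mul, norm_mul, h3]
  have h4 := exp_two_pi_mul_le (ζ x).im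
  calc _ ≤ K * (Real.exp (2 * Real.log 2 * M) * Real.exp (2 * Real.log 2 * (ζ x).re)) *
        Real.exp (2 * Real.pi * (ζ x).im) * (D x * Real.exp (-stirlingExp (-ζ x))) := by gcongr
    _ = K * Real.exp (2 * Real.log 2 * M) * D x * (Real.exp (2 * Real.log 2 * (ζ x).re +
        stirlingExp (ζ x)) * Real.exp (2 * Real.pi * (ζ x).im + Real.pi * |(ζ x).im|)) := by
        rw [stirlingExp_neg, show -(-stirlingExp (ζ x) - Real.pi * |(ζ x).im|) =
          stirlingExp (ζ x) + Real.pi * |(ζ x).im| by ring]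
        simp only [Real.exp_add]; ring
    _ ≤ K * Real.exp (2 * Real.log 2 * M) * D x * (Real.exp (2 * Real.log 2 * (ζ x).re +
        stirlingExp (ζ x)) * (Real.exp (-(Real.pi * |(ζ x).im|)) *
          (1 + Real.exp (4 * Real.pi * (ζ x).im)))) := by gcongr
    _ = _ := by
        rw [stirlingExp_neg, stirlingExp_two_mul, show 2 * stirlingExp (ζ x) +
          2 * Real.log 2 * (ζ x).re + (-stirlingExp (ζ x) - Real.pi * |(ζ x).im|) =
          2 * Real.log 2 * (ζ x).re + stirlingExp (ζ x) + -(Real.pi * |(ζ x).im|) by ring]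
        simp only [Real.exp_add]; ring

theorem exists_norm_regFactorOut_le (hζ : PolyBounded fun x => ‖ζ x‖) (N M : ℕ) {c : ℝ}
    (hc : 0 < c) (N' : ℕ) (h : ∀ x, ∀ u : ℝ, u ≤ 0 → c ≤ (1 + ‖x‖) ^ N' * ‖2 * ζ x - u‖) :
    ∃ D : E → ℝ, PolyBounded D ∧ (∀ x, 0 ≤ D x) ∧ ∀ x (v : ℝ), |v| ≤ M → 0 ≤ v + N →
      ‖regFactorOut N (ζ x + v)‖ ≤ D x * (Real.exp (stirlingExp (2 * ζ x) + stirlingExp (-ζ x)) *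
        (1 + Real.exp (2 * Real.pi * (ζ x).im))) := by
  obtain ⟨D, hD, hD0, hD'⟩ := exists_norm_Gamma_add_le hζ (M + N) (half_pos hc) N'
  set K := ‖(Real.sqrt Real.pi : ℂ)‖
  refine ⟨fun x => K * Real.exp (2 * Real.log 2 * M) * D x, (PolyBounded.const _).mul hD,
    fun x => mul_nonneg (by positivity) (hD0 x), fun x v hv hvN => ?_⟩
  have h1 := hD' x (v + N) (by
    rw [abs_le] at hv ⊢; push_cast
    have : (0 : ℝ) ≤ N := by positivity
    constructor <;> linarith) (fun k => by
      -- The shift v is an arbitrary real number, so the shifted poles need not be integers;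
      -- avoidance of the whole ray ℝ_{≤0} is used, through v + N ≥ 0.
      have := h x (-(2 * (v + N + k))) (by
        have : (0 : ℝ) ≤ k := by positivity
        linarith)
      rw [show 2 * ζ x - ((-(2 * (v + N + k)) : ℝ) : ℂ) = 2 * (ζ x + ((v + N : ℝ) : ℂ) + k) by
        push_cast; ring, norm_mul, Complex.norm_ofNat] at this
      linarith)
  rw [show ζ x + ((v + N : ℝ) : ℂ) = ζ x + v + N by push_cast; ring] at h1
  have h2 := exp_log_two_le hv (ζ x)
  have h3 := norm_exp_neg_pi_mul 1 (ζ x + v)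
  rw [Complex.add_im, Complex.ofReal_im, add_zero, Complex.ofReal_one, one_mul, one_mul] at h3
  have hD := hD0 x
  have h5 : ‖((-1 : ℂ) ^ N)‖ = 1 := by simp
  rw [regFactorOut, norm_mul, norm_mul, norm_mul, norm_mul, h3, h5, one_mul]
  have h4 := exp_pi_mul_le (ζ x).im
  calc _ ≤ K * (Real.exp (2 * Real.log 2 * M) * Real.exp (2 * Real.log 2 * (ζ x).re)) *
        Real.exp (Real.pi * (ζ x).im) * (D x * Real.exp (stirlingExp (ζ x))) := by gcongr
    _ ≤ K * (Real.exp (2 * Real.log 2 * M) * Real.exp (2 * Real.log 2 * (ζ x).re)) *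
        (Real.exp (-(Real.pi * |(ζ x).im|)) * (1 + Real.exp (2 * Real.pi * (ζ x).im))) *
        (D x * Real.exp (stirlingExp (ζ x))) := by gcongr
    _ = _ := by
        rw [stirlingExp_neg, stirlingExp_two_mul, show 2 * stirlingExp (ζ x) +
          2 * Real.log 2 * (ζ x).re + (-stirlingExp (ζ x) - Real.pi * |(ζ x).im|) =
          2 * Real.log 2 * (ζ x).re + stirlingExp (ζ x) + -(Real.pi * |(ζ x).im|) by ring]
        simp only [Real.exp_add]; ring

theorem exists_norm_regFactorPart_le (hζ : PolyBounded fun x => ‖ζ x‖) (N M : ℕ) :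
    ∃ D : E → ℝ, PolyBounded D ∧ (∀ x, 0 ≤ D x) ∧ ∀ x (v : ℝ), |v| ≤ M →
      ‖regFactorPart N (ζ x + v)‖ ≤ D x * (Real.exp (stirlingExp (-ζ x)) *
        (1 + Real.exp (2 * Real.pi * (ζ x).im))) := by
  obtain ⟨D, hD, hD0, hD'⟩ := exists_norm_inv_Gamma_add_le hζ (1 + M + N)
  set K := ‖(2 * Real.pi : ℂ)‖
  refine ⟨fun x => K * D x, (PolyBounded.const _).mul hD,
    fun x => mul_nonneg (by positivity) (hD0 x), fun x v hv => ?_⟩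
  have h1 := hD' x (1 / 2 + v - N) (by
    rw [abs_le] at hv ⊢; push_cast
    have : (0 : ℝ) ≤ N := by positivity
    constructor <;> linarith)
  rw [show ζ x + ((1 / 2 + v - N : ℝ) : ℂ) = 1 / 2 + (ζ x + v) - N by push_cast; ring] at h1
  have h3 := norm_exp_neg_pi_mul 1 (ζ x + v)
  rw [Complex.add_im, Complex.ofReal_im, add_zero, Complex.ofReal_one, one_mul, one_mul] at h3
  have hD := hD0 x
  rw [regFactorPart, norm_mul, norm_mul, h3]
  have h4 := exp_pi_mul_le (ζ x).im
  calc _ ≤ K * Real.exp (Real.pi * (ζ x).im) * (D x * Real.exp (-stirlingExp (ζ x))) := by gcongr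
    _ ≤ K * (Real.exp (-(Real.pi * |(ζ x).im|)) * (1 + Real.exp (2 * Real.pi * (ζ x).im))) *
        (D x * Real.exp (-stirlingExp (ζ x))) := by gcongr
    _ = _ := by
        rw [stirlingExp_neg, sub_eq_add_neg]
        simp only [Real.exp_add]; ring

end Growth

end

noncomputable section

variable {n p r s : ℕ}

/-! ### The lattice of relations -/

/-- The exact sequence `0 → Hom(Cl(X), ℤ) → ℤ^𝓘 → ℤ^{r+n}`. -/
theorem exists_dotProduct_theta_eq {X : SmoothCompleteFan n p} {P : X.NefPartition r}
    (b : Module.Basis (Fin s) ℤ X.Cl) {k : Idx p r → ℤ} (hk : (gkzMatrix X P).mulVec k = 0) :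
    ∃ m : Fin s → ℤ, (∀ a, theta X P b (Sum.inl a) ⬝ᵥ m = k (Sum.inl a)) ∧
      ∀ i, theta X P b (Sum.inr i) ⬝ᵥ m = -k (Sum.inr i) := by
  -- The ray part of k is a functional on torus-invariant divisors. The last n rows of A say that it
  -- kills principal divisors, hence it descends to Cl(X); m lists its values on the basis. The
  -- first r rows then give the values at the parts.
  let φ₀ : (Fin p → ℤ) →ₗ[ℤ] ℤ :=
    ∑ a, k (Sum.inl a) • LinearMap.proj (R := ℤ) (φ := fun _ : Fin p => ℤ) a
  have hφ₀ : ∀ D, φ₀ D = ∑ a, k (Sum.inl a) * D a := fun D => by simp [φ₀]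
  have h0 : LinearMap.range X.principal ≤ LinearMap.ker φ₀ := by
    rintro _ ⟨v, rfl⟩
    rw [LinearMap.mem_ker, hφ₀]
    have h1 : ∀ l, ∑ a, X.ρ a l * k (Sum.inl a) = 0 := fun l => by
      have := congrFun hk (Sum.inr l)
      simpa [Matrix.mulVec, dotProduct, gkzMatrix, Fintype.sum_sum_type] using this
    have h2 : ∀ a, X.principal v a = ∑ l, X.ρ a l * v l := fun a => rfl
    simp only [h2, Finset.mul_sum]
    rw [Finset.sum_comm]
    refine Finset.sum_eq_zero fun l _ => ?_
    calc _ = (∑ a, X.ρ a l * k (Sum.inl a)) * v l := by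
          rw [Finset.sum_mul]; exact Finset.sum_congr rfl fun a _ => by ring
      _ = 0 := by rw [h1, zero_mul]
  let φ : X.Cl →ₗ[ℤ] ℤ := (LinearMap.range X.principal).liftQ φ₀ h0
  have h1 : ∀ a, theta X P b (Sum.inl a) ⬝ᵥ (fun j => φ (b j)) = k (Sum.inl a) := by
    intro a
    have h2 : φ (X.divClass (Pi.single a 1)) = k (Sum.inl a) := by
      change φ₀ (Pi.single a 1) = _
      rw [hφ₀, Finset.sum_eq_single a] <;> simp +contextual
    rw [← h2]
    conv_rhs => rw [← b.sum_repr (X.divClass (Pi.single a 1)), map_sum]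
    simp [dotProduct, theta]
  refine ⟨fun j => φ (b j), h1, fun i => ?_⟩
  have h2 := congrFun hk (Sum.inl i)
  have h3 : ∑ a with P.part a = i, k (Sum.inl a) + k (Sum.inr i) = 0 := by
    simpa [Matrix.mulVec, dotProduct, gkzMatrix, Fintype.sum_sum_type, Finset.sum_filter] using h2
  have h4 : theta X P b (Sum.inr i) = ∑ a with P.part a = i, theta X P b (Sum.inl a) := rfl
  rw [h4, sum_dotProduct, Finset.sum_congr rfl fun a _ => h1 a]
  linarith

/-- Add the first r rows: each column has exactly one entry 1 there. This kills the total sign in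
the shift relation. -/
theorem sum_eq_zero_of_gkzMatrix_mulVec_eq_zero {X : SmoothCompleteFan n p}
    {P : X.NefPartition r} {k : Idx p r → ℤ} (hk : (gkzMatrix X P).mulVec k = 0) :
    ∑ c, k c = 0 := by
  have h3 : ∀ i, ∑ a with P.part a = i, k (Sum.inl a) + k (Sum.inr i) = 0 := fun i => by
    have h2 := congrFun hk (Sum.inl i)
    simpa [Matrix.mulVec, dotProduct, gkzMatrix, Fintype.sum_sum_type, Finset.sum_filter] using h2
  rw [Fintype.sum_sum_type, ← Finset.sum_fiberwise Finset.univ P.part (fun a => k (Sum.inl a)),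
    ← Finset.sum_add_distrib]
  exact Finset.sum_eq_zero fun i _ => h3 i

/-- The exponents of the integral representation satisfy the Euler relations. -/
theorem sum_gkzMatrix_mul_gkzExponent (X : SmoothCompleteFan n p) (P : X.NefPartition r)
    (b : Module.Basis (Fin s) ℤ X.Cl) (σ : Fin s → ℂ) (l : Fin r ⊕ Fin n) :
    ∑ c, (gkzMatrix X P l c : ℂ) * gkzExponent c (weightArg (theta X P b) c σ) =
      gkzBeta r n l := by
  rw [Fintype.sum_sum_type]
  rcases l with i | l
  · have h4 : theta X P b (Sum.inr i) = ∑ a with P.part a = i, theta X P b (Sum.inl a) := rfl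
    simp only [gkzMatrix, gkzExponent, gkzBeta, weightArg, Int.cast_ite, Int.cast_one,
      Int.cast_zero, ite_mul, one_mul, zero_mul]
    rw [Finset.sum_ite_eq' Finset.univ i, if_pos (Finset.mem_univ i), h4, pairing_sum,
      Finset.sum_filter, Finset.mul_sum, Finset.sum_congr rfl fun a _ => mul_ite _ _ _ _]
    have : ∑ a, (if P.part a = i then -(Complex.I * pairing (theta X P b (Sum.inl a)) σ) else 0) =
        -∑ a, (if P.part a = i then Complex.I * pairing (theta X P b (Sum.inl a)) σ
          else Complex.I * 0) := by
      rw [← Finset.sum_neg_distrib]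
      exact Finset.sum_congr rfl fun a _ => by split_ifs <;> simp
    rw [this]; ring
  · simp only [gkzMatrix, gkzExponent, gkzBeta, weightArg, Int.cast_zero, zero_mul,
      Finset.sum_const_zero, add_zero, pairing]
    have h1 : ∀ k, ∑ a, X.ρ a l * theta X P b (Sum.inl a) k = 0 := by
      intro k
      -- The divisor with coefficients ρ_{a,l} is that of the l-th coordinate character.
      have h2 : X.divClass (fun a => X.ρ a l) = 0 := by
        refine (Submodule.Quotient.mk_eq_zero _).mpr ⟨Pi.single l 1, ?_⟩
        ext a
        simp [SmoothCompleteFan.principal, Matrix.mulVec, dotProduct, Pi.single_apply]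
      have h3 : (fun a => X.ρ a l) = ∑ a, X.ρ a l • (Pi.single a 1 : Fin p → ℤ) := by
        ext a; simp [Finset.sum_apply, Pi.single_apply]
      rw [h3, map_sum] at h2
      have h5 := congrArg (fun v => b.repr v k) h2
      simpa only [theta, map_sum, map_smul, Finsupp.finsetSum_apply, Finsupp.smul_apply, smul_eq_mul,
        map_zero, Finsupp.zero_apply] using h5
    calc _ = -(Complex.I * ∑ k, ((∑ a, X.ρ a l * theta X P b (Sum.inl a) k : ℤ) : ℂ) * σ k) := by
          push_cast
          simp only [Finset.mul_sum, Finset.sum_mul, ← Finset.sum_neg_distrib]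
          rw [Finset.sum_comm]
          exact Finset.sum_congr rfl fun k _ => Finset.sum_congr rfl fun a _ => by ring
      _ = 0 := by simp [h1]

/-! ### The regularized integrand -/

/-- The integrand obtained by applying `∂^N`, up to the factor `∏ x_c^{-N_c}`, after cancellation of
poles. -/
def regIntegrand (θ : Idx p r → Fin s → ℤ) (J : Finset (Fin p)) (N : Idx p r → ℕ)
    (t σ : Fin s → ℂ) : ℂ :=
  (∏ c, regFactor J (N c) c (weightArg θ c σ)) * Complex.exp (Complex.I * ∑ k, t k * σ k)

/-- A domain on which `regIntegrand` is holomorphic. -/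
def regDomain (θ : Idx p r → Fin s → ℤ) (J : Finset (Fin p)) (N : Idx p r → ℕ) :
    Set (Fin s → ℂ) :=
  {σ | ∀ a, a ∉ J → weightArg θ (Sum.inl a) σ + N (Sum.inl a) ∈ Complex.slitPlane}

variable {θ : Idx p r → Fin s → ℤ} {J : Finset (Fin p)}

theorem differentiable_weightArg (c : Idx p r) : Differentiable ℂ (weightArg θ c) := by
  unfold weightArg pairing; fun_prop

theorem isOpen_regDomain (N : Idx p r → ℕ) : IsOpen (regDomain θ J N) := by
  simp only [regDomain, Set.ofPred_forall]
  exact isOpen_iInter_of_finite fun a => isOpen_iInter_of_finite fun _ =>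
    Complex.isOpen_slitPlane.preimage
      ((differentiable_weightArg (Sum.inl a)).continuous.add continuous_const)

theorem differentiableOn_regIntegrand (N : Idx p r → ℕ) (t : Fin s → ℂ) :
    DifferentiableOn ℂ (regIntegrand θ J N t) (regDomain θ J N) := by
  intro σ hσ
  refine DifferentiableAt.differentiableWithinAt ?_
  have h : ∀ c, DifferentiableAt ℂ (fun σ => regFactor J (N c) c (weightArg θ c σ)) σ := ?_
  · unfold regIntegrand
    exact (HasFDerivAt.finsetProd fun c _ => (h c).hasFDerivAt).differentiableAt.mul (by fun_prop)
  intro c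
  refine DifferentiableAt.comp (g := regFactor J (N c) c) σ ?_ (differentiable_weightArg c σ)
  rcases c with a | k
  · by_cases ha : a ∈ J
    · simp only [regFactor, ha, if_true]
      exact differentiable_regFactorIn _ _
    · simp only [regFactor, ha, if_false]
      exact differentiableAt_regFactorOut (hσ a ha)
  · exact differentiable_regFactorPart _ _

theorem weightArg_shift (c : Idx p r) (σ : Fin s → ℂ) (m : Fin s → ℤ) (κ : ℝ) :
    weightArg θ c (fun k => σ k + Complex.I * (κ * m k : ℝ)) =
      weightArg θ c σ + ((-(κ * (θ c ⬝ᵥ m : ℤ)) : ℝ) : ℂ) := by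
  simp only [weightArg, pairing, dotProduct]
  push_cast
  rw [← mul_neg_one, show (-1 : ℂ) = Complex.I * Complex.I by simp]
  simp only [Finset.mul_sum, Finset.sum_mul, ← Finset.sum_add_distrib]
  exact Finset.sum_congr rfl fun k _ => by ring

theorem prod_zpow_eq_zpow_sum {ι : Type*} (S : Finset ι) {A : ℂ} (hA : A ≠ 0) (e : ι → ℤ) :
    ∏ k ∈ S, A ^ e k = A ^ ∑ k ∈ S, e k := by
  classical
  induction S using Finset.induction_on with
  | empty => simp
  | insert i S hi ih => rw [Finset.prod_insert hi, Finset.sum_insert hi, zpow_add₀ hA, ih]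

theorem prod_qVariable_zpow {x : Idx p r → ℂ} (hx : ∀ c, x c ≠ 0) (m : Fin s → ℤ) :
    ∏ k, qVariable θ x k ^ m k = (∏ a, (-4 * x (Sum.inl a)) ^ (θ (Sum.inl a) ⬝ᵥ m)) *
      ∏ i, x (Sum.inr i) ^ (-(θ (Sum.inr i) ⬝ᵥ m)) := by
  simp only [qVariable, mul_zpow _ _ (m _), ← Finset.prod_zpow, ← zpow_mul,
    Finset.prod_mul_distrib (s := (Finset.univ : Finset (Fin s)))]
  rw [Finset.prod_comm, Finset.prod_comm (s := (Finset.univ : Finset (Fin s)))]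
  congr 1
  · refine Finset.prod_congr rfl fun a _ => ?_
    rw [prod_zpow_eq_zpow_sum _ (mul_ne_zero (by norm_num) (hx _)), dotProduct]
  · refine Finset.prod_congr rfl fun i _ => ?_
    rw [prod_zpow_eq_zpow_sum _ (hx _), dotProduct, ← Finset.sum_neg_distrib]
    congr 1
    exact Finset.sum_congr rfl fun k _ => by ring

/-- Translation by im sends z_c to z_c - θ_c·m, which replaces N by N' inside the Gamma factors,
while e^{it(σ)} acquires ∏ q_k^{m_k}, a monomial in the x_c and in -4. -/
theorem regIntegrand_shift {N N' : Idx p r → ℕ} {m : Fin s → ℤ}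
    (h1 : ∀ a, θ (Sum.inl a) ⬝ᵥ m = N (Sum.inl a) - N' (Sum.inl a))
    (h2 : ∀ i, θ (Sum.inr i) ⬝ᵥ m = -((N (Sum.inr i) : ℤ) - N' (Sum.inr i)))
    (h3 : ∑ c, ((N c : ℤ) - N' c) = 0) {x : Idx p r → ℂ} (hx : ∀ c, x c ≠ 0) {t : Fin s → ℂ}
    (ht : ∀ k, Complex.exp (-t k) = qVariable θ x k) (σ : Fin s → ℂ) :
    regIntegrand θ J N t (fun k => σ k + Complex.I * (m k : ℝ)) =
      (∏ c, x c ^ ((N c : ℤ) - N' c)) * regIntegrand θ J N' t σ := by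
  have hw : ∀ c, weightArg θ c (fun k => σ k + Complex.I * (m k : ℝ)) =
      weightArg θ c σ - (θ c ⬝ᵥ m : ℤ) := fun c => by
    have := weightArg_shift (θ := θ) c σ m 1
    simp only [one_mul] at this
    rw [this]; push_cast; ring
  have he : Complex.exp (Complex.I * ∑ k, t k * (σ k + Complex.I * (m k : ℝ))) =
      (∏ k, qVariable θ x k ^ m k) * Complex.exp (Complex.I * ∑ k, t k * σ k) := by
    have h5 : ∀ k, qVariable θ x k ^ m k = Complex.exp (m k * -t k) := fun k => by
      rw [← ht, Complex.exp_int_mul]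
    simp only [h5]
    rw [← Complex.exp_sum, ← Complex.exp_add]
    congr 1
    rw [Finset.mul_sum, Finset.mul_sum, ← Finset.sum_add_distrib]
    refine Finset.sum_congr rfl fun k _ => ?_
    push_cast
    linear_combination (t k * m k) * Complex.I_sq
  have hsign : ∏ c : Idx p r, (-1 : ℂ) ^ ((N c : ℤ) - N' c) = 1 := by
    rw [prod_zpow_eq_zpow_sum _ (by norm_num), h3, zpow_zero]
  have hin : ∀ a, regFactor (r := r) J (N (Sum.inl a)) (Sum.inl a)
      (weightArg θ (Sum.inl a) σ - (θ (Sum.inl a) ⬝ᵥ m : ℤ)) =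
      (4 : ℂ) ^ (-((N (Sum.inl a) : ℤ) - N' (Sum.inl a))) *
        regFactor (r := r) J (N' (Sum.inl a)) (Sum.inl a) (weightArg θ (Sum.inl a) σ) := by
    intro a
    rw [h1]
    by_cases ha : a ∈ J
    · simp only [regFactor, ha, if_true]
      exact regFactorIn_shift rfl _
    · simp only [regFactor, ha, if_false]
      exact regFactorOut_shift rfl _
  have hpart : ∀ i, regFactor (r := r) J (N (Sum.inr i)) (Sum.inr i)
      (weightArg θ (Sum.inr i) σ - (θ (Sum.inr i) ⬝ᵥ m : ℤ)) =
      (-1 : ℂ) ^ ((N (Sum.inr i) : ℤ) - N' (Sum.inr i)) *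
        regFactor J (N' (Sum.inr i)) (Sum.inr i) (weightArg θ (Sum.inr i) σ) := by
    intro i
    rw [h2, Int.cast_neg, sub_neg_eq_add]
    exact regFactorPart_shift rfl _
  rw [regIntegrand, he, prod_qVariable_zpow hx, regIntegrand]
  simp only [hw]
  rw [← one_mul (∏ c : Idx p r, x c ^ ((N c : ℤ) - N' c)), ← hsign]
  simp only [Fintype.prod_sum_type, hin, hpart]
  simp only [h1, h2, neg_neg, Finset.prod_mul_distrib, mul_zpow]
  -- The 4^{-k} from duplication meet the (-4)^k from q. The surviving signs combine with those of
  -- the parts into the trivial total sign, which was inserted on the right-hand side.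
  have h4 : (∏ a : Fin p, (4 : ℂ) ^ (-((N (Sum.inl a) : ℤ) - N' (Sum.inl a)))) *
      (∏ a : Fin p, (-4 : ℂ) ^ ((N (Sum.inl a) : ℤ) - N' (Sum.inl a))) =
      ∏ a : Fin p, (-1 : ℂ) ^ ((N (Sum.inl a) : ℤ) - N' (Sum.inl a)) := by
    rw [← Finset.prod_mul_distrib]
    refine Finset.prod_congr rfl fun a _ => ?_
    rw [show (-4 : ℂ) = 4 * -1 by norm_num, mul_zpow, ← mul_assoc, ← zpow_add₀ (by norm_num),
      neg_add_cancel, zpow_zero, one_mul]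
  rw [← h4]
  ring

/-! ### Bounds for the regularized integrand, uniform along a translation -/

section Bound

variable {X : SmoothCompleteFan n p} {P : X.NefPartition r} {b : Module.Basis (Fin s) ℤ X.Cl}
  {f : Fin r → MvPolynomial (Fin p) ℂ} {hf : IsSectionFamily (theta X P b) f}
  {y : (Fin s → ℝ) → (Fin s → ℝ)}

theorem AbelianGLSM.IsContour.polyBounded_weightArg {G : AbelianGLSM s} (hy : G.IsContour y)
    (c : Idx p r) : PolyBounded fun x => ‖weightArg θ c (graphPoint y x)‖ := by
  simpa [weightArg] using hy.polyBounded_pairing (θ c)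

theorem exists_norm_regFactor_le (hy : (doubleCoverModel X P b f hf).IsContour y)
    (N M : ℕ) (c : Idx p r) :
    ∃ D : (Fin s → ℝ) → ℝ, PolyBounded D ∧ (∀ x, 0 ≤ D x) ∧ ∀ x (v : ℝ), |v| ≤ M →
      (∀ a, a ∉ J → c = Sum.inl a → 0 ≤ v + N) →
      ‖regFactor J N c (weightArg (theta X P b) c (graphPoint y x) + v)‖ ≤
        D x * localMajorant J c (weightArg (theta X P b) c (graphPoint y x)) := by
  have hζ := hy.polyBounded_weightArg (θ := theta X P b) c
  rcases c with a | k
  · by_cases ha : a ∈ J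
    · simp only [regFactor, localMajorant, ha, if_true]
      obtain ⟨D, hD, hD0, h⟩ := exists_norm_regFactorIn_le hζ N M
      exact ⟨D, hD, hD0, fun x v hv _ => h x v hv⟩
    · simp only [regFactor, localMajorant, ha, if_false]
      obtain ⟨c, hc, N', hN'⟩ := hy.avoids (Sum.inl a)
      simp only [gammaArg_inl] at hN'
      obtain ⟨D, hD, hD0, h⟩ := exists_norm_regFactorOut_le hζ N M hc N' hN'
      exact ⟨D, hD, hD0, fun x v hv hv' => h x v hv (hv' a ha rfl)⟩
  · obtain ⟨D, hD, hD0, h⟩ := exists_norm_regFactorPart_le hζ N M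
    exact ⟨D, hD, hD0, fun x v hv _ => h x v hv⟩

/-- Moving by iκm shifts each z_c by a bounded real number and changes the modulus of e^{it(σ)} by a
bounded factor, so the majorant on the original contour controls the whole family. -/
theorem exists_norm_regIntegrand_le (hy : (doubleCoverModel X P b f hf).IsContour y)
    (N : Idx p r → ℕ) (t : Fin s → ℂ) (m : Fin s → ℤ)
    (hm : ∀ a, a ∉ J → ∀ κ ∈ Set.Icc (0 : ℝ) 1,
      0 ≤ -(κ * (theta X P b (Sum.inl a) ⬝ᵥ m : ℤ)) + N (Sum.inl a)) :
    ∃ D : (Fin s → ℝ) → ℝ, PolyBounded D ∧ (∀ x, 0 ≤ D x) ∧ ∀ x, ∀ κ ∈ Set.Icc (0 : ℝ) 1,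
      ‖regIntegrand (theta X P b) J N t
        (fun k => graphPoint y x k + Complex.I * (κ * m k : ℝ))‖ ≤
        D x * (braneJ X P b f hf J).majorant y t x := by
  choose M hM using fun c : Idx p r => exists_nat_ge |((theta X P b c ⬝ᵥ m : ℤ) : ℝ)|
  choose D hD hD0 hD' using fun c : Idx p r =>
    exists_norm_regFactor_le (J := J) hy (N c) (M c) c
  refine ⟨fun x => (∏ c, D c x) * Real.exp |(∑ k, t k * m k).re|,
    (PolyBounded.prod fun c _ => hD c).mul (PolyBounded.const _),
    fun x => mul_nonneg (Finset.prod_nonneg fun c _ => hD0 c x) (Real.exp_pos _).le,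
    fun x κ hκ => ?_⟩
  have h1 : ‖Complex.exp (Complex.I * ∑ k, t k * (graphPoint y x k +
      Complex.I * (κ * m k : ℝ)))‖ ≤ Real.exp |(∑ k, t k * m k).re| *
      ‖Complex.exp (Complex.I * ∑ k, t k * graphPoint y x k)‖ := by
    have e : Complex.I * ∑ k, t k * (graphPoint y x k + Complex.I * (κ * m k : ℝ)) =
        -((κ : ℂ) * ∑ k, t k * m k) + Complex.I * ∑ k, t k * graphPoint y x k := by
      rw [Finset.mul_sum, Finset.mul_sum, Finset.mul_sum, ← Finset.sum_neg_distrib,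
        ← Finset.sum_add_distrib]
      refine Finset.sum_congr rfl fun k _ => ?_
      push_cast
      linear_combination (t k * κ * m k) * Complex.I_sq
    rw [e, Complex.exp_add, norm_mul, Complex.norm_exp, Complex.neg_re, Complex.re_ofReal_mul]
    gcongr
    refine (neg_le_abs _).trans ?_
    rw [abs_mul, abs_of_nonneg hκ.1]
    exact mul_le_of_le_one_left (abs_nonneg _) hκ.2
  have h2 : ∏ c, ‖regFactor J (N c) c (weightArg (theta X P b) c
      (fun k => graphPoint y x k + Complex.I * (κ * m k : ℝ)))‖ ≤
      ∏ c, (D c x * localMajorant J c (weightArg (theta X P b) c (graphPoint y x))) := by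
    refine Finset.prod_le_prod (fun _ _ => norm_nonneg _) fun c _ => ?_
    rw [weightArg_shift]
    refine hD' c x _ ?_ fun a ha hc => ?_
    · rw [abs_neg, abs_mul, abs_of_nonneg hκ.1]
      exact (mul_le_of_le_one_left (abs_nonneg _) hκ.2).trans (hM c)
    · subst hc
      exact hm a ha κ hκ
  rw [regIntegrand, norm_mul, norm_prod, majorant_braneJ_eq]
  have h3 : 0 ≤ ∏ c, (D c x * localMajorant J c (weightArg (theta X P b) c (graphPoint y x))) :=
    Finset.prod_nonneg fun c _ => mul_nonneg (hD0 c x) (localMajorant_nonneg _ _)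
  refine (mul_le_mul h2 h1 (norm_nonneg _) h3).trans (le_of_eq ?_)
  rw [Finset.prod_mul_distrib]
  ring

end Bound

end

noncomputable section

variable {n p r s : ℕ} {J : Finset (Fin p)}
  {X : SmoothCompleteFan n p} {P : X.NefPartition r} {b : Module.Basis (Fin s) ℤ X.Cl}
  {f : Fin r → MvPolynomial (Fin p) ℂ} {hf : IsSectionFamily (theta X P b) f}
  {y : (Fin s → ℝ) → (Fin s → ℝ)}

/-! ### Translation of the contour by a lattice vector -/

theorem weightArg_graphPoint_re (θ : Idx p r → Fin s → ℤ) (c : Idx p r)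
    (y : (Fin s → ℝ) → (Fin s → ℝ)) (x : Fin s → ℝ) :
    (weightArg θ c (graphPoint y x)).re = -∑ k, (θ c k : ℝ) * y x k := by
  rw [weightArg, Complex.I_mul_re, pairing, Complex.im_sum]
  simp [graphPoint]

theorem weightArg_graphPoint_im (θ : Idx p r → Fin s → ℤ) (c : Idx p r)
    (y : (Fin s → ℝ) → (Fin s → ℝ)) (x : Fin s → ℝ) :
    (weightArg θ c (graphPoint y x)).im = ∑ k, (θ c k : ℝ) * x k := by
  rw [weightArg, Complex.I_mul_im, pairing, Complex.re_sum]
  simp [graphPoint]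

/-- On the hyperplane θ_a·x = 0 the value z_a is real, equal to -θ_a·y; as the contour avoids
ℝ_{≤0}, it must be positive. -/
theorem weightArg_re_pos (hy : (doubleCoverModel X P b f hf).IsContour y) (a : Fin p)
    {x : Fin s → ℝ} (hx : ∑ k, (theta X P b (Sum.inl a) k : ℝ) * x k = 0) :
    ∑ k, (theta X P b (Sum.inl a) k : ℝ) * y x k < 0 := by
  obtain ⟨c, hc, N, h⟩ := hy.avoids (Sum.inl a)
  by_contra! hcon
  have := h x (-(2 * ∑ k, (theta X P b (Sum.inl a) k : ℝ) * y x k)) (by linarith)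
  have h0 : weightArg (theta X P b) (Sum.inl a) (graphPoint y x) =
      ((-∑ k, (theta X P b (Sum.inl a) k : ℝ) * y x k : ℝ) : ℂ) := by
    apply Complex.ext
    · rw [weightArg_graphPoint_re, Complex.ofReal_re]
    · rw [weightArg_graphPoint_im, hx, Complex.ofReal_im]
  rw [gammaArg_inl, h0] at this
  push_cast at this
  rw [show ∀ w : ℂ, 2 * -w - -(2 * w) = 0 by intro w; ring] at this
  simp at this
  linarith

/-- The imaginary part θ_a·x of z_a is the same at every stage, so only θ_a·x = 0 matters. There the
real part is a convex combination of the positive values for y(0) and y(x), plus a nonnegative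
shift. Since 0 lies on every such hyperplane, the height y(0) serves as common flat contour. -/
theorem graphPoint_mem_regDomain (hy : (doubleCoverModel X P b f hf).IsContour y)
    {N : Idx p r → ℕ} {m : Fin s → ℤ}
    (hm : ∀ a, a ∉ J → ∀ κ ∈ Set.Icc (0 : ℝ) 1,
      0 ≤ -(κ * (theta X P b (Sum.inl a) ⬝ᵥ m : ℤ)) + N (Sum.inl a))
    {l : ℝ} (hl : l ∈ Set.Icc (0 : ℝ) 1) {κ : (Fin s → ℝ) → ℝ} {x : Fin s → ℝ}
    (hκ : κ x ∈ Set.Icc (0 : ℝ) 1) :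
    graphPoint (fun x => y 0 + l • ((y x + κ x • fun k => (m k : ℝ)) - y 0)) x ∈
      regDomain (theta X P b) J N := by
  intro a ha
  rw [Complex.mem_slitPlane_iff, Complex.add_re, Complex.add_im, Complex.natCast_re,
    Complex.natCast_im, weightArg_graphPoint_re, weightArg_graphPoint_im, add_zero]
  by_cases hx : ∑ k, (theta X P b (Sum.inl a) k : ℝ) * x k = 0
  · left
    have h1 := weightArg_re_pos hy a hx
    have h2 := weightArg_re_pos hy a (x := 0) (by simp)
    have h3 := hm a ha (l * κ x) ⟨mul_nonneg hl.1 hκ.1, mul_le_one₀ hl.2 hκ.1 hκ.2⟩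
    have e : ∑ k, (theta X P b (Sum.inl a) k : ℝ) *
        (y 0 + l • ((y x + κ x • fun k => (m k : ℝ)) - y 0)) k =
        (1 - l) * ∑ k, (theta X P b (Sum.inl a) k : ℝ) * y 0 k +
        l * ∑ k, (theta X P b (Sum.inl a) k : ℝ) * y x k +
        l * κ x * (theta X P b (Sum.inl a) ⬝ᵥ m : ℤ) := by
      simp only [dotProduct, Int.cast_sum, Int.cast_mul, Finset.mul_sum, ← Finset.sum_add_distrib]
      refine Finset.sum_congr rfl fun k _ => ?_
      simp only [Pi.add_apply, Pi.sub_apply, Pi.smul_apply, smul_eq_mul]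
      ring
    rw [e]
    obtain ⟨hl0, hl1⟩ := hl
    rcases hl0.eq_or_lt with h | h
    · rw [← h] at h3 ⊢
      linarith
    · have h4 := mul_neg_of_pos_of_neg h h1
      have h5 := mul_nonneg (sub_nonneg.mpr hl1) (neg_nonneg.mpr h2.le)
      linarith
  · exact Or.inr hx

theorem graphPoint_add_smul (y : (Fin s → ℝ) → (Fin s → ℝ)) (κ : (Fin s → ℝ) → ℝ) (m : Fin s → ℤ)
    (x : Fin s → ℝ) : graphPoint (fun x => y x + κ x • fun k => (m k : ℝ)) x =
      fun k => graphPoint y x k + Complex.I * (κ x * m k : ℝ) := by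
  ext k
  simp only [graphPoint, Pi.add_apply, Pi.smul_apply, smul_eq_mul]
  push_cast; ring

theorem graphJacobian_add_const (y : (Fin s → ℝ) → (Fin s → ℝ)) (v : Fin s → ℝ) (x : Fin s → ℝ) :
    graphJacobian (fun x => y x + v) x = graphJacobian y x := by
  unfold graphJacobian
  rw [fderiv_add_const]

theorem aestronglyMeasurable_regIntegrand {θ : Idx p r → Fin s → ℤ} {N : Idx p r → ℕ}
    {t : Fin s → ℂ} {w : (Fin s → ℝ) → (Fin s → ℝ)} (hw : Continuous w)
    (hmem : ∀ x, graphPoint w x ∈ regDomain θ J N) :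
    AEStronglyMeasurable (fun x => regIntegrand θ J N t (graphPoint w x) * graphJacobian w x)
      volume := by
  refine AEStronglyMeasurable.mul (Continuous.aestronglyMeasurable ?_)
    (measurable_scaledJacobian w Complex.I).stronglyMeasurable.aestronglyMeasurable
  exact (differentiableOn_regIntegrand N t).continuousOn.comp_continuous
    (continuous_graphPoint hw) hmem

theorem exists_integrable_bound {G : AbelianGLSM s} {B : Brane G} (hy : G.IsContour y)
    {t : Fin s → ℂ} (ht : t ∈ interior (B.admissibleParams y)) {D : (Fin s → ℝ) → ℝ}
    (hD : PolyBounded D) :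
    ∃ g : (Fin s → ℝ) → ℝ, Integrable g ∧ ∀ x, D x * B.majorant y t x ≤ g x := by
  obtain ⟨ε, hε, h⟩ := exists_majorant_mul_exp_le hy ht
  obtain ⟨C₁, hC₁, M, hM⟩ := hD
  obtain ⟨C₂, hC₂, h₂⟩ := h (M + (s + 1))
  refine ⟨fun x => C₁ * C₂ * (1 + ‖x‖) ^ (-((s + 1 : ℕ) : ℝ)),
    (integrable_one_add_norm (by simp)).const_mul _, fun x => ?_⟩
  have hp : 0 < (1 + ‖x‖) ^ (s + 1) := by positivity
  have hm := B.majorant_nonneg (y := y) t x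
  beta_reduce
  rw [Real.rpow_neg (by positivity), Real.rpow_natCast, ← div_eq_mul_inv, le_div_iff₀ hp]
  have h3 : 1 ≤ Real.exp (ε * ∑ k, ‖graphPoint y x k‖) := Real.one_le_exp (by positivity)
  calc _ ≤ C₁ * (1 + ‖x‖) ^ M * B.majorant y t x * (1 + ‖x‖) ^ (s + 1) := by
        gcongr
        exact (le_abs_self _).trans (hM x)
    _ = C₁ * ((1 + ‖x‖) ^ (M + (s + 1)) * (B.majorant y t x * 1)) := by rw [pow_add]; ring
    _ ≤ C₁ * ((1 + ‖x‖) ^ (M + (s + 1)) * (B.majorant y t x *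
        Real.exp (ε * ∑ k, ‖graphPoint y x k‖))) := by gcongr
    _ ≤ C₁ * C₂ := by gcongr; exact h₂ x

/-- The translation is not compactly supported, so only the part over a large ball is moved first,
by `integral_contour_congr`. Letting the radius grow, dominated convergence applies because the cut
off contours share one integrable majorant. -/
theorem integral_regIntegrand_shift (hy : (doubleCoverModel X P b f hf).IsContour y)
    {t : Fin s → ℂ} (ht : t ∈ interior ((braneJ X P b f hf J).admissibleParams y))
    {N : Idx p r → ℕ} {m : Fin s → ℤ}
    (hm : ∀ a, a ∉ J → ∀ κ ∈ Set.Icc (0 : ℝ) 1,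
      0 ≤ -(κ * (theta X P b (Sum.inl a) ⬝ᵥ m : ℤ)) + N (Sum.inl a)) :
    ∫ x, regIntegrand (theta X P b) J N t (graphPoint y x) * graphJacobian y x =
      ∫ x, regIntegrand (theta X P b) J N t
        (fun k => graphPoint y x k + Complex.I * (m k : ℝ)) * graphJacobian y x := by
  set μ : Fin s → ℝ := fun k => (m k : ℝ) with hμ
  obtain ⟨C, N₀, hL⟩ := hy.lipschitz
  obtain ⟨D₁, hD₁, hD₁0, hD₁'⟩ := exists_norm_regIntegrand_le hy N t m hm
  obtain ⟨D₂, hD₂, hD₂'⟩ := exists_norm_graphJacobian_le (s := s) (|C| + ‖μ‖) N₀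
  -- contours with a Lipschitz translation factor
  have hLip : ∀ κ : (Fin s → ℝ) → ℝ, (∀ x, κ x ∈ Set.Icc (0 : ℝ) 1) →
      (∀ x x', |κ x - κ x'| ≤ ‖x - x'‖) → ∀ x x',
      ‖(y x + κ x • μ) - (y x' + κ x' • μ)‖ ≤ (|C| + ‖μ‖) * (1 + ‖x‖ + ‖x'‖) ^ N₀ * ‖x - x'‖ := by
    intro κ _ hκ x x'
    have h1 : 1 ≤ (1 + ‖x‖ + ‖x'‖) ^ N₀ :=
      one_le_pow₀ (by linarith [norm_nonneg x, norm_nonneg x'])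
    calc _ = ‖(y x - y x') + (κ x - κ x') • μ‖ := by rw [sub_smul]; congr 1; abel
      _ ≤ ‖y x - y x'‖ + |κ x - κ x'| * ‖μ‖ := by
          refine (norm_add_le _ _).trans ?_
          rw [norm_smul, Real.norm_eq_abs]
      _ ≤ |C| * (1 + ‖x‖ + ‖x'‖) ^ N₀ * ‖x - x'‖ +
          (1 + ‖x‖ + ‖x'‖) ^ N₀ * ‖x - x'‖ * ‖μ‖ := by
          refine add_le_add ((hL x x').trans ?_) ?_
          · gcongr; exact le_abs_self C
          · gcongr
            exact (hκ x x').trans (le_mul_of_one_le_left (norm_nonneg _) h1)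
      _ = _ := by ring
  have hcont : ∀ κ : (Fin s → ℝ) → ℝ, Continuous κ → Continuous fun x => y x + κ x • μ :=
    fun κ hκ => hy.continuous.add (hκ.smul continuous_const)
  have hLocal : ∀ w : (Fin s → ℝ) → (Fin s → ℝ), (∀ x x', ‖w x - w x'‖ ≤
      (|C| + ‖μ‖) * (1 + ‖x‖ + ‖x'‖) ^ N₀ * ‖x - x'‖) →
      ∀ R, ∃ K, LipschitzOnWith K w (Metric.closedBall 0 R) := by
    intro w hw R
    refine ⟨⟨(|C| + ‖μ‖) * (1 + |R| + |R|) ^ N₀, by positivity⟩,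
      LipschitzOnWith.of_dist_le_mul fun x hx x' hx' => ?_⟩
    rw [dist_eq_norm, dist_eq_norm]
    refine (hw x x').trans ?_
    change _ ≤ ((|C| + ‖μ‖) * (1 + |R| + |R|) ^ N₀) * _
    have h1 : ‖x‖ ≤ |R| := (by simpa using hx : ‖x‖ ≤ R).trans (le_abs_self R)
    have h2 : ‖x'‖ ≤ |R| := (by simpa using hx' : ‖x'‖ ≤ R).trans (le_abs_self R)
    gcongr
  have hbound : ∀ κ : (Fin s → ℝ) → ℝ, (∀ x, κ x ∈ Set.Icc (0 : ℝ) 1) →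
      (∀ x x', |κ x - κ x'| ≤ ‖x - x'‖) → ∀ x,
      ‖regIntegrand (theta X P b) J N t (graphPoint (fun x => y x + κ x • μ) x) *
        graphJacobian (fun x => y x + κ x • μ) x‖ ≤
        D₁ x * D₂ x * (braneJ X P b f hf J).majorant y t x := by
    intro κ hκ hκ' x
    have h1 := hD₁' x (κ x) (hκ x)
    have h2 := hD₂' _ (hLip κ hκ hκ') x
    rw [← graphPoint_add_smul] at h1
    have h0 := hD₁0 x
    have hM := (braneJ X P b f hf J).majorant_nonneg (y := y) t x
    rw [norm_mul]
    calc _ ≤ (D₁ x * (braneJ X P b f hf J).majorant y t x) * D₂ x :=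
          mul_le_mul h1 h2 (norm_nonneg _) (by positivity)
      _ = _ := by ring
  have hmeas : ∀ κ : (Fin s → ℝ) → ℝ, (∀ x, κ x ∈ Set.Icc (0 : ℝ) 1) → Continuous κ →
      AEStronglyMeasurable (fun x => regIntegrand (theta X P b) J N t
        (graphPoint (fun x => y x + κ x • μ) x) * graphJacobian (fun x => y x + κ x • μ) x)
        volume := fun κ hκ hκc => by
    refine aestronglyMeasurable_regIntegrand (hcont κ hκc) fun x => ?_
    have := graphPoint_mem_regDomain hy hm (l := 1) (by simp) (hκ x)
    simpa using this
  obtain ⟨g, hg, hgle⟩ := exists_integrable_bound hy ht (hD₁.mul hD₂)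
  have hint : ∀ κ : (Fin s → ℝ) → ℝ, (∀ x, κ x ∈ Set.Icc (0 : ℝ) 1) →
      (∀ x x', |κ x - κ x'| ≤ ‖x - x'‖) → Continuous κ →
      Integrable fun x => regIntegrand (theta X P b) J N t
        (graphPoint (fun x => y x + κ x • μ) x) * graphJacobian (fun x => y x + κ x • μ) x :=
    fun κ hκ hκ' hκc => hg.mono' (hmeas κ hκ hκc)
      (Eventually.of_forall fun x => (hbound κ hκ hκ' x).trans (hgle x))
  have h0 : ∀ x : Fin s → ℝ, (fun _ => 0 : (Fin s → ℝ) → ℝ) x ∈ Set.Icc (0 : ℝ) 1 :=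
    fun x => by simp
  have hL0 : ∀ x x' : Fin s → ℝ, |(0 : ℝ) - 0| ≤ ‖x - x'‖ := fun x x' => by simp
  have hcutc : ∀ R, Continuous (cutoff (s := s) R) := fun R => by unfold cutoff; fun_prop
  have hcut : ∀ R : ℕ, ∫ x, regIntegrand (theta X P b) J N t
        (graphPoint (fun x => y x + cutoff R x • μ) x) *
          graphJacobian (fun x => y x + cutoff R x • μ) x =
      ∫ x, regIntegrand (theta X P b) J N t (graphPoint y x) * graphJacobian y x := by
    intro R
    have key := integral_contour_congr (isOpen_regDomain N)
      (differentiableOn_regIntegrand (θ := theta X P b) (J := J) N t) (y 0)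
      (y1 := fun x => y x + cutoff R x • μ) (y2 := fun x => y x + (0 : ℝ) • μ)
      (hLocal _ (hLip _ (cutoff_mem R) (abs_cutoff_sub_le R)))
      (hLocal _ (hLip (fun _ => 0) h0 hL0)) (R := R + 1)
      (fun x hx => by simp only [cutoff_eq_zero hx])
      (fun l hl x => graphPoint_mem_regDomain hy hm hl (cutoff_mem R x))
      (fun l hl x => graphPoint_mem_regDomain hy hm hl (κ := fun _ => 0) (h0 x))
      (hint _ (cutoff_mem R) (abs_cutoff_sub_le R) (hcutc R))
      (hint (fun _ => 0) h0 hL0 continuous_const)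
    simpa only [zero_smul, add_zero] using key
  have hlim := tendsto_integral_of_dominated_convergence (μ := volume)
    (F := fun (R : ℕ) x => regIntegrand (theta X P b) J N t
        (graphPoint (fun x => y x + cutoff R x • μ) x) *
          graphJacobian (fun x => y x + cutoff R x • μ) x)
    (f := fun x => regIntegrand (theta X P b) J N t
        (fun k => graphPoint y x k + Complex.I * (m k : ℝ)) * graphJacobian y x) g
    (fun R => hmeas _ (cutoff_mem R) (hcutc R)) hg
    (fun R => Eventually.of_forall fun x =>
      (hbound _ (cutoff_mem R) (abs_cutoff_sub_le R) x).trans (hgle x))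
    (Eventually.of_forall fun x => ?_)
  · simp only [hcut] at hlim
    exact tendsto_nhds_unique tendsto_const_nhds hlim
  · refine tendsto_const_nhds.congr' ?_
    filter_upwards [eventually_gt_atTop ⌈‖x‖⌉₊] with R hR
    have hR' : ‖x‖ < R := (Nat.le_ceil _).trans_lt (by exact_mod_cast hR)
    -- For R > ‖x‖ the cut off contour is near x an exact translate, so point and Jacobian have
    -- already reached their limits.
    have hev : (fun x => y x + cutoff R x • μ) =ᶠ[𝓝 x] fun x => y x + μ := by
      filter_upwards [(isOpen_lt continuous_norm continuous_const).mem_nhds hR'] with z hz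
      rw [cutoff_eq_one (le_of_lt hz), one_smul]
    rw [graphJacobian_congr hev, graphJacobian_add_const, graphPoint_add_smul,
      cutoff_eq_one hR'.le]
    simp only [one_mul]

end

noncomputable section

variable {n p r s : ℕ}

/-! ### Branches of the logarithms -/

/-- A branch of the logarithms of the coordinates near `x₀`. -/
def logBranch {m : Type*} (x₀ x : m → ℂ) (c : m) : ℂ :=
  Complex.log (x c / x₀ c) + Complex.log (x₀ c)

theorem exp_logBranch {m : Type*} {x₀ x : m → ℂ} {c : m} (h₀ : x₀ c ≠ 0) (h : x c ≠ 0) :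
    Complex.exp (logBranch x₀ x c) = x c := by
  rw [logBranch, Complex.exp_add, Complex.exp_log (div_ne_zero h h₀), Complex.exp_log h₀,
    div_mul_cancel₀ _ h₀]

/-- The slit neighbourhood of `x₀`. -/
def slitNeighborhood {m : Type*} (x₀ : m → ℂ) : Set (m → ℂ) :=
  {x | ∀ c, x c / x₀ c ∈ Complex.slitPlane}

theorem isOpen_slitNeighborhood {m : Type*} [Finite m] (x₀ : m → ℂ) :
    IsOpen (slitNeighborhood x₀) := by
  simp only [slitNeighborhood, Set.ofPred_forall]
  exact isOpen_iInter_of_finite fun c =>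
    Complex.isOpen_slitPlane.preimage ((continuous_apply c).div_const _)

theorem isLogChart_logBranch {m : Type*} [Fintype m] [DecidableEq m] {W : Set (m → ℂ)}
    {x₀ : m → ℂ} (hW : IsOpen W)
    (hW0 : ∀ x ∈ W, ∀ c, x c ≠ 0) (hx₀ : ∀ c, x₀ c ≠ 0) (hWs : W ⊆ slitNeighborhood x₀) :
    IsLogChart W (logBranch x₀) where
  isOpen := hW
  ne_zero := hW0
  exp_eq x hx c := exp_logBranch (hx₀ c) (hW0 x hx c)
  analyticAt x hx := by
    rw [show logBranch x₀ = fun x c => logBranch x₀ x c from rfl, analyticAt_pi_iff]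
    intro c
    unfold logBranch
    refine AnalyticAt.add (AnalyticAt.clog ?_ (hWs hx c)) analyticAt_const
    exact ((ContinuousLinearMap.proj (R := ℂ) (φ := fun _ : m => ℂ) c).analyticAt x).div_const

/-- Two logarithms of the same number closer than 1 are equal. Used to compare a given continuous
branch with an explicit one. -/
theorem eventually_eq_of_exp_eq {E : Type*} [TopologicalSpace E] {h : E → ℂ} {x₀ : E}
    (hc : ContinuousAt h x₀) (he : ∀ᶠ x in 𝓝 x₀, Complex.exp (-h x) = Complex.exp (-h x₀)) :
    ∀ᶠ x in 𝓝 x₀, h x = h x₀ := by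
  have h1 : ∀ᶠ x in 𝓝 x₀, ‖h x - h x₀‖ < 1 := by
    have := Metric.tendsto_nhds.mp hc 1 one_pos
    simpa only [dist_eq_norm] using this
  filter_upwards [he, h1] with x hx hx1
  have h2 : Complex.exp (h x - h x₀) = 1 := by
    rw [show h x - h x₀ = -h x₀ - -h x by ring, Complex.exp_sub, hx, div_self (Complex.exp_ne_zero _)]
  have h3 := (Complex.abs_im_le_norm (h x - h x₀)).trans_lt hx1
  rw [abs_lt] at h3
  have h4 := Complex.log_exp (x := h x - h x₀) (by linarith [Real.pi_gt_three])
    (by linarith [Real.pi_gt_three])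
  rw [h2, Complex.log_one] at h4
  exact (sub_eq_zero.mp h4.symm)

theorem eventually_eq_of_sq_eq_one {E : Type*} [TopologicalSpace E] {h : E → ℂ} {x₀ : E}
    (hc : ContinuousAt h x₀) (he : ∀ᶠ x in 𝓝 x₀, h x ^ 2 = 1) : ∀ᶠ x in 𝓝 x₀, h x = h x₀ := by
  have h1 : ∀ᶠ x in 𝓝 x₀, ‖h x - h x₀‖ < 2 := by
    have := Metric.tendsto_nhds.mp hc 2 two_pos
    simpa only [dist_eq_norm] using this
  have h0 := he.self_of_nhds
  filter_upwards [he, h1] with x hx hx1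
  rcases sq_eq_sq_iff_eq_or_eq_neg.mp (hx.trans h0.symm) with h2 | h2
  · exact h2
  · rcases sq_eq_sq_iff_eq_or_eq_neg.mp (h0.trans (one_pow 2).symm) with h3 | h3
    all_goals
      rw [h2, h3] at hx1
      norm_num at hx1

/-- The linear form `t_k` in the logarithms of the coordinates, up to a constant. -/
def logParam (θ : Idx p r → Fin s → ℤ) (Λ : Idx p r → ℂ) (k : Fin s) : ℂ :=
  ∑ i, (θ (Sum.inr i) k : ℂ) * Λ (Sum.inr i) - ∑ a, (θ (Sum.inl a) k : ℂ) * Λ (Sum.inl a)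

theorem qVariable_eq {θ : Idx p r → Fin s → ℤ} {x Λ : Idx p r → ℂ}
    (h : ∀ c, Complex.exp (Λ c) = x c) (k : Fin s) :
    qVariable θ x k = (∏ a, (-4 : ℂ) ^ θ (Sum.inl a) k) * Complex.exp (-logParam θ Λ k) := by
  rw [qVariable, logParam, neg_sub, Complex.exp_sub, Complex.exp_sum, Complex.exp_sum,
    div_eq_mul_inv, ← Finset.prod_inv_distrib, ← mul_assoc, ← Finset.prod_mul_distrib]
  congr 1
  · refine Finset.prod_congr rfl fun a _ => ?_
    rw [mul_zpow, Complex.exp_int_mul, h]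
  · refine Finset.prod_congr rfl fun i _ => ?_
    rw [Complex.exp_int_mul, h, zpow_neg]

/-- Locally, branches of `t` and of the square root are given by branches of the logarithms. -/
theorem exists_logChart {θ : Idx p r → Fin s → ℤ} {U : Set (Idx p r → ℂ)} (hU : IsOpen U)
    (hU0 : ∀ x ∈ U, ∀ c, x c ≠ 0) {t : (Idx p r → ℂ) → Fin s → ℂ} (ht : ContinuousOn t U)
    (htq : ∀ x ∈ U, ∀ k, Complex.exp (-t x k) = qVariable θ x k)
    {root : (Idx p r → ℂ) → ℂ} (hroot : ContinuousOn root U)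
    (hroot2 : ∀ x ∈ U, root x ^ 2 = ∏ i, x (Sum.inr i)) {x₀ : Idx p r → ℂ} (hx₀ : x₀ ∈ U) :
    ∃ (W : Set (Idx p r → ℂ)) (Λ : (Idx p r → ℂ) → Idx p r → ℂ) (τ : Fin s → ℂ) (ρ : ℂ),
      x₀ ∈ W ∧ W ⊆ U ∧ IsLogChart W Λ ∧ (∀ x ∈ W, ∀ k, t x k = logParam θ (Λ x) k + τ k) ∧
      ∀ x ∈ W, (root x)⁻¹ = ρ * Complex.exp (-(1 / 2 * ∑ i, Λ x (Sum.inr i))) := by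
  have h0 := hU0 x₀ hx₀
  have hV : IsOpen (U ∩ slitNeighborhood x₀) := hU.inter (isOpen_slitNeighborhood x₀)
  have hxV : x₀ ∈ U ∩ slitNeighborhood x₀ := ⟨hx₀, fun c => by
    rw [div_self (h0 c)]; exact Complex.one_mem_slitPlane⟩
  have chart : ∀ W, IsOpen W → W ⊆ U ∩ slitNeighborhood x₀ → IsLogChart W (logBranch x₀) :=
    fun W hW hWV => isLogChart_logBranch hW (fun x hx => hU0 x (hWV hx).1) h0
      fun x hx => (hWV hx).2
  have hΛ := ((chart _ hV subset_rfl).analyticAt x₀ hxV).continuousAt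
  have hΛc : ∀ c, ContinuousAt (fun x => logBranch x₀ x c) x₀ := fun c =>
    (continuous_apply c).continuousAt.comp hΛ
  have hexp := (chart _ hV subset_rfl).exp_eq
  -- Both t_k and the linear form in the logarithms exponentiate to q_k up to the constant ∏(-4)^θ,
  -- so their difference is locally constant.
  have e1 : ∀ k, ∀ᶠ x in 𝓝 x₀, t x k - logParam θ (logBranch x₀ x) k =
      t x₀ k - logParam θ (logBranch x₀ x₀) k := by
    intro k
    have hval : ∀ x ∈ U ∩ slitNeighborhood x₀,
        Complex.exp (-(t x k - logParam θ (logBranch x₀ x) k)) =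
          ∏ a, (-4 : ℂ) ^ θ (Sum.inl a) k := by
      intro x hx
      rw [neg_sub, sub_eq_add_neg, Complex.exp_add, htq x hx.1, qVariable_eq (hexp x hx),
        mul_left_comm, ← Complex.exp_add, add_neg_cancel, Complex.exp_zero, mul_one]
    refine eventually_eq_of_exp_eq (h := fun x => t x k - logParam θ (logBranch x₀ x) k) ?_ ?_
    · have h2 : ContinuousAt (fun x => t x k) x₀ :=
        (continuous_apply k).continuousAt.comp (ht.continuousAt (hU.mem_nhds hx₀))
      unfold logParam
      fun_prop
    · filter_upwards [hV.mem_nhds hxV] with x hx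
      rw [hval x hx, hval x₀ hxV]
  have e2 : ∀ᶠ x in 𝓝 x₀, root x * Complex.exp (-(1 / 2 * ∑ i, logBranch x₀ x (Sum.inr i))) =
      root x₀ * Complex.exp (-(1 / 2 * ∑ i, logBranch x₀ x₀ (Sum.inr i))) := by
    refine eventually_eq_of_sq_eq_one
      (h := fun x => root x * Complex.exp (-(1 / 2 * ∑ i, logBranch x₀ x (Sum.inr i)))) ?_ ?_
    · have h2 := hroot.continuousAt (hU.mem_nhds hx₀)
      fun_prop
    · filter_upwards [hV.mem_nhds hxV] with x hx
      have h3 : ∏ i, x (Sum.inr i) = Complex.exp (∑ i, logBranch x₀ x (Sum.inr i)) := by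
        rw [Complex.exp_sum]
        exact Finset.prod_congr rfl fun i _ => (hexp x hx _).symm
      rw [mul_pow, hroot2 x hx.1, h3, ← Complex.exp_nat_mul, ← Complex.exp_add]
      convert Complex.exp_zero using 2
      push_cast; ring
  obtain ⟨W, hWsub, hWo, hxW⟩ := eventually_nhds_iff.mp
    ((eventually_all.mpr e1).and (e2.and (hV.mem_nhds hxV)))
  refine ⟨W, logBranch x₀, fun k => t x₀ k - logParam θ (logBranch x₀ x₀) k,
    (root x₀ * Complex.exp (-(1 / 2 * ∑ i, logBranch x₀ x₀ (Sum.inr i))))⁻¹, hxW,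
    fun x hx => (hWsub x hx).2.2.1, chart W hWo fun x hx => (hWsub x hx).2.2, fun x hx k => ?_,
    fun x hx => ?_⟩
  · have := (hWsub x hx).1 k
    linear_combination this
  · rw [← (hWsub x hx).2.1, mul_inv, mul_assoc, inv_mul_cancel₀ (Complex.exp_ne_zero _), mul_one]

/-! ### The hemisphere partition function as a GKZ integral -/

section Model

variable {J : Finset (Fin p)}
  {X : SmoothCompleteFan n p} {P : X.NefPartition r} {b : Module.Basis (Fin s) ℤ X.Cl}
  {f : Fin r → MvPolynomial (Fin p) ℂ} {hf : IsSectionFamily (theta X P b) f}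
  {y : (Fin s → ℝ) → (Fin s → ℝ)}

/-- Regrouping i t(σ) by the coordinates x_c instead of by k; the -1/2 in the exponents of the parts
is the prefactor (∏ x_{i,0})^{-1/2}. -/
theorem sum_gkzExponent_mul {θ : Idx p r → Fin s → ℤ} (σ τ : Fin s → ℂ) (Λ : Idx p r → ℂ) :
    Complex.I * ∑ k, τ k * σ k + ∑ c, gkzExponent c (weightArg θ c σ) * Λ c =
      -(1 / 2 * ∑ i, Λ (Sum.inr i)) + Complex.I * ∑ k, (logParam θ Λ k + τ k) * σ k := by
  have h1 : ∑ a : Fin p, -(Complex.I * ∑ k, (θ (Sum.inl a) k : ℂ) * σ k) * Λ (Sum.inl a) =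
      -(Complex.I * ∑ k, (∑ a, (θ (Sum.inl a) k : ℂ) * Λ (Sum.inl a)) * σ k) := by
    simp only [Finset.mul_sum, Finset.sum_mul, ← Finset.sum_neg_distrib]
    rw [Finset.sum_comm]
    exact Finset.sum_congr rfl fun _ _ => Finset.sum_congr rfl fun _ _ => by ring
  have h2 : ∑ i : Fin r, (Complex.I * ∑ k, (θ (Sum.inr i) k : ℂ) * σ k) * Λ (Sum.inr i) =
      Complex.I * ∑ k, (∑ i, (θ (Sum.inr i) k : ℂ) * Λ (Sum.inr i)) * σ k := by
    simp only [Finset.mul_sum, Finset.sum_mul]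
    rw [Finset.sum_comm]
    exact Finset.sum_congr rfl fun _ _ => Finset.sum_congr rfl fun _ _ => by ring
  simp only [Fintype.sum_sum_type, gkzExponent, weightArg, pairing, logParam, sub_mul, add_mul,
    Finset.sum_add_distrib, Finset.sum_sub_distrib]
  rw [h1, h2, ← Finset.mul_sum]
  ring

theorem continuous_gkzExponent (hy : (doubleCoverModel X P b f hf).IsContour y) (c : Idx p r) :
    Continuous fun x => gkzExponent c (weightArg (theta X P b) c (graphPoint y x)) := by
  have h : Continuous fun x => weightArg (theta X P b) c (graphPoint y x) :=
    continuous_const.mul (hy.continuous_pairing _)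
  rcases c with a | i
  · exact h.neg
  · exact h.sub continuous_const

variable {W : Set (Idx p r → ℂ)} {Λ : (Idx p r → ℂ) → Idx p r → ℂ}
  {t : (Idx p r → ℂ) → Fin s → ℂ} {root : (Idx p r → ℂ) → ℂ} {τ : Fin s → ℂ} {ρ : ℂ}

/-- The left side separates a fixed density from the dependence on x, as differentiation requires;
the right side is pole-free and carries the estimates. The constant τ need not be admissible: the
density is never integrated without its monomial. -/
theorem gkz_integrand_eq (hy : (doubleCoverModel X P b f hf).IsContour y) (hΛ : IsLogChart W Λ)
    (htW : ∀ x ∈ W, ∀ k, t x k = logParam (theta X P b) (Λ x) k + τ k)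
    (hrW : ∀ x ∈ W, (root x)⁻¹ = ρ * Complex.exp (-(1 / 2 * ∑ i, Λ x (Sum.inr i))))
    (N : Idx p r → ℕ) {x : Idx p r → ℂ} (hx : x ∈ W) (ξ : Fin s → ℝ) :
    (ρ * (braneJ X P b f hf J).integrand y τ ξ) *
        (∏ c, fallProd (gkzExponent c (weightArg (theta X P b) c (graphPoint y ξ))) (N c)) *
        Complex.exp (∑ c, (gkzExponent c (weightArg (theta X P b) c (graphPoint y ξ)) - N c) *
          Λ x c) =
      ((root x)⁻¹ * ∏ c, x c ^ (-(N c : ℤ))) *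
        (regIntegrand (theta X P b) J N (t x) (graphPoint y ξ) * graphJacobian y ξ) := by
  have h1 : Complex.exp (∑ c, (gkzExponent c (weightArg (theta X P b) c (graphPoint y ξ)) - N c) *
      Λ x c) = Complex.exp (∑ c, gkzExponent c (weightArg (theta X P b) c (graphPoint y ξ)) *
        Λ x c) * ∏ c, x c ^ (-(N c : ℤ)) := by
    simp only [sub_mul, Finset.sum_sub_distrib]
    rw [sub_eq_add_neg, Complex.exp_add, ← Finset.sum_neg_distrib]
    congr 1
    rw [Complex.exp_sum]
    refine Finset.prod_congr rfl fun c _ => ?_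
    rw [← hΛ.exp_eq x hx c, ← Complex.exp_int_mul]
    push_cast; ring_nf
  have h2 := congrArg Complex.exp (sum_gkzExponent_mul (θ := theta X P b) (graphPoint y ξ) τ (Λ x))
  rw [Complex.exp_add, Complex.exp_add] at h2
  have h3 := gammaProduct_mul_factor_eq (J := J) hy N ξ
  simp only [← htW x hx] at h2
  rw [h1, hrW x hx, Brane.integrand, regIntegrand, ← h3]
  linear_combination (ρ * (doubleCoverModel X P b f hf).gammaProduct (graphPoint y ξ) *
      (braneJ X P b f hf J).factor (graphPoint y ξ) *
      (∏ c, fallProd (gkzExponent c (weightArg (theta X P b) c (graphPoint y ξ))) (N c)) *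
      (∏ c, x c ^ (-(N c : ℤ))) * graphJacobian y ξ) * h2

theorem gkzIntegral_eq (hy : (doubleCoverModel X P b f hf).IsContour y) (hΛ : IsLogChart W Λ)
    (htW : ∀ x ∈ W, ∀ k, t x k = logParam (theta X P b) (Λ x) k + τ k)
    (hrW : ∀ x ∈ W, (root x)⁻¹ = ρ * Complex.exp (-(1 / 2 * ∑ i, Λ x (Sum.inr i))))
    (N : Idx p r → ℕ) {x : Idx p r → ℂ} (hx : x ∈ W) :
    gkzIntegral volume (fun ξ => ρ * (braneJ X P b f hf J).integrand y τ ξ)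
      (fun ξ c => gkzExponent c (weightArg (theta X P b) c (graphPoint y ξ))) Λ N x =
      ((root x)⁻¹ * ∏ c, x c ^ (-(N c : ℤ))) *
        ∫ ξ, regIntegrand (theta X P b) J N (t x) (graphPoint y ξ) * graphJacobian y ξ := by
  rw [gkzIntegral, expIntegral, ← integral_const_mul]
  exact integral_congr_ae (Eventually.of_forall fun ξ => gkz_integrand_eq hy hΛ htW hrW N hx ξ)

theorem hemisphere_eq (hy : (doubleCoverModel X P b f hf).IsContour y) (t : Fin s → ℂ) :
    (braneJ X P b f hf J).hemisphere y t =
      ∫ ξ, regIntegrand (theta X P b) J 0 t (graphPoint y ξ) * graphJacobian y ξ := by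
  refine integral_congr_ae (Eventually.of_forall fun ξ => ?_)
  have h3 := gammaProduct_mul_factor_eq (J := J) hy 0 ξ
  simp only [fallProd, Pi.zero_apply, Finset.range_zero, Finset.prod_empty, Finset.prod_const_one,
    mul_one] at h3
  simp only [Brane.integrand, regIntegrand, h3, Pi.zero_apply]

theorem exists_sum_norm_gkzExponent_le (θ : Idx p r → Fin s → ℤ) (N : Idx p r → ℕ) :
    ∃ A : ℝ, 0 < A ∧ ∀ σ : Fin s → ℂ,
      ∑ c, ‖gkzExponent c (weightArg θ c σ) - N c‖ ≤ A * (1 + ∑ k, ‖σ k‖) := by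
  have h1 : ∀ c, ∃ A : ℝ, 0 ≤ A ∧ ∀ σ : Fin s → ℂ,
      ‖gkzExponent c (weightArg θ c σ) - N c‖ ≤ A * (1 + ∑ k, ‖σ k‖) := by
    intro c
    refine ⟨1 / 2 + N c + ∑ k, ‖(θ c k : ℂ)‖, by positivity, fun σ => ?_⟩
    have hS : 0 ≤ ∑ k, ‖σ k‖ := by positivity
    have hw : ‖weightArg θ c σ‖ ≤ (∑ k, ‖(θ c k : ℂ)‖) * ∑ k, ‖σ k‖ := by
      rw [weightArg, norm_mul, Complex.norm_I, one_mul, Finset.sum_mul]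
      refine (norm_pairing_le _ _).trans (Finset.sum_le_sum fun k _ => ?_)
      gcongr
      exact Finset.single_le_sum (f := fun k => ‖σ k‖) (fun _ _ => norm_nonneg _)
        (Finset.mem_univ k)
    have hu : ‖gkzExponent c (weightArg θ c σ)‖ ≤ ‖weightArg θ c σ‖ + 1 / 2 := by
      rcases c with a | i
      · simp [gkzExponent]
      · refine (norm_sub_le _ _).trans ?_
        norm_num
    have hN : ‖(N c : ℂ)‖ = N c := Complex.norm_natCast _
    have hT : 0 ≤ ∑ k, ‖(θ c k : ℂ)‖ := by positivity
    have hN0 : (0 : ℝ) ≤ N c := by positivity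
    calc _ ≤ ‖gkzExponent c (weightArg θ c σ)‖ + ‖(N c : ℂ)‖ := norm_sub_le _ _
      _ ≤ (∑ k, ‖(θ c k : ℂ)‖) * (∑ k, ‖σ k‖) + 1 / 2 + N c := by rw [hN]; linarith
      _ ≤ _ := by nlinarith
  choose A hA hA' using h1
  refine ⟨1 + ∑ c, A c, by have := Finset.sum_nonneg fun c (_ : c ∈ Finset.univ) => hA c; linarith,
    fun σ => (Finset.sum_le_sum fun c _ => hA' c σ).trans ?_⟩
  rw [← Finset.sum_mul]
  have hS : 0 ≤ ∑ k, ‖σ k‖ := by positivity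
  gcongr
  linarith

/-- The exponents grow linearly in σ, so the exponential room in ∑|σ_k| given by the interior
condition is room in the exponents too; the pole-free form bounds the density for every N. -/
theorem hasExpMoment_gkz (hy : (doubleCoverModel X P b f hf).IsContour y) (hΛ : IsLogChart W Λ)
    (htW : ∀ x ∈ W, ∀ k, t x k = logParam (theta X P b) (Λ x) k + τ k)
    (hrW : ∀ x ∈ W, (root x)⁻¹ = ρ * Complex.exp (-(1 / 2 * ∑ i, Λ x (Sum.inr i))))
    (hadm : ∀ x ∈ W, t x ∈ interior ((braneJ X P b f hf J).admissibleParams y))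
    (N : Idx p r → ℕ) {x : Idx p r → ℂ} (hx : x ∈ W) :
    HasExpMoment volume (fun ξ => (ρ * (braneJ X P b f hf J).integrand y τ ξ) *
        ∏ c, fallProd (gkzExponent c (weightArg (theta X P b) c (graphPoint y ξ))) (N c))
      (fun ξ c => gkzExponent c (weightArg (theta X P b) c (graphPoint y ξ)) - N c) (Λ x) := by
  obtain ⟨ε, hε, h⟩ := exists_integrable_mul_exp hy (hadm x hx)
  obtain ⟨A, hA, hA'⟩ := exists_sum_norm_gkzExponent_le (theta X P b) N
  obtain ⟨D₁, hD₁, hD₁0, hD₁'⟩ := exists_norm_regIntegrand_le (J := J) hy N (t x) 0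
    (fun a _ κ _ => by simp)
  obtain ⟨C, N₀, hL⟩ := hy.lipschitz
  obtain ⟨D₂, hD₂, hD₂'⟩ := exists_norm_graphJacobian_le (s := s) C N₀
  obtain ⟨K, hK⟩ : ∃ K, K = (root x)⁻¹ * ∏ c, x c ^ (-(N c : ℤ)) := ⟨_, rfl⟩
  have hmeas : AEStronglyMeasurable (fun ξ => (ρ * (braneJ X P b f hf J).integrand y τ ξ) *
        (∏ c, fallProd (gkzExponent c (weightArg (theta X P b) c (graphPoint y ξ))) (N c)) *
        Complex.exp (∑ c, (gkzExponent c (weightArg (theta X P b) c (graphPoint y ξ)) - N c) *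
          Λ x c)) volume := by
    have hu := fun c => continuous_gkzExponent (c := c) hy
    refine (aestronglyMeasurable_mul_fallProd
      ((hy.aestronglyMeasurable_integrand _ τ).const_mul ρ)
      (u := fun ξ c => gkzExponent c (weightArg (theta X P b) c (graphPoint y ξ)))
      (fun c => (hu c).aestronglyMeasurable) N).mul (Continuous.aestronglyMeasurable ?_)
    fun_prop
  have hb := h (fun ξ => ‖K‖ * (D₁ ξ * D₂ ξ)) _ ((PolyBounded.const _).mul (hD₁.mul hD₂))
    hmeas.norm (fun ξ => ?_)
  -- Since ∑‖u_c - N_c‖ ≤ A(1 + ∑|σ_k|), the rate ε/A costs e^ε times the available exponential.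
  · refine ⟨ε / A, div_pos hε hA, (hb.const_mul (Real.exp ε)).mono' ?_
      (Eventually.of_forall fun ξ => ?_)⟩
    · refine hmeas.norm.mul (Continuous.aestronglyMeasurable ?_)
      have hu := fun c => continuous_gkzExponent (c := c) hy
      fun_prop
    · rw [norm_mul, norm_norm, Real.norm_eq_abs, Real.abs_exp, mul_left_comm, ← Real.exp_add]
      gcongr
      calc ε / A * _ ≤ ε / A * (A * (1 + ∑ k, ‖graphPoint y ξ k‖)) := by
            gcongr
            exact hA' _
        _ = _ := by field_simp
  · rw [abs_norm, gkz_integrand_eq hy hΛ htW hrW N hx ξ, ← hK, norm_mul, norm_mul]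
    have h1 := hD₁' ξ 0 (by simp)
    simp only [zero_mul, Complex.ofReal_zero, mul_zero, add_zero] at h1
    have h2 := hD₂' y hL ξ
    have hM := (braneJ X P b f hf J).majorant_nonneg (y := y) (t x) ξ
    have h0 := hD₁0 ξ
    calc _ ≤ ‖K‖ * ((D₁ ξ * (braneJ X P b f hf J).majorant y (t x) ξ) * D₂ ξ) := by gcongr
      _ = _ := by ring

end Model

end
end DoubleCoverPeriods

/-! ### Assembly of the theorem -/

open DoubleCoverPeriods in
theorem theorem4p1 {n p r s : ℕ} (X : SmoothCompleteFan n p) (P : X.NefPartition r)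
    (b : Module.Basis (Fin s) ℤ X.Cl) (hb : ∀ k, X.IsAmpleClass (b k))
    (f : Fin r → MvPolynomial (Fin p) ℂ) (hf : IsSectionFamily (theta X P b) f)
    (J : Finset (Fin p))
    (y : (Fin s → ℝ) → (Fin s → ℝ)) (hy : (doubleCoverModel X P b f hf).IsContour y)
    (U : Set (Idx p r → ℂ)) (hU : IsOpen U) (hU0 : ∀ x ∈ U, ∀ c, x c ≠ 0)
    (t : (Idx p r → ℂ) → Fin s → ℂ) (ht : ContinuousOn t U)
    (htq : ∀ x ∈ U, ∀ k, Complex.exp (-t x k) = qVariable (theta X P b) x k)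
    (root : (Idx p r → ℂ) → ℂ) (hroot : ContinuousOn root U)
    (hroot2 : ∀ x ∈ U, root x ^ 2 = ∏ i, x (Sum.inr i))
    (hadm : ∀ x ∈ U, t x ∈ interior ((braneJ X P b f hf J).admissibleParams y)) :
    (∀ x ∈ U, MeasureTheory.Integrable ((braneJ X P b f hf J).integrand y (t x))) ∧
      IsGKZSolution (gkzMatrix X P) (gkzBeta r n) U
        (fun x => (root x)⁻¹ * (braneJ X P b f hf J).hemisphere y (t x)) := by
  refine ⟨fun x hx => integrable_integrand hy (hadm x hx), ?_⟩
  -- All claims are local, so a chart with branches of the logarithms around each point suffices;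
  -- the density g depends on the chart, the integral on the right does not.
  have main : ∀ x₀ ∈ U, ∃ (W : Set (Idx p r → ℂ)) (Λ : (Idx p r → ℂ) → Idx p r → ℂ)
      (g : (Fin s → ℝ) → ℂ), x₀ ∈ W ∧ W ⊆ U ∧ IsLogChart W Λ ∧
      MeasureTheory.AEStronglyMeasurable g MeasureTheory.volume ∧
      (∀ (N : Idx p r → ℕ), ∀ x ∈ W, HasExpMoment MeasureTheory.volume
        (fun ξ => g ξ * ∏ c, fallProd (gkzExponent c (weightArg (theta X P b) c
          (graphPoint y ξ))) (N c))
        (fun ξ c => gkzExponent c (weightArg (theta X P b) c (graphPoint y ξ)) - N c) (Λ x)) ∧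
      ∀ (N : Idx p r → ℕ), ∀ x ∈ W, gkzIntegral MeasureTheory.volume g
        (fun ξ c => gkzExponent c (weightArg (theta X P b) c (graphPoint y ξ))) Λ N x =
        ((root x)⁻¹ * ∏ c, x c ^ (-(N c : ℤ))) * ∫ ξ, regIntegrand (theta X P b) J N (t x)
          (graphPoint y ξ) * graphJacobian y ξ := by
    intro x₀ hx₀
    obtain ⟨W, Λ, τ, ρ, hxW, hWU, hΛ, htW, hrW⟩ :=
      exists_logChart hU hU0 ht htq hroot hroot2 hx₀
    exact ⟨W, Λ, fun ξ => ρ * (braneJ X P b f hf J).integrand y τ ξ, hxW, hWU, hΛ,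
      (hy.aestronglyMeasurable_integrand _ τ).const_mul ρ,
      fun N x hx => hasExpMoment_gkz hy hΛ htW hrW (fun x hx => hadm x (hWU hx)) N hx,
      fun N x hx => gkzIntegral_eq hy hΛ htW hrW N hx⟩
  have hu : ∀ c, MeasureTheory.AEStronglyMeasurable
      (fun ξ => gkzExponent c (weightArg (theta X P b) c (graphPoint y ξ)))
      MeasureTheory.volume := fun c => (continuous_gkzExponent hy c).aestronglyMeasurable
  have hZ : ∀ x, (root x)⁻¹ * (braneJ X P b f hf J).hemisphere y (t x) =
      ((root x)⁻¹ * ∏ c, x c ^ (-(((0 : Idx p r → ℕ) c : ℕ) : ℤ))) *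
        ∫ ξ, regIntegrand (theta X P b) J 0 (t x) (graphPoint y ξ) * graphJacobian y ξ := by
    intro x
    rw [hemisphere_eq hy]
    simp
  refine ⟨fun x₀ hx₀ => ?_, fun x₀ hx₀ l => ?_, fun ℓp ℓm hℓ x₀ hx₀ => ?_⟩
  · obtain ⟨W, Λ, g, hxW, hWU, hΛ, hg, hmom, hint⟩ := main x₀ hx₀
    have h1 := (analyticAt_expIntegral (aestronglyMeasurable_mul_fallProd hg hu 0)
      (fun c => (hu c).sub MeasureTheory.aestronglyMeasurable_const) (hmom 0 x₀ hxW)).comp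
      (hΛ.analyticAt x₀ hxW)
    refine h1.congr ?_
    filter_upwards [hΛ.isOpen.mem_nhds hxW] with x hx
    exact (hint 0 x hx).trans (hZ x).symm
  · obtain ⟨W, Λ, g, hxW, hWU, hΛ, hg, hmom, hint⟩ := main x₀ hx₀
    have hEq : Set.EqOn (fun x => (root x)⁻¹ * (braneJ X P b f hf J).hemisphere y (t x))
        (gkzIntegral MeasureTheory.volume g
        (fun ξ c => gkzExponent c (weightArg (theta X P b) c (graphPoint y ξ))) Λ 0) W :=
      fun x hx => (hZ x).trans (hint 0 x hx).symm
    have hm0 : HasExpMoment MeasureTheory.volume g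
        (fun ξ c => gkzExponent c (weightArg (theta X P b) c (graphPoint y ξ))) (Λ x₀) := by
      simpa [fallProd] using hmom 0 x₀ hxW
    have h1 := euler_gkzIntegral hΛ hg hu hxW hm0 (A := fun c => (gkzMatrix X P l c : ℂ))
      (fun ξ => sum_gkzMatrix_mul_gkzExponent X P b (graphPoint y ξ) l)
    rw [← hEq hxW] at h1
    rw [← h1]
    exact Finset.sum_congr rfl fun c _ => by rw [partialDeriv_eqOn hΛ.isOpen hEq c hxW]
  · obtain ⟨W, Λ, g, hxW, hWU, hΛ, hg, hmom, hint⟩ := main x₀ hx₀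
    have hEq : Set.EqOn (fun x => (root x)⁻¹ * (braneJ X P b f hf J).hemisphere y (t x))
        (gkzIntegral MeasureTheory.volume g
        (fun ξ c => gkzExponent c (weightArg (theta X P b) c (graphPoint y ξ))) Λ 0) W :=
      fun x hx => (hZ x).trans (hint 0 x hx).symm
    have hk : (gkzMatrix X P).mulVec (fun c => (ℓp c : ℤ) - ℓm c) = 0 := by
      have : (fun c => (ℓp c : ℤ) - ℓm c) = (fun c => (ℓp c : ℤ)) - fun c => (ℓm c : ℤ) := rfl
      rw [this, Matrix.mulVec_sub, hℓ, sub_self]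
    obtain ⟨m, hm1, hm2⟩ := exists_dotProduct_theta_eq b hk
    have hm3 := sum_eq_zero_of_gkzMatrix_mulVec_eq_zero hk
    have hx0 := hU0 x₀ hx₀
    rw [multiPartial_eqOn_gkzIntegral hΛ hg hu hmom hEq ℓp hxW,
      multiPartial_eqOn_gkzIntegral hΛ hg hu hmom hEq ℓm hxW, hint ℓp x₀ hxW, hint ℓm x₀ hxW,
      integral_regIntegrand_shift hy (hadm x₀ hx₀) (m := m) (fun a _ κ hκ => ?_)]
    -- On the translated contour the ℓ⁺-integrand is x^{ℓ⁺ - ℓ⁻} times the ℓ⁻-integrand, and x^{-ℓ⁺}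
    -- x^{ℓ⁺ - ℓ⁻} = x^{-ℓ⁻}.
    · simp only [regIntegrand_shift hm1 hm2 hm3 hx0 (htq x₀ hx₀), mul_assoc]
      rw [MeasureTheory.integral_const_mul, ← mul_assoc (∏ c, x₀ c ^ (-(ℓp c : ℤ))),
        ← Finset.prod_mul_distrib]
      have hp : ∀ c, x₀ c ^ (-(ℓp c : ℤ)) * x₀ c ^ ((ℓp c : ℤ) - ℓm c) = x₀ c ^ (-(ℓm c : ℤ)) :=
        fun c => by rw [← zpow_add₀ (hx0 c)]; congr 1; ring
      simp only [hp]
    -- The shift ℓ⁺ - κ(ℓ⁺ - ℓ⁻) is the convex combination (1 - κ)ℓ⁺ + κℓ⁻ ≥ 0, so no pole is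
    -- crossed.
    · rw [hm1]
      push_cast
      have h1 : (0 : ℝ) ≤ ℓp (Sum.inl a) := Nat.cast_nonneg _
      have h2 : (0 : ℝ) ≤ ℓm (Sum.inl a) := Nat.cast_nonneg _
      have h3 := mul_nonneg hκ.1 h2
      have h4 := mul_nonneg (sub_nonneg.mpr hκ.2) h1
      linarith
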